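/- Let $n=p_1\cdots p_k$ be a positive square-free integer with $n\equiv 1\pmod 8$ and all primes $p_i\equiv 1\pmod 4$. Let $E^{(n)}: y^2=x^3-n^2x$ over $\mathbb Q$. Identify $\mathrm{Sel}_2(E^{(n)})$ with the group of triples $\Lambda=(d_1,d_2,d_3)\in(\mathbb Q^\times/\mathbb Q^{\times 2})^3$ such that $d_1d_2d_3\in\mathbb Q^{\times 2}$ and the curve $$D_\Lambda:\quad -nt^2+d_2u_2^2-d_3u_3^2=0,\quad -nt^2+d_3u_3^2-d_1u_1^2=0,\quad 2nt^2+d_1u_1^2-d_2u_2^2=0$$ in $\mathbb P^3$ has points over $\mathbb R$ and over $\mathbb Q_p$ for every prime $p$. Embed $E^{(n)}(\mathbb Q)[2]$ in it by the Kummer map $(x,y)\mapsto(x-n,x+n,x)$, where a vanishing component is replaced by the product of the other two and $O\mapsto(1,1,1)$. Put $$s_2(n)=\dim_{\mathbb F_2}\mathrm{Sel}_2(E^{(n)})/E^{(n)}(\mathbb Q)[2],\qquad h_4(n)=\dim_{\mathbb F_2}2\mathcal A_n/4\mathcal A_n,$$ where $\mathcal A_n$ is the ideal class group of $\mathbb Q(\sqrt{-n})$,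 written additively. For a prime $p$ and an integer $a$ coprime to $p$ let $\left[\frac ap\right]\in\mathbb F_2$ be $0$ if the Legendre symbol $\left(\frac ap\right)$ is $1$, and $1$ otherwise. Let $A=(a_{ij})$ be the $k\times k$ matrix over $\mathbb F_2$ with $a_{ij}=\left[\frac{p_j}{p_i}\right]$ for $i\ne j$ and $a_{ii}=\sum_{l\ne i}a_{il}$; let $B=\left(\left[\frac2{p_1}\right],\dots,\left[\frac2{p_k}\right]\right)^T$ and $x_0=(1,\dots,1)^T$. Then $s_2(n)=2$ if and only if $h_4(n)=1$. Suppose moreover that $h_4(n)=1$. (a) If $\operatorname{rank}A=k-2$, then there is $x\in\mathbb F_2^k$ with $Ax=0$ and $x\ne 0,x_0$. For every such $x$, put $d=\prod_i p_i^{x_i}$ and $d^*=d$. (b) If $\operatorname{rank}A\ne k-2$, then there is $x\in\mathbb F_2^k$ with $Ax=B$. For every such $x$, put $d=\prod_i p_i^{x_i}$ and $d^*=n/d$. In both cases, for every such $x$, the triples $(n,n,1)$ and $(d,d^*,dd^*)$ lie in $\mathrm{Sel}_2(E^{(n)})$, and their classes generate $\mathrm{Sel}_2(E^{(n)})/E^{(n)}(\mathbb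 Q)[2]$. -/

import Mathlib

/-! ## Square classes of rational numbers -/

/-- The group `ℚˣ / (ℚˣ)²` of square classes. -/
abbrev SqClass : Type := ℚˣ ⧸ (powMonoidHom 2 : ℚˣ →* ℚˣ).range

/-- The square class of a non-zero rational number `a` (with the junk value `1` for `a = 0`). -/
noncomputable def sqClass (a : ℚ) : SqClass :=
  if h : a = 0 then 1 else QuotientGroup.mk (Units.mk0 a h)

/-- The triple of square classes of `(a, b, c)`. -/
noncomputable def sqTriple (a b c : ℚ) : SqClass × SqClass × SqClass :=
  (sqClass a, sqClass b, sqClass c)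

/-! ## The genus one curves `D_Λ` -/

/-- The genus one curve `D_Λ` in `ℙ³` attached to `Λ = (d₁, d₂, d₃)`, i.e. the curve
`-n t² + d₂ u₂² - d₃ u₃² = 0`, `-n t² + d₃ u₃² - d₁ u₁² = 0`, `2 n t² + d₁ u₁² - d₂ u₂² = 0`
with homogeneous coordinates `(t : u₁ : u₂ : u₃)`, has a point over the field `F`. -/
def DHasPoint (F : Type*) [Field F] (n d₁ d₂ d₃ : F) : Prop :=
  ∃ t u₁ u₂ u₃ : F, ¬ (t = 0 ∧ u₁ = 0 ∧ u₂ = 0 ∧ u₃ = 0) ∧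
    -n * t ^ 2 + d₂ * u₂ ^ 2 - d₃ * u₃ ^ 2 = 0 ∧
    -n * t ^ 2 + d₃ * u₃ ^ 2 - d₁ * u₁ ^ 2 = 0 ∧
    2 * n * t ^ 2 + d₁ * u₁ ^ 2 - d₂ * u₂ ^ 2 = 0

/-- `D_Λ(𝔸) ≠ ∅`: since `D_Λ` is projective, an adelic point is the same as a point over each
completion `ℝ` and `ℚ_p` of `ℚ`. -/
def DHasAdelicPoint (n : ℕ) (d₁ d₂ d₃ : ℚ) : Prop :=
  DHasPoint ℝ (n : ℝ) (d₁ : ℝ) (d₂ : ℝ) (d₃ : ℝ) ∧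
    ∀ (p : ℕ) [Fact p.Prime], DHasPoint ℚ_[p] (n : ℚ_[p]) (d₁ : ℚ_[p]) (d₂ : ℚ_[p]) (d₃ : ℚ_[p])

/-! ### Products of solvable triples are solvable

These facts are needed only to see that the `2`-Selmer group is a group. -/

theorem DHasPoint.of_squares {F : Type*} [Field F] (n : F) {d₁ d₂ d₃ : F}
    (h₁ : ∃ r, r ≠ 0 ∧ d₁ = r ^ 2) (h₂ : ∃ r, r ≠ 0 ∧ d₂ = r ^ 2)
    (h₃ : ∃ r, r ≠ 0 ∧ d₃ = r ^ 2) : DHasPoint F n d₁ d₂ d₃ := by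
  obtain ⟨a, ha, rfl⟩ := h₁
  obtain ⟨b, hb, rfl⟩ := h₂
  obtain ⟨c, hc, rfl⟩ := h₃
  refine ⟨0, a⁻¹, b⁻¹, c⁻¹, ?_, ?_, ?_, ?_⟩
  · simp [ha]
  all_goals field_simp; ring

/-- Multiplying the `dᵢ` by non-zero squares does not affect solvability. -/
theorem DHasPoint.scale {F : Type*} [Field F] {n d₁ d₂ d₃ : F}
    (h : DHasPoint F n d₁ d₂ d₃) {e₁ e₂ e₃ : F} (h₁ : ∃ r, r ≠ 0 ∧ e₁ = r ^ 2)
    (h₂ : ∃ r, r ≠ 0 ∧ e₂ = r ^ 2) (h₃ : ∃ r, r ≠ 0 ∧ e₃ = r ^ 2) :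
    DHasPoint F n (e₁ * d₁) (e₂ * d₂) (e₃ * d₃) := by
  obtain ⟨a, ha, rfl⟩ := h₁
  obtain ⟨b, hb, rfl⟩ := h₂
  obtain ⟨c, hc, rfl⟩ := h₃
  obtain ⟨t, u₁, u₂, u₃, h0, k₁, k₂, k₃⟩ := h
  have e₁ : a ^ 2 * d₁ * (u₁ / a) ^ 2 = d₁ * u₁ ^ 2 := by field_simp
  have e₂ : b ^ 2 * d₂ * (u₂ / b) ^ 2 = d₂ * u₂ ^ 2 := by field_simp
  have e₃ : c ^ 2 * d₃ * (u₃ / c) ^ 2 = d₃ * u₃ ^ 2 := by field_simp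
  refine ⟨t, u₁ / a, u₂ / b, u₃ / c, ?_, ?_, ?_, ?_⟩
  · simpa [ha, hb, hc] using h0
  · rw [e₂, e₃]; exact k₁
  · rw [e₃, e₁]; exact k₂
  · rw [e₁, e₂]; exact k₃

/-- A point of `D_Λ` either is at infinity, and then `Λ` is trivial, or gives the
`x`-coordinate of a point of the curve `y² = x³ - n² x`. -/
theorem DHasPoint.cases {F : Type*} [Field F] {n d₁ d₂ d₃ : F} (h₁ : d₁ ≠ 0) (h₂ : d₂ ≠ 0)
    (h₃ : d₃ ≠ 0) (hs : ∃ s, d₁ * d₂ * d₃ = s ^ 2) (h : DHasPoint F n d₁ d₂ d₃) :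
    ((∃ r, r ≠ 0 ∧ d₁ = r ^ 2) ∧ (∃ r, r ≠ 0 ∧ d₂ = r ^ 2) ∧ (∃ r, r ≠ 0 ∧ d₃ = r ^ 2)) ∨
    ∃ x u v w, x - n = d₁ * u ^ 2 ∧ x - (-n) = d₂ * v ^ 2 ∧ x - 0 = d₃ * w ^ 2 := by
  obtain ⟨s, hs⟩ := hs
  obtain ⟨t, u₁, u₂, u₃, h0, k₁, k₂, k₃⟩ := h
  by_cases ht : t = 0
  · left
    subst ht
    have k₁' : d₂ * u₂ ^ 2 = d₃ * u₃ ^ 2 := by linear_combination k₁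
    have k₂' : d₃ * u₃ ^ 2 = d₁ * u₁ ^ 2 := by linear_combination k₂
    have hu : u₁ ≠ 0 := by
      rintro rfl
      have hu₃ : u₃ = 0 := by simpa [h₃] using k₂'
      subst hu₃
      have hu₂ : u₂ = 0 := by simpa [h₂] using k₁'
      exact h0 ⟨rfl, rfl, hu₂, rfl⟩
    have hc : d₁ * u₁ ^ 2 ≠ 0 := mul_ne_zero h₁ (pow_ne_zero 2 hu)
    have hu₃ : u₃ ≠ 0 := by
      rintro rfl
      exact hc (by rw [← k₂']; ring)
    have hu₂ : u₂ ≠ 0 := by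
      rintro rfl
      exact hc (by rw [← k₂', ← k₁']; ring)
    have hs0 : s ≠ 0 := by
      rintro rfl
      exact mul_ne_zero (mul_ne_zero h₁ h₂) h₃ (by rw [hs]; ring)
    -- the common value of the three `dᵢ uᵢ²` is a square
    have hsq : d₁ * u₁ ^ 2 = (s * u₁ * u₂ * u₃ / (d₁ * u₁ ^ 2)) ^ 2 := by
      rw [div_pow, eq_div_iff (pow_ne_zero 2 hc)]
      calc d₁ * u₁ ^ 2 * (d₁ * u₁ ^ 2) ^ 2
          = (d₁ * u₁ ^ 2) * (d₂ * u₂ ^ 2) * (d₃ * u₃ ^ 2) := by rw [k₁', k₂']; ring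
        _ = (d₁ * d₂ * d₃) * (u₁ * u₂ * u₃) ^ 2 := by ring
        _ = _ := by rw [hs]; ring
    set c := s * u₁ * u₂ * u₃ / (d₁ * u₁ ^ 2) with hcdef
    have hc0 : c ≠ 0 := by
      intro h
      exact hc (by rw [hsq, h]; ring)
    refine ⟨⟨c / u₁, div_ne_zero hc0 hu, ?_⟩, ⟨c / u₂, div_ne_zero hc0 hu₂, ?_⟩,
      ⟨c / u₃, div_ne_zero hc0 hu₃, ?_⟩⟩
    · rw [div_pow, eq_div_iff (pow_ne_zero 2 hu), hsq]
    · rw [div_pow, eq_div_iff (pow_ne_zero 2 hu₂), k₁', k₂', hsq]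
    · rw [div_pow, eq_div_iff (pow_ne_zero 2 hu₃), k₂', hsq]
  · right
    refine ⟨d₃ * (u₃ / t) ^ 2, u₁ / t, u₂ / t, u₃ / t, ?_, ?_, ?_⟩
    · field_simp
      linear_combination k₂
    · field_simp
      linear_combination -k₁
    · ring

/-- The chord construction: the third intersection point of the line through two points of
`y² = (x - e)(x - f)(x - g)`. -/
theorem chord_sq {F : Type*} [Field F] {e f g x x' y y' d d₂ d₃ d' d₂' d₃' u v w u' v' w' s s' : F}
    (hd : d ≠ 0) (hd' : d' ≠ 0) (hx : x ≠ x')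
    (h₁ : x - e = d * u ^ 2) (h₂ : x - f = d₂ * v ^ 2) (h₃ : x - g = d₃ * w ^ 2)
    (hs : d * d₂ * d₃ = s ^ 2) (hy : y = s * u * v * w)
    (h₁' : x' - e = d' * u' ^ 2) (h₂' : x' - f = d₂' * v' ^ 2) (h₃' : x' - g = d₃' * w' ^ 2)
    (hs' : d' * d₂' * d₃' = s' ^ 2) (hy' : y' = s' * u' * v' * w') :
    ∃ r, ((y - y') / (x - x')) ^ 2 - x - x' + (e + f + g) - e = d * d' * r ^ 2 := by
  have hxx : x - x' ≠ 0 := sub_ne_zero.mpr hx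
  have hY : y ^ 2 = (x - e) * (x - f) * (x - g) := by
    rw [h₁, h₂, h₃, hy]
    linear_combination (-(u * v * w) ^ 2) * hs
  have hY' : y' ^ 2 = (x' - e) * (x' - f) * (x' - g) := by
    rw [h₁', h₂', h₃', hy']
    linear_combination (-(u' * v' * w') ^ 2) * hs'
  set l := (y - y') / (x - x') with hl
  have hly : y - y' = l * (x - x') := by rw [hl]; field_simp
  -- the value at `e` of the difference of the cubic and the square of the line
  have key : (x - e) * (x' - e) * (l ^ 2 - x - x' + (e + f + g) - e) = (l * (e - x) + y) ^ 2 := by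
    have : (x - x') * ((x - e) * (x' - e) * (l ^ 2 - x - x' + (e + f + g) - e)
        - (l * (e - x) + y) ^ 2) = 0 := by
      have hy2 : y' = y - l * (x - x') := by linear_combination -hly
      rw [hy2] at hY'
      linear_combination (x' - e) * hY - (x - e) * hY'
    rcases mul_eq_zero.mp this with h | h
    · exact absurd h hxx
    · linear_combination h
  by_cases hu : u = 0
  · subst hu
    have hxe : x = e := by linear_combination h₁
    have hu' : u' ≠ 0 := by
      rintro rfl
      exact hx (by linear_combination h₁ - h₁')
    have hy0 : y = 0 := by rw [hy]; ring
    refine ⟨s * v * w / (d * d' * u'), ?_⟩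
    have hX : x' - e ≠ 0 := by rw [h₁']; exact mul_ne_zero hd' (pow_ne_zero 2 hu')
    have hl2 : l ^ 2 * (x' - e) = (x' - f) * (x' - g) := by
      have h5 : y' = l * (x' - e) := by rw [← hxe]; linear_combination -hly + hy0
      have h6 : (x' - e) * (l ^ 2 * (x' - e) - (x' - f) * (x' - g)) = 0 := by
        rw [h5] at hY'
        linear_combination hY'
      rcases mul_eq_zero.mp h6 with h | h
      · exact absurd h hX
      · linear_combination h
    have h7 : (l ^ 2 - x - x' + (e + f + g) - e) * (d' * u' ^ 2) = (x - f) * (x - g) := by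
      rw [← h₁']
      rw [hxe]
      linear_combination hl2
    rw [h₂, h₃] at h7
    have h8 : d * d' * (s * v * w / (d * d' * u')) ^ 2 * (d' * u' ^ 2)
        = d₂ * v ^ 2 * (d₃ * w ^ 2) := by
      field_simp
      linear_combination (-(v * w) ^ 2) * hs
    exact mul_right_cancel₀ (mul_ne_zero hd' (pow_ne_zero 2 hu')) (h7.trans h8.symm)
  · by_cases hu' : u' = 0
    · subst hu'
      have hxe : x' = e := by linear_combination h₁'
      have hy0 : y' = 0 := by rw [hy']; ring
      refine ⟨s' * v' * w' / (d * d' * u), ?_⟩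
      have hX : x - e ≠ 0 := by rw [h₁]; exact mul_ne_zero hd (pow_ne_zero 2 hu)
      have hl2 : l ^ 2 * (x - e) = (x - f) * (x - g) := by
        have h5 : y = l * (x - e) := by rw [← hxe]; linear_combination hly + hy0
        have h6 : (x - e) * (l ^ 2 * (x - e) - (x - f) * (x - g)) = 0 := by
          rw [h5] at hY
          linear_combination hY
        rcases mul_eq_zero.mp h6 with h | h
        · exact absurd h hX
        · linear_combination h
      have h7 : (l ^ 2 - x - x' + (e + f + g) - e) * (d * u ^ 2) = (x' - f) * (x' - g) := by
        rw [← h₁]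
        rw [hxe]
        linear_combination hl2
      rw [h₂', h₃'] at h7
      have h8 : d * d' * (s' * v' * w' / (d * d' * u)) ^ 2 * (d * u ^ 2)
          = d₂' * v' ^ 2 * (d₃' * w' ^ 2) := by
        field_simp
        linear_combination (-(v' * w') ^ 2) * hs'
      exact mul_right_cancel₀ (mul_ne_zero hd (pow_ne_zero 2 hu)) (h7.trans h8.symm)
    · refine ⟨(l * (e - x) + y) / (d * d' * u * u'), ?_⟩
      rw [h₁, h₁'] at key
      have h9 : d * u ^ 2 * (d' * u' ^ 2) ≠ 0 :=
        mul_ne_zero (mul_ne_zero hd (pow_ne_zero 2 hu)) (mul_ne_zero hd' (pow_ne_zero 2 hu'))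
      apply mul_left_cancel₀ h9
      rw [key]
      field_simp

theorem DHasPoint.mul {F : Type*} [Field F] (h2 : (2 : F) ≠ 0) {n : F} (hn : n ≠ 0)
    {d₁ d₂ d₃ d₁' d₂' d₃' : F} (h₁ : d₁ ≠ 0) (h₂ : d₂ ≠ 0) (h₃ : d₃ ≠ 0)
    (h₁' : d₁' ≠ 0) (h₂' : d₂' ≠ 0) (h₃' : d₃' ≠ 0)
    (hs : ∃ s, d₁ * d₂ * d₃ = s ^ 2) (hs' : ∃ s, d₁' * d₂' * d₃' = s ^ 2)
    (h : DHasPoint F n d₁ d₂ d₃) (h' : DHasPoint F n d₁' d₂' d₃') :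
    DHasPoint F n (d₁ * d₁') (d₂ * d₂') (d₃ * d₃') := by
  rcases h.cases h₁ h₂ h₃ hs with ⟨a, b, c⟩ | ⟨x, u, v, w, k₁, k₂, k₃⟩
  · exact h'.scale a b c
  rcases h'.cases h₁' h₂' h₃' hs' with ⟨a, b, c⟩ | ⟨x', u', v', w', k₁', k₂', k₃'⟩
  · have := h.scale a b c
    rwa [mul_comm d₁, mul_comm d₂, mul_comm d₃]
  obtain ⟨s, hs⟩ := hs
  obtain ⟨s', hs'⟩ := hs'
  have hs0 : s ≠ 0 := by
    rintro rfl
    exact mul_ne_zero (mul_ne_zero h₁ h₂) h₃ (by rw [hs]; ring)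
  have hs0' : s' ≠ 0 := by
    rintro rfl
    exact mul_ne_zero (mul_ne_zero h₁' h₂') h₃' (by rw [hs']; ring)
  by_cases hx : x = x'
  · subst hx
    -- the product is trivial
    have sq : ∀ {X a a' z z' : F}, a ≠ 0 → a' ≠ 0 → X = a * z ^ 2 → X = a' * z' ^ 2 → X ≠ 0 →
        ∃ r, r ≠ 0 ∧ a * a' = r ^ 2 := by
      intro X a a' z z' ha ha' e e' hX
      have hz : z ≠ 0 := by rintro rfl; exact hX (by rw [e]; ring)
      have hz' : z' ≠ 0 := by rintro rfl; exact hX (by rw [e']; ring)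
      refine ⟨X / (z * z'), div_ne_zero hX (mul_ne_zero hz hz'), ?_⟩
      rw [div_pow, eq_div_iff (pow_ne_zero 2 (mul_ne_zero hz hz'))]
      linear_combination (-X) * e' - a' * z' ^ 2 * e
    have third : ∀ {a b c : F}, (∃ r, r ≠ 0 ∧ a = r ^ 2) → (∃ r, r ≠ 0 ∧ b = r ^ 2) →
        a * b * c = (s * s') ^ 2 → ∃ r, r ≠ 0 ∧ c = r ^ 2 := by
      rintro a b c ⟨r, hr, rfl⟩ ⟨q, hq, rfl⟩ e
      refine ⟨s * s' / (r * q), div_ne_zero (mul_ne_zero hs0 hs0') (mul_ne_zero hr hq), ?_⟩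
      rw [div_pow, eq_div_iff (pow_ne_zero 2 (mul_ne_zero hr hq)), ← e]
      ring
    have hprod : (d₁ * d₁') * (d₂ * d₂') * (d₃ * d₃') = (s * s') ^ 2 := by
      linear_combination (d₁' * d₂' * d₃') * hs + s ^ 2 * hs'
    by_cases z₁ : x - n = 0
    · have hxn : x = n := by linear_combination z₁
      have z₂ : x - (-n) ≠ 0 := by
        intro hz
        exact mul_ne_zero h2 hn (by linear_combination hz - hxn)
      have z₃ : x - 0 ≠ 0 := by simpa [hxn] using hn
      have q₂ := sq h₂ h₂' k₂ k₂' z₂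
      have q₃ := sq h₃ h₃' k₃ k₃' z₃
      exact .of_squares n (third q₂ q₃ (by linear_combination hprod)) q₂ q₃
    · have q₁ := sq h₁ h₁' k₁ k₁' z₁
      by_cases z₂ : x - (-n) = 0
      · have z₃ : x - 0 ≠ 0 := by
          intro hz
          exact hn (by linear_combination z₂ - hz)
        have q₃ := sq h₃ h₃' k₃ k₃' z₃
        exact .of_squares n q₁ (third q₁ q₃ (by linear_combination hprod)) q₃
      · have q₂ := sq h₂ h₂' k₂ k₂' z₂
        exact .of_squares n q₁ q₂ (third q₁ q₂ hprod)
  · obtain ⟨r₁, e₁⟩ := chord_sq (y := s * u * v * w) (y' := s' * u' * v' * w') h₁ h₁' hx k₁ k₂ k₃ hs rfl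
      k₁' k₂' k₃' hs' rfl
    obtain ⟨r₂, e₂⟩ := chord_sq (y := s * u * v * w) (y' := s' * u' * v' * w') (s := s) (s' := s')
      h₂ h₂' hx k₂ k₃ k₁ (by linear_combination hs) (by ring)
      k₂' k₃' k₁' (by linear_combination hs') (by ring)
    obtain ⟨r₃, e₃⟩ := chord_sq (y := s * u * v * w) (y' := s' * u' * v' * w') (s := s) (s' := s')
      h₃ h₃' hx k₃ k₁ k₂ (by linear_combination hs) (by ring)
      k₃' k₁' k₂' (by linear_combination hs') (by ring)
    refine ⟨1, r₁, r₂, r₃, by simp, ?_, ?_, ?_⟩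
    · linear_combination e₃ - e₂
    · linear_combination e₁ - e₃
    · linear_combination e₂ - e₁

/-! ## The pure `2`-Selmer group of `E⁽ⁿ⁾ : y² = x³ - n² x` -/

theorem DHasAdelicPoint.mul (n : ℕ) {a b c a' b' c' : ℚˣ}
    (hs : IsSquare (a * b * c)) (hs' : IsSquare (a' * b' * c'))
    (h : DHasAdelicPoint n a b c) (h' : DHasAdelicPoint n a' b' c') :
    DHasAdelicPoint n (a * a' : ℚˣ) (b * b' : ℚˣ) (c * c' : ℚˣ) := by
  have gen : ∀ (F : Type) [Field F] [CharZero F],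
      DHasPoint F (n : F) ((a : ℚ) : F) ((b : ℚ) : F) ((c : ℚ) : F) →
      DHasPoint F (n : F) ((a' : ℚ) : F) ((b' : ℚ) : F) ((c' : ℚ) : F) →
      DHasPoint F (n : F) ((a * a' : ℚˣ) : ℚ) ((b * b' : ℚˣ) : ℚ) ((c * c' : ℚˣ) : ℚ) := by
    intro F _ _ k k'
    rcases Nat.eq_zero_or_pos n with rfl | hn
    · exact ⟨1, 0, 0, 0, by simp, by simp, by simp, by simp⟩
    have cast_sq : ∀ {x y z : ℚˣ}, IsSquare (x * y * z) →
        ∃ s : F, ((x : ℚ) : F) * ((y : ℚ) : F) * ((z : ℚ) : F) = s ^ 2 := by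
      rintro x y z ⟨r, hr⟩
      refine ⟨((r : ℚ) : F), ?_⟩
      have := congrArg (fun q : ℚˣ => ((q : ℚ) : F)) hr
      simp only [Units.val_mul, Rat.cast_mul] at this
      rw [this]; ring
    have ne : ∀ x : ℚˣ, ((x : ℚ) : F) ≠ 0 := fun x => by exact_mod_cast x.ne_zero
    have := DHasPoint.mul (F := F) two_ne_zero (n := (n : F)) (by exact_mod_cast hn.ne')
      (ne a) (ne b) (ne c) (ne a') (ne b') (ne c') (cast_sq hs) (cast_sq hs') k k'
    simpa only [Units.val_mul, Rat.cast_mul] using this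
  exact ⟨gen ℝ h.1 h'.1, fun p _ => gen ℚ_[p] (h.2 p) (h'.2 p)⟩

theorem sqTriple_sq (g : SqClass × SqClass × SqClass) : g ^ 2 = 1 := by
  have key : ∀ x : SqClass, x ^ 2 = 1 := by
    intro x
    induction x using QuotientGroup.induction_on with
    | H z => exact (QuotientGroup.eq_one_iff (z ^ 2)).mpr ⟨z, rfl⟩
  obtain ⟨a, b, c⟩ := g
  simp only [Prod.pow_mk, key]
  rfl

/-- The `2`-Selmer group `Sel₂(E⁽ⁿ⁾)`: the group of all triples `Λ = (d₁, d₂, d₃)` of square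
classes such that `d₁ d₂ d₃` is a square and `D_Λ(𝔸) ≠ ∅`. -/
def Sel2 (n : ℕ) : Subgroup (SqClass × SqClass × SqClass) where
  carrier := {g | ∃ d₁ d₂ d₃ : ℚˣ,
    g = (QuotientGroup.mk d₁, QuotientGroup.mk d₂, QuotientGroup.mk d₃) ∧
      IsSquare (d₁ * d₂ * d₃) ∧ DHasAdelicPoint n d₁ d₂ d₃}
  one_mem' := by
    refine ⟨1, 1, 1, rfl, ⟨1, by simp⟩, ⟨0, 1, 1, 1, ?_, ?_, ?_, ?_⟩, fun p _ =>
      ⟨0, 1, 1, 1, ?_, ?_, ?_, ?_⟩⟩ <;> simp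
  mul_mem' := by
    rintro _ _ ⟨a, b, c, rfl, hs, h⟩ ⟨a', b', c', rfl, hs', h'⟩
    refine ⟨a * a', b * b', c * c', rfl, ?_, .mul n hs hs' h h'⟩
    have : a * a' * (b * b') * (c * c') = a * b * c * (a' * b' * c') := by
      simp only [mul_comm, mul_left_comm]
    rw [this]
    exact hs.mul hs'
  inv_mem' := by
    intro g hg
    have : g⁻¹ = g := by
      rw [inv_eq_iff_mul_eq_one, ← pow_two, sqTriple_sq]
    rwa [this]

/-- The congruent elliptic curve `E⁽ⁿ⁾ : y² = x³ - n² x` over `ℚ`. -/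
def congruentCurve (n : ℕ) : WeierstrassCurve.Affine ℚ where
  a₁ := 0
  a₂ := 0
  a₃ := 0
  a₄ := -(n : ℚ) ^ 2
  a₆ := 0

/-- The Kummer map `E⁽ⁿ⁾(ℚ) → (ℚˣ / (ℚˣ)²)³`, `(x, y) ↦ (x - n, x + n, x)`; a component that
vanishes is replaced by the product of the other two, and the point at infinity goes to `1`. -/
noncomputable def kummerMap (n : ℕ) : (congruentCurve n).Point → SqClass × SqClass × SqClass
  | .zero => 1
  | .some x _ _ => sqTriple
      (if x - n = 0 then (x + n) * x else x - n)
      (if x + n = 0 then (x - n) * x else x + n)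
      (if x = 0 then (x - n) * (x + n) else x)

/-- The image of `E⁽ⁿ⁾(ℚ)[2]` in `(ℚˣ / (ℚˣ)²)³` under the Kummer map. -/
noncomputable def torsionImage (n : ℕ) : Subgroup (SqClass × SqClass × SqClass) :=
  Subgroup.closure (kummerMap n '' {P | P + P = 0})

/-- The pure `2`-Selmer group `Sel₂(E⁽ⁿ⁾) / E⁽ⁿ⁾(ℚ)[2]`. -/
abbrev PureSel2 (n : ℕ) : Type := Sel2 n ⧸ (torsionImage n).subgroupOf (Sel2 n)

/-! ## Ranks over `𝔽₂` -/

/-- The `𝔽₂`-dimension of a (multiplicatively written) commutative group killed by `2`. -/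
noncomputable def rankF2 (V : Type*) [CommGroup V] (h : ∀ v : V, v ^ 2 = 1) : ℕ :=
  letI : Module (ZMod 2) (Additive V) :=
    AddCommGroup.zmodModule fun v => congrArg Additive.ofMul (h v.toMul)
  Module.finrank (ZMod 2) (Additive V)

theorem pureSel2_sq (n : ℕ) (v : PureSel2 n) : v ^ 2 = 1 := by
  induction v using QuotientGroup.induction_on with
  | H z =>
    have : z ^ 2 = 1 := Subtype.ext (sqTriple_sq z.1)
    rw [← QuotientGroup.mk_pow, this, QuotientGroup.mk_one]

/-- The pure `2`-Selmer rank `s₂(n)`. -/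
noncomputable def s2 (n : ℕ) : ℕ := rankF2 (PureSel2 n) (pureSel2_sq n)

/-! ## The `2ⁱ`-ranks of the class group of `ℚ(√-n)` -/

/-- The field `ℚ(√-n)`, as a subfield of `ℂ`. -/
noncomputable abbrev imagQuadField (n : ℕ) : IntermediateField ℚ ℂ :=
  IntermediateField.adjoin ℚ {Complex.I * (Real.sqrt n : ℂ)}

/-- The ideal class group `𝒜ₙ` of `ℚ(√-n)`. -/
abbrev classGroupOf (n : ℕ) : Type :=
  ClassGroup (NumberField.RingOfIntegers (imagQuadField n))

/-- For a commutative group `A`, written additively in the literature, the subgroup `2ʲA`. -/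
def twoPowMul (A : Type*) [CommGroup A] (j : ℕ) : Subgroup A := (powMonoidHom (2 ^ j)).range

theorem twoPowMul_quot_sq (A : Type*) [CommGroup A] (j : ℕ)
    (v : twoPowMul A j ⧸ (twoPowMul A (j + 1)).subgroupOf (twoPowMul A j)) : v ^ 2 = 1 := by
  induction v using QuotientGroup.induction_on with
  | H z =>
    obtain ⟨_, x, rfl⟩ := z
    refine (QuotientGroup.eq_one_iff _).mpr ?_
    rw [Subgroup.mem_subgroupOf]
    exact ⟨x, by simp [pow_succ, pow_mul]⟩

/-- `rank_{𝔽₂} 2ʲ𝒜ₙ / 2ʲ⁺¹𝒜ₙ`, i.e. the `2ʲ⁺¹`-rank of the class group of `ℚ(√-n)`. -/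
noncomputable def classRank (n j : ℕ) : ℕ :=
  rankF2 (twoPowMul (classGroupOf n) j ⧸
      (twoPowMul (classGroupOf n) (j + 1)).subgroupOf (twoPowMul (classGroupOf n) j))
    (twoPowMul_quot_sq _ j)

/-- The `4`-rank `h₄(n) = rank_{𝔽₂} 2𝒜ₙ / 4𝒜ₙ`. -/
noncomputable def h4 (n : ℕ) : ℕ := classRank n 1

/-! ## The matrix `A` and the vector `B` -/

/-- The additive Legendre symbol: `0` if the Legendre symbol `(a / p)` is `1`, else `1`. -/
def addLegendre (a : ℤ) (p : ℕ) [Fact p.Prime] : ZMod 2 :=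
  if legendreSym p a = 1 then 0 else 1

/-- The `k × k` matrix `A` over `𝔽₂`: `a_{ij} = [p_j / p_i]` for `i ≠ j` and
`a_{ii} = ∑_{l ≠ i} a_{il}`. -/
def matA {k : ℕ} (p : Fin k → ℕ) [∀ i, Fact (p i).Prime] : Matrix (Fin k) (Fin k) (ZMod 2) :=
  Matrix.of fun i j =>
    if i = j then ∑ l ∈ Finset.univ.erase i, addLegendre (p l) (p i) else addLegendre (p j) (p i)

/-- The column vector `B = ([2 / p_1], …, [2 / p_k])ᵀ`. -/
def vecB {k : ℕ} (p : Fin k → ℕ) [∀ i, Fact (p i).Prime] : Fin k → ZMod 2 :=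
  fun i => addLegendre 2 (p i)

/-- The integer `∏ p_i^{x_i}` attached to a vector `x` over `𝔽₂`. -/
def prodOfVec {k : ℕ} (p : Fin k → ℕ) (x : Fin k → ZMod 2) : ℕ := ∏ i, p i ^ (x i).val

/-- The triples `g` and `g'` of square classes lie in the `2`-Selmer group, and their classes
generate the pure `2`-Selmer group. -/
def PureSel2GeneratedBy (n : ℕ) (g g' : SqClass × SqClass × SqClass) : Prop :=
  ∃ (h : g ∈ Sel2 n) (h' : g' ∈ Sel2 n),
    Subgroup.closure {(QuotientGroup.mk ⟨g, h⟩ : PureSel2 n), QuotientGroup.mk ⟨g', h'⟩} = ⊤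

/-! ## Squares in `ℚ_p` -/

section PadicSquares

variable {p : ℕ} [Fact p.Prime]

/-! Both invariants are orders of explicit 𝔽₂-kernels built from `A` and `B`, and elementary linear
algebra compares the two kernels.

Selmer side. Modulo torsion every Selmer class has a unique representative (d₁, d₂, d₁d₂) with d₁,
d₂ positive divisors of n. Write their exponent vectors as x and x + z. At p_i the image of the
local Kummer map consists of the classes of the 2-torsion, because -1 is a square in ℚ_{p_i}, and
membership becomes Az = 0, Ax = Bz (componentwise product) at the index i. The real place and the
primes q ∤ 2n impose nothing more. The place 2 asks for d₁d₂ ≡ 1 mod 8, that is B·z = 0, which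
follows by pairing Ax = Bz with x₀, as A is symmetric and Ax₀ = 0. So the pure Selmer group is
`monskyKernel` (`vecTriple_mem_sel2_iff`, `pureSelmerMap_bijective`).

Class group side. The ring of integers is ℤ[√-n], and its 2-torsion classes are those of products of
the ramified primes above 2 and the p_i, encoded by pairs (x, e). Exactly one non-trivial pair gives
a principal ideal. The class of (x, e) is a square if and only if 2ᵉd is a norm from ℚ(√-n) up to
squares, if and only if Ax = eB. Necessity is reduction modulo p_i. Sufficiency is Legendre's
theorem for dZ² + (n/d)Y² = 2ᵉX², proved by the pigeonhole principle (`exists_ternary_solution`).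
Since |2𝒜/4𝒜| = |𝒜[2] ∩ 2𝒜|, the kernel `redeiKernel` has 2·2^{h₄} elements (`h4_eq_one_iff`).

Comparison. The image of the symmetric matrix A is the orthogonal complement of its kernel, and B·x₀
= 0 because n ≡ 1 mod 8. For k > 0 this shows that either kernel has four elements exactly when ker
A = {0, x₀}, with B then automatically in the image, or |ker A| = 4 and B is not in the image
(`card_monskyKernel_eq_four`). In the second case the Monsky kernel is ker A × 0, and in the first
it is spanned by (x₀, 0) and any (x, x₀) with Ax = B. These are the two families of generators. -/

theorem PadicInt.isSquare_of_norm_sub_one_lt {c : ℤ_[p]} (hc : ‖c - 1‖ < ‖(2 : ℤ_[p])‖ ^ 2) :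
    IsSquare c := by
  obtain ⟨z, hz, -⟩ := hensels_lemma (p := p) (R := ℤ_[p]) (F := Polynomial.X ^ 2 - Polynomial.C c)
    (a := 1) (by
      simp only [map_sub, map_pow, Polynomial.aeval_X, Polynomial.aeval_C, one_pow,
        Polynomial.derivative_X_pow, Polynomial.derivative_C]
      simpa [norm_sub_rev] using hc)
  refine ⟨z, ?_⟩
  simp only [map_sub, map_pow, Polynomial.aeval_X, Polynomial.aeval_C] at hz
  have : z ^ 2 = c := sub_eq_zero.mp hz
  rw [← this, pow_two]

/-- The quotient a / b is close to 1, hence a square by Hensel's lemma. Equality of square classes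
is expressed through the product ab so that it can be chained without division. -/
theorem Padic.isSquare_mul_of_norm_sub_lt {a b : ℚ_[p]}
    (h : ‖a - b‖ < ‖(2 : ℚ_[p])‖ ^ 2 * ‖b‖) : IsSquare (a * b) := by
  have hb : b ≠ 0 := by
    rintro rfl
    simp at h
    exact absurd h (not_lt.mpr (norm_nonneg _))
  have hb' : 0 < ‖b‖ := norm_pos_iff.mpr hb
  have h2 : ‖(2 : ℚ_[p])‖ ≤ 1 := by
    simpa using Padic.norm_int_le_one (p := p) 2
  have hd : ‖a / b - 1‖ < ‖(2 : ℚ_[p])‖ ^ 2 := by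
    rw [div_sub_one hb, norm_div, div_lt_iff₀ hb']
    exact h
  have hd1 : ‖a / b - 1‖ < 1 := hd.trans_le (pow_le_one₀ (norm_nonneg _) h2)
  have h1 : ‖a / b‖ ≤ 1 := by
    have : a / b = (a / b - 1) + 1 := by ring
    rw [this]
    exact (Padic.nonarchimedean _ _).trans (max_le hd1.le (by simp))
  obtain ⟨z, hz⟩ := PadicInt.isSquare_of_norm_sub_one_lt (p := p) (c := ⟨a / b, h1⟩) (by
    rw [PadicInt.norm_def, PadicInt.norm_def]
    exact hd)
  have hz' : a / b = (z : ℚ_[p]) * z := by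
    have := congrArg (fun t : ℤ_[p] => (t : ℚ_[p])) hz
    simpa using this
  refine ⟨b * z, ?_⟩
  rw [div_eq_iff hb] at hz'
  rw [hz']; ring

theorem Padic.norm_two (hp : p ≠ 2) : ‖(2 : ℚ_[p])‖ = 1 := by
  have := Padic.norm_natCast_eq_one_iff (p := p) (n := 2)
  rw [Nat.cast_ofNat] at this
  rw [this]
  exact (Nat.coprime_primes (Fact.out : p.Prime) Nat.prime_two).mpr hp

theorem Padic.isSquare_mul_of_norm_sub_lt' (hp : p ≠ 2) {a b : ℚ_[p]}
    (h : ‖a - b‖ < ‖b‖) : IsSquare (a * b) :=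
  Padic.isSquare_mul_of_norm_sub_lt (by rwa [Padic.norm_two hp, one_pow, one_mul])

theorem isSquare_of_mul {F : Type*} [Field F] {a b : F} (h : IsSquare (a * b)) (hb : IsSquare b)
    (hb0 : b ≠ 0) : IsSquare a := by
  have := h.div hb
  rwa [mul_div_cancel_right₀ _ hb0] at this

theorem isSquare_mul_trans {F : Type*} [Field F] {a b c : F} (h : IsSquare (a * b))
    (h' : IsSquare (b * c)) (hb : b ≠ 0) : IsSquare (a * c) := by
  have := h.mul h'
  refine isSquare_of_mul (b := b * b) ?_ ⟨b, rfl⟩ (mul_ne_zero hb hb)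
  rwa [show a * c * (b * b) = a * b * (b * c) by ring]

/-- An integer prime to `p` is a square in `ℚ_p` if and only if it is one modulo `p`. -/
theorem Padic.isSquare_intCast_iff (hp : p ≠ 2) {m : ℤ} (hm : ((m : ℤ) : ZMod p) ≠ 0) :
    IsSquare (m : ℚ_[p]) ↔ IsSquare (m : ZMod p) := by
  constructor
  · rintro ⟨r, hr⟩
    have hr1 : ‖r‖ ≤ 1 := by
      by_contra hlt
      push Not at hlt
      have h1 : ‖(m : ℚ_[p])‖ ≤ 1 := Padic.norm_int_le_one m
      rw [hr, norm_mul] at h1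
      nlinarith
    obtain ⟨z, rfl⟩ : ∃ z : ℤ_[p], (z : ℚ_[p]) = r := ⟨⟨r, hr1⟩, rfl⟩
    have hz : (m : ℤ_[p]) = z * z := by
      apply Subtype.coe_injective
      simpa using hr
    refine ⟨PadicInt.toZMod z, ?_⟩
    rw [← map_mul, ← hz, map_intCast]
  · rintro ⟨r, hr⟩
    obtain ⟨s, rfl⟩ := ZMod.intCast_surjective r
    have hs : ((s : ℤ) : ZMod p) ≠ 0 := by
      intro h
      rw [h, zero_mul] at hr
      exact hm hr
    have hs1 : ‖((s : ℤ) : ℚ_[p])‖ = 1 := by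
      refine le_antisymm (Padic.norm_int_le_one s) (not_lt.mp fun h => hs ?_)
      rw [Padic.norm_intCast_lt_one_iff] at h
      exact (ZMod.intCast_zmod_eq_zero_iff_dvd s p).mpr h
    have hlt : ‖(m : ℚ_[p]) - (s : ℚ_[p]) * s‖ < ‖(s : ℚ_[p]) * s‖ := by
      rw [norm_mul, hs1, one_mul]
      have : ((m - s * s : ℤ) : ℚ_[p]) = (m : ℚ_[p]) - (s : ℚ_[p]) * s := by push_cast; ring
      rw [← this, Padic.norm_intCast_lt_one_iff]
      apply (ZMod.intCast_zmod_eq_zero_iff_dvd _ p).mp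
      push_cast
      rw [hr, sub_self]
    refine isSquare_of_mul (Padic.isSquare_mul_of_norm_sub_lt' hp hlt) ⟨_, rfl⟩ ?_
    intro h
    rw [h, norm_zero] at hlt
    exact absurd hlt (not_lt.mpr (norm_nonneg _))

end PadicSquares

/-! ## The additive Legendre symbol -/

section AddLegendre

variable {p : ℕ} [Fact p.Prime]

theorem addLegendre_eq_zero_iff {a : ℤ} (ha : (a : ZMod p) ≠ 0) :
    addLegendre a p = 0 ↔ IsSquare (a : ZMod p) := by
  rw [← legendreSym.eq_one_iff p ha]
  unfold addLegendre
  split_ifs with h <;> simp [h]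

theorem addLegendre_mul {a b : ℤ} (ha : (a : ZMod p) ≠ 0) (hb : (b : ZMod p) ≠ 0) :
    addLegendre (a * b) p = addLegendre a p + addLegendre b p := by
  unfold addLegendre
  rw [legendreSym.mul]
  rcases legendreSym.eq_one_or_neg_one p ha with h | h <;>
    rcases legendreSym.eq_one_or_neg_one p hb with h' | h' <;> rw [h, h'] <;> decide

theorem addLegendre_one : addLegendre 1 p = 0 := by
  simp [addLegendre, legendreSym.at_one]

theorem addLegendre_prod {ι : Type*} (s : Finset ι) (f : ι → ℤ)
    (h : ∀ i ∈ s, (f i : ZMod p) ≠ 0) :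
    addLegendre (∏ i ∈ s, f i) p = ∑ i ∈ s, addLegendre (f i) p := by
  classical
  induction s using Finset.induction_on with
  | empty => simpa using addLegendre_one
  | insert i s hi ih =>
    rw [Finset.prod_insert hi, Finset.sum_insert hi, addLegendre_mul (h i (by simp)),
      ih fun j hj => h j (by simp [hj])]
    push_cast
    exact Finset.prod_ne_zero_iff.mpr fun j hj => h j (by simp [hj])

theorem zmod_two_cases (e : ZMod 2) : e = 0 ∨ e = 1 := by
  revert e
  decide

theorem addLegendre_pow_val (a : ℤ) (e : ZMod 2) :
    addLegendre (a ^ e.val) p = e * addLegendre a p := by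
  rcases zmod_two_cases e with rfl | rfl
  · simpa using addLegendre_one (p := p)
  · simp [ZMod.val_one]

end AddLegendre

/-! ## Local points on `D_Λ` -/

/-- An affine point, t = 1, above the abscissa x. Requiring products rather than quotients to be
squares lets a factor vanish, so that x may be the abscissa of a 2-torsion point. -/
theorem DHasPoint.of_isSquare {F : Type*} [Field F] {n d₁ d₂ d₃ : F} (x : F) (h₁ : d₁ ≠ 0)
    (h₂ : d₂ ≠ 0) (h₃ : d₃ ≠ 0) (s₁ : IsSquare ((x - n) * d₁)) (s₂ : IsSquare ((x + n) * d₂))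
    (s₃ : IsSquare (x * d₃)) : DHasPoint F n d₁ d₂ d₃ := by
  obtain ⟨a, ha⟩ := s₁
  obtain ⟨b, hb⟩ := s₂
  obtain ⟨c, hc⟩ := s₃
  have e₁ : d₁ * (a / d₁) ^ 2 = x - n := by field_simp; linear_combination -ha
  have e₂ : d₂ * (b / d₂) ^ 2 = x + n := by field_simp; linear_combination -hb
  have e₃ : d₃ * (c / d₃) ^ 2 = x := by field_simp; linear_combination -hc
  refine ⟨1, a / d₁, b / d₂, c / d₃, by simp, ?_, ?_, ?_⟩
  · rw [e₂, e₃]; ring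
  · rw [e₃, e₁]; ring
  · rw [e₁, e₂]; ring

theorem DHasPoint.of_isSquare_infinity {F : Type*} [Field F] (n : F) {d₁ d₂ d₃ : F} (h₁ : d₁ ≠ 0)
    (h₂ : d₂ ≠ 0) (h₃ : d₃ ≠ 0) (s₁ : IsSquare d₁) (s₂ : IsSquare d₂) (s₃ : IsSquare d₃) :
    DHasPoint F n d₁ d₂ d₃ := by
  have key : ∀ {d : F}, d ≠ 0 → IsSquare d → ∃ r, r ≠ 0 ∧ d = r ^ 2 := by
    rintro d hd ⟨r, rfl⟩
    exact ⟨r, fun h => hd (by rw [h, zero_mul]), (pow_two r).symm⟩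
  exact .of_squares n (key h₁ s₁) (key h₂ s₂) (key h₃ s₃)

/-! ### Points at primes of good reduction, by character sums -/

section FiniteField

variable {F : Type*} [Field F] [Fintype F] [DecidableEq F]

/-- The affine substitution x = -(b - a)y - a turns the sum into χ(-1) times the Jacobi sum J(χ,
χ⁻¹) = -χ(-1). -/
theorem sum_quadraticChar_mul_shift (hF : ringChar F ≠ 2) {a b : F} (hab : a ≠ b) :
    ∑ x : F, quadraticChar F (x + a) * quadraticChar F (x + b) = -1 := by
  have hba : b - a ≠ 0 := sub_ne_zero.mpr hab.symm
  have hJ := jacobiSum_nontrivial_inv (quadraticChar_ne_one hF)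
  rw [MulChar.IsQuadratic.inv (quadraticChar_isQuadratic F), jacobiSum] at hJ
  have h1 : quadraticChar F (-1) * quadraticChar F (-1) = 1 := by
    rw [← map_mul]; simp
  have hb2 : quadraticChar F (b - a) * quadraticChar F (b - a) = 1 := by
    have := quadraticChar_sq_one hba
    rwa [pow_two] at this
  rw [← Equiv.sum_comp ((Equiv.mulRight₀ (-(b - a)) (neg_ne_zero.mpr hba)).trans
    (Equiv.addRight (-a)))]
  have : ∀ y : F, quadraticChar F
      (((Equiv.mulRight₀ (-(b - a)) (neg_ne_zero.mpr hba)).trans (Equiv.addRight (-a))) y + a) *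
      quadraticChar F
      (((Equiv.mulRight₀ (-(b - a)) (neg_ne_zero.mpr hba)).trans (Equiv.addRight (-a))) y + b) =
      quadraticChar F (-1) * (quadraticChar F y * quadraticChar F (1 - y)) := by
    intro y
    have e1 : ((Equiv.mulRight₀ (-(b - a)) (neg_ne_zero.mpr hba)).trans
        (Equiv.addRight (-a))) y + a = (-1) * y * (b - a) := by
      simp; ring
    have e2 : ((Equiv.mulRight₀ (-(b - a)) (neg_ne_zero.mpr hba)).trans
        (Equiv.addRight (-a))) y + b = (1 - y) * (b - a) := by
      simp; ring
    rw [e1, e2, map_mul, map_mul, map_mul (quadraticChar F) (1 - y)]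
    linear_combination (quadraticChar F (-1) * (quadraticChar F y * quadraticChar F (1 - y))) * hb2
  simp_rw [this]
  rw [← Finset.mul_sum, hJ]
  linear_combination -h1

/-- Over a finite field every curve `D_Λ` with `n ≠ 0` has a point, by comparing character sums. -/
theorem exists_isSquare_triple (hF : ringChar F ≠ 2) {n d₁ d₂ : F} (hn : n ≠ 0) (h₁ : d₁ ≠ 0)
    (h₂ : d₂ ≠ 0) (hns : ¬ (IsSquare d₁ ∧ IsSquare d₂)) :
    ∃ x : F, IsSquare ((x - n) * d₁) ∧ IsSquare ((x + n) * d₂) ∧ IsSquare (x * (d₁ * d₂)) := by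
  have h2 : (2 : F) ≠ 0 := Ring.two_ne_zero hF
  set χ := quadraticChar F with hχ
  have hχ_ge : ∀ x, -1 ≤ χ x := by
    intro x
    by_cases hx : x = 0
    · rw [hx, MulChar.map_zero]; norm_num
    · rcases quadraticChar_dichotomy hx with h | h <;> rw [hχ, h] <;> norm_num
  -- With a = χ(d₁) and b = χ(d₂), a summand is non-zero only if x - n, x + n and x each vanish or
  -- have the required quadratic character.
  set S : ℤ → ℤ → ℤ := fun a b =>
    ∑ x : F, (1 + a * χ (x - n)) * (1 + b * χ (x + n)) * (1 + a * b * χ x) with hS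
  have hsum : ∀ c : F, ∑ x : F, χ (x + c) = 0 := by
    intro c
    exact (Equiv.sum_comp (Equiv.addRight c) (fun x => χ x)).trans (quadraticChar_sum_zero hF)
  -- Linear character sums vanish and quadratic ones equal -1. The unknown cubic sum has coefficient
  -- (ab)² = 1, so it is the same for all signs.
  have hSval : ∀ a b : ℤ, a ^ 2 = 1 → b ^ 2 = 1 →
      S a b = Fintype.card F + ∑ x : F, χ (x - n) * χ (x + n) * χ x - (a + b + a * b) := by
    intro a b ha hb
    have e : ∀ x : F, (1 + a * χ (x - n)) * (1 + b * χ (x + n)) * (1 + a * b * χ x) =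
        1 + a * χ (x + -n) + b * χ (x + n) + a * b * χ (x + 0) + a * b * (χ (x + -n) * χ (x + n)) +
        b * (χ (x + -n) * χ (x + 0)) + a * (χ (x + n) * χ (x + 0)) +
        χ (x - n) * χ (x + n) * χ x := by
      intro x
      rw [add_zero, ← sub_eq_add_neg]
      linear_combination (b * χ (x - n) * χ x + b ^ 2 * χ (x - n) * χ (x + n) * χ x) * ha +
        (a * χ (x + n) * χ x + χ (x - n) * χ (x + n) * χ x) * hb
    have hnn : -n ≠ n := by
      intro h
      exact mul_ne_zero h2 hn (by linear_combination -h)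
    simp only [hS]
    simp_rw [e]
    simp only [Finset.sum_add_distrib, ← Finset.mul_sum, hsum]
    rw [sum_quadraticChar_mul_shift hF hnn,
      sum_quadraticChar_mul_shift hF (neg_ne_zero.mpr hn), sum_quadraticChar_mul_shift hF hn]
    simp only [Finset.sum_const, Finset.card_univ, nsmul_eq_mul, mul_one, mul_zero]
    ring
  have hpm : ∀ d : F, d ≠ 0 → χ d ^ 2 = 1 := fun d hd => quadraticChar_sq_one hd
  have hnonneg : 0 ≤ S 1 1 := by
    refine Finset.sum_nonneg fun x _ => ?_
    have := hχ_ge x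
    have := hχ_ge (x - n)
    have := hχ_ge (x + n)
    exact mul_nonneg (mul_nonneg (by linarith) (by linarith)) (by linarith)
  -- The quantity a + b + ab is 3 for a = b = 1 and -1 for the other signs, so S here exceeds S 1 1
  -- ≥ 0 by 4.
  have hpos : 0 < S (χ d₁) (χ d₂) := by
    rw [hSval 1 1 (by norm_num) (by norm_num)] at hnonneg
    rw [hSval _ _ (hpm d₁ h₁) (hpm d₂ h₂)]
    rcases quadraticChar_dichotomy h₁ with k₁ | k₁ <;>
      rcases quadraticChar_dichotomy h₂ with k₂ | k₂ <;>
      (rw [← hχ] at k₁ k₂; rw [k₁, k₂])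
    · exact absurd ⟨(quadraticChar_one_iff_isSquare h₁).mp k₁,
        (quadraticChar_one_iff_isSquare h₂).mp k₂⟩ hns
    all_goals linarith
  obtain ⟨x, -, hx⟩ := Finset.exists_ne_zero_of_sum_ne_zero hpos.ne'
  have hsq : ∀ {d y : F}, d ≠ 0 → 1 + χ d * χ y ≠ 0 → IsSquare (y * d) := by
    intro d y hd h
    by_cases hy : y = 0
    · exact ⟨0, by rw [hy]; ring⟩
    rw [← quadraticChar_one_iff_isSquare (mul_ne_zero hy hd)]
    rcases quadraticChar_dichotomy (mul_ne_zero hy hd) with k | k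
    · exact k
    · rw [← map_mul, mul_comm, hχ, k] at h
      norm_num at h
  rw [← map_mul χ d₁ d₂] at hx
  refine ⟨x, hsq h₁ (left_ne_zero_of_mul (left_ne_zero_of_mul hx)),
    hsq h₂ (right_ne_zero_of_mul (left_ne_zero_of_mul hx)),
    hsq (mul_ne_zero h₁ h₂) (right_ne_zero_of_mul hx)⟩

end FiniteField

/-- If d₁ and d₂ are squares modulo q, the points at infinity are rational over ℚ_q. This is the
case in which the character sum may vanish. Otherwise a point over 𝔽_q exists and lifts. -/
theorem dHasPoint_padic_of_coprime {q : ℕ} [Fact q.Prime] (hq : q ≠ 2) {n d₁ d₂ : ℕ}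
    (hn : ¬ q ∣ n) (h₁ : ¬ q ∣ d₁) (h₂ : ¬ q ∣ d₂) :
    DHasPoint ℚ_[q] n d₁ d₂ (d₁ * d₂) := by
  have z : ∀ {m : ℕ}, ¬ q ∣ m → (m : ZMod q) ≠ 0 := fun hm h =>
    hm ((ZMod.natCast_eq_zero_iff _ _).mp h)
  have hz : ∀ {m : ℕ}, ¬ q ∣ m → (m : ℚ_[q]) ≠ 0 := fun {m} hm h =>
    hm (by rw [Nat.cast_eq_zero.mp h]; exact dvd_zero q)
  by_cases hs : IsSquare (d₁ : ZMod q) ∧ IsSquare (d₂ : ZMod q)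
  · have key : ∀ {m : ℕ}, ¬ q ∣ m → IsSquare (m : ZMod q) → IsSquare (m : ℚ_[q]) := by
      intro m hm h
      have := (Padic.isSquare_intCast_iff hq (m := m) (by simpa using z hm)).mpr (by simpa using h)
      simpa using this
    have k₁ := key h₁ hs.1
    have k₂ := key h₂ hs.2
    exact .of_isSquare_infinity _ (hz h₁) (hz h₂) (mul_ne_zero (hz h₁) (hz h₂)) k₁ k₂ (k₁.mul k₂)
  · have hchar : ringChar (ZMod q) ≠ 2 := by rwa [ZMod.ringChar_zmod_n]
    have h2 : (2 : ZMod q) ≠ 0 := Ring.two_ne_zero hchar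
    obtain ⟨x, s₁, s₂, s₃⟩ := exists_isSquare_triple hchar (z hn) (z h₁) (z h₂) hs
    -- The lift is chosen so that a factor vanishing modulo q vanishes exactly. Since 2n is a unit
    -- only one factor can vanish, and the abscissa is then n, -n or 0. Non-vanishing factors are
    -- units, whose squareness is decided modulo q.
    obtain ⟨X, hX, c₁, c₂, c₃⟩ : ∃ X : ℤ, (X : ZMod q) = x ∧
        (((X - n : ℤ) : ZMod q) = 0 → X - n = 0) ∧ (((X + n : ℤ) : ZMod q) = 0 → X + n = 0) ∧
        ((X : ZMod q) = 0 → X = 0) := by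
      by_cases e₁ : x = n
      · refine ⟨n, by simp [e₁], by simp, fun h => absurd h ?_, fun h => absurd h ?_⟩
        · push_cast
          rw [← two_mul]
          exact mul_ne_zero h2 (z hn)
        · simpa using z hn
      by_cases e₂ : x = -n
      · refine ⟨-n, by simp [e₂], fun h => absurd h ?_, by simp, fun h => absurd h ?_⟩
        · push_cast
          rw [← neg_add', ← two_mul]
          exact neg_ne_zero.mpr (mul_ne_zero h2 (z hn))
        · simpa using z hn
      by_cases e₃ : x = 0
      · refine ⟨0, by simp [e₃], fun h => absurd h ?_, fun h => absurd h ?_, by simp⟩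
        · simpa using z hn
        · simpa using z hn
      obtain ⟨X, rfl⟩ := ZMod.intCast_surjective x
      refine ⟨X, rfl, fun h => absurd h ?_, fun h => absurd h ?_, fun h => absurd h e₃⟩
      · push_cast
        rwa [sub_eq_zero]
      · push_cast
        rwa [add_eq_zero_iff_eq_neg]
    have key : ∀ {c : ℤ} {m : ℕ}, ¬ q ∣ m → ((c : ZMod q) = 0 → c = 0) →
        IsSquare ((c : ZMod q) * m) → IsSquare ((c : ℚ_[q]) * m) := by
      intro c m hm hc h
      by_cases hc0 : (c : ZMod q) = 0
      · rw [hc hc0]; simp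
      · have := (Padic.isSquare_intCast_iff hq (m := c * m)
          (by push_cast; exact mul_ne_zero hc0 (z hm))).mpr (by simpa using h)
        simpa using this
    have k₁ := key h₁ c₁ (by push_cast; rwa [hX])
    have k₂ := key h₂ c₂ (by push_cast; rwa [hX])
    have hd : ¬ q ∣ d₁ * d₂ := fun h =>
      ((Fact.out : q.Prime).dvd_mul.mp h).elim h₁ h₂
    have k₃ := key hd c₃ (by push_cast; rwa [hX])
    push_cast at k₁ k₂ k₃
    exact .of_isSquare X (hz h₁) (hz h₂) (mul_ne_zero (hz h₁) (hz h₂)) k₁ k₂ k₃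

/-! ### Points at the primes dividing n, at the real place and at 2 -/

section LocalSufficiency

/-- Up to signs, which are squares here, the four alternatives are the Kummer images (1, 1), (n, n),
(2, 2n), (2n, 2) of O, (0, 0), (n, 0), (-n, 0). Those points supply the abscissa. -/
theorem DHasPoint.of_torsion_class {F : Type*} [Field F] (h2 : (2 : F) ≠ 0)
    (hneg : IsSquare (-1 : F)) {n d₁ d₂ : F} (h₁ : d₁ ≠ 0) (h₂ : d₂ ≠ 0)
    (h : (IsSquare d₁ ∧ IsSquare d₂) ∨ (IsSquare (n * d₁) ∧ IsSquare (n * d₂)) ∨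
      (IsSquare (2 * d₁) ∧ IsSquare (2 * n * d₂)) ∨ (IsSquare (2 * n * d₁) ∧ IsSquare (2 * d₂))) :
    DHasPoint F n d₁ d₂ (d₁ * d₂) := by
  have h₃ := mul_ne_zero h₁ h₂
  have h4 : (2 * 2 : F) ≠ 0 := mul_ne_zero h2 h2
  rcases h with ⟨s₁, s₂⟩ | ⟨s₁, s₂⟩ | ⟨s₁, s₂⟩ | ⟨s₁, s₂⟩
  · exact .of_isSquare_infinity n h₁ h₂ h₃ s₁ s₂ (s₁.mul s₂)
  · refine .of_isSquare 0 h₁ h₂ h₃ ?_ (by rwa [zero_add]) (by simp)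
    have := hneg.mul s₁
    rwa [show (0 - n) * d₁ = -1 * (n * d₁) by ring]
  · refine .of_isSquare n h₁ h₂ h₃ (by simp) (by rwa [← two_mul]) ?_
    refine isSquare_of_mul (b := 2 * 2) ?_ ⟨2, rfl⟩ h4
    rw [show n * (d₁ * d₂) * (2 * 2) = (2 * d₁) * (2 * n * d₂) by ring]
    exact s₁.mul s₂
  · refine .of_isSquare (-n) h₁ h₂ h₃ ?_ (by simp) ?_
    · rw [show (-n - n) * d₁ = -1 * (2 * n * d₁) by ring]
      exact hneg.mul s₁
    refine isSquare_of_mul (b := 2 * 2) ?_ ⟨2, rfl⟩ h4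
    rw [show -n * (d₁ * d₂) * (2 * 2) = -1 * ((2 * n * d₁) * (2 * d₂)) by ring]
    exact hneg.mul (s₁.mul s₂)

theorem dHasPoint_real {n d₁ d₂ : ℕ} (h₁ : d₁ ≠ 0) (h₂ : d₂ ≠ 0) :
    DHasPoint ℝ n d₁ d₂ (d₁ * d₂) := by
  have key : ∀ m : ℕ, IsSquare (m : ℝ) := fun m =>
    ⟨√m, (Real.mul_self_sqrt (Nat.cast_nonneg m)).symm⟩
  have z₁ : (d₁ : ℝ) ≠ 0 := by exact_mod_cast h₁
  have z₂ : (d₂ : ℝ) ≠ 0 := by exact_mod_cast h₂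
  exact .of_isSquare_infinity _ z₁ z₂ (mul_ne_zero z₁ z₂) (key _) (key _) ((key _).mul (key _))

theorem Padic.isSquare_intCast_two {m : ℤ} (hm : m ≡ 1 [ZMOD 8]) : IsSquare (m : ℚ_[2]) := by
  have h2 : ‖(2 : ℚ_[2])‖ = 2⁻¹ := by
    simpa using Padic.norm_p (p := 2)
  have h8 : ‖((m - 1 : ℤ) : ℚ_[2])‖ ≤ ((2 : ℕ) : ℝ) ^ (-(3 : ℕ) : ℤ) := by
    rw [Padic.norm_int_le_pow_iff_dvd]
    exact (Int.modEq_iff_dvd.mp hm.symm)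
  have := Padic.isSquare_mul_of_norm_sub_lt (p := 2) (a := (m : ℚ_[2])) (b := 1) (by
    rw [h2]
    push_cast at h8
    refine lt_of_le_of_lt h8 ?_
    rw [norm_one]
    norm_num)
  rwa [mul_one] at this

/-- The congruences leave two cases: d₁ and d₂ are both 1 modulo 8, hence squares in ℚ₂, or both 5
modulo 8. -/
theorem dHasPoint_two {n d₁ d₂ : ℕ} (hn : n ≡ 1 [MOD 8]) (h₁ : d₁ ≡ 1 [MOD 4])
    (h₂ : d₂ ≡ 1 [MOD 4]) (h : d₁ * d₂ ≡ 1 [MOD 8]) : DHasPoint ℚ_[2] n d₁ d₂ (d₁ * d₂) := by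
  have z₁ : (d₁ : ℚ_[2]) ≠ 0 := by
    rw [Nat.cast_ne_zero]; rintro rfl; exact absurd h₁ (by decide)
  have z₂ : (d₂ : ℚ_[2]) ≠ 0 := by
    rw [Nat.cast_ne_zero]; rintro rfl; exact absurd h₂ (by decide)
  have h4 : (4 : ℚ_[2]) ≠ 0 := by norm_num
  have sq4 : ∀ {a : ℚ_[2]}, IsSquare (a * 4) → IsSquare a := fun ha =>
    isSquare_of_mul ha ⟨2, by norm_num⟩ h4
  have key : ∀ {m : ℤ} {a : ℚ_[2]}, m ≡ 1 [ZMOD 8] → a * 4 = m → IsSquare a := fun hm ha =>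
    sq4 (by rw [ha]; exact Padic.isSquare_intCast_two hm)
  have hm : ∀ {a b : ℕ}, a ≡ b [MOD 8] → (a : ℤ) ≡ b [ZMOD 8] := fun h =>
    (Int.natCast_modEq_iff).mpr h
  have h58 : ∀ a : ℕ, a ≡ 1 [MOD 4] → a ≡ 1 [MOD 8] ∨ a ≡ 5 [MOD 8] := by
    intro a ha
    simp only [Nat.ModEq] at *
    omega
  have hprod := hm h
  have hn' := hm hn
  push_cast at hprod hn'
  rcases h58 d₁ h₁ with k₁ | k₁ <;> rcases h58 d₂ h₂ with k₂ | k₂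
  · have s₁ := Padic.isSquare_intCast_two (hm k₁)
    have s₂ := Padic.isSquare_intCast_two (hm k₂)
    simp only [Int.cast_natCast] at s₁ s₂
    exact .of_isSquare_infinity _ z₁ z₂ (mul_ne_zero z₁ z₂) s₁ s₂ (s₁.mul s₂)
  · exact absurd ((k₁.mul k₂).symm.trans h) (by decide)
  · exact absurd ((k₁.mul k₂).symm.trans h) (by decide)
  · have k₁' := hm k₁
    have k₂' := hm k₂
    push_cast at k₁' k₂'
    -- For x = n/4 the three factors are -3n/4, 5n/4 and n/4. Both -3 and 5 are 5 modulo 8, which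
    -- matches d₁ and d₂.
    refine .of_isSquare (n / 4 : ℚ_[2]) z₁ z₂ (mul_ne_zero z₁ z₂) (key (m := -3 * n * d₁) ?_ ?_)
      (key (m := 5 * n * d₂) ?_ ?_) (key (m := n * (d₁ * d₂)) ?_ ?_)
    · exact (((Int.ModEq.refl (-3)).mul hn').mul k₁').trans (by decide)
    · push_cast
      field_simp
      ring
    · exact (((Int.ModEq.refl 5).mul hn').mul k₂').trans (by decide)
    · push_cast
      field_simp
      ring
    · exact (hn'.mul hprod).trans (by decide)
    · push_cast
      field_simp

end LocalSufficiency

/-! ### Necessary local conditions -/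

section LocalNecessity

/-- If d₂ < 0 then x ≤ -n, so x - n and x are negative. All three dᵢ are then negative and their
product cannot be a square. -/
theorem DHasPoint.real_pos {n d₁ d₂ d₃ : ℝ} (hn : 0 < n) (h₁ : d₁ ≠ 0) (h₂ : d₂ ≠ 0) (h₃ : d₃ ≠ 0)
    (hs : ∃ s, d₁ * d₂ * d₃ = s ^ 2) (h : DHasPoint ℝ n d₁ d₂ d₃) : 0 < d₂ := by
  rcases h.cases h₁ h₂ h₃ hs with ⟨-, ⟨r, hr, rfl⟩, -⟩ | ⟨x, u, v, w, k₁, k₂, k₃⟩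
  · positivity
  · by_contra hlt
    have hd₂ : d₂ < 0 := lt_of_le_of_ne (not_lt.mp hlt) h₂
    have hneg : ∀ {d y u : ℝ}, y < 0 → y = d * u ^ 2 → d < 0 := by
      intro d y u hy e
      by_contra hd
      have : 0 ≤ d * u ^ 2 := mul_nonneg (not_lt.mp hd) (sq_nonneg u)
      linarith
    have hx : x ≤ -n := by nlinarith [sq_nonneg v]
    have hd₁ := hneg (by linarith) k₁
    have hd₃ := hneg (by linarith) k₃
    obtain ⟨s, hs⟩ := hs
    have : d₁ * d₂ * d₃ < 0 := mul_neg_of_pos_of_neg (mul_pos_of_neg_of_neg hd₁ hd₂) hd₃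
    nlinarith [sq_nonneg s]

variable {q : ℕ} [Fact q.Prime]

theorem Padic.even_valuation_of_isSquare {a : ℚ_[q]} (ha : a ≠ 0) (h : IsSquare a) :
    Even a.valuation := by
  obtain ⟨r, rfl⟩ := h
  have hr : r ≠ 0 := by rintro rfl; simp at ha
  exact ⟨r.valuation, Padic.valuation_mul hr hr⟩

theorem Padic.even_valuation_iff {a b : ℚ_[q]} (ha : a ≠ 0) (hb : b ≠ 0) (h : IsSquare (a * b)) :
    Even a.valuation ↔ Even b.valuation := by
  have := Padic.even_valuation_of_isSquare (mul_ne_zero ha hb) h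
  rw [Padic.valuation_mul ha hb, Int.even_add] at this
  exact this

theorem Padic.valuation_eq_of_norm_eq {a b : ℚ_[q]} (ha : a ≠ 0) (hb : b ≠ 0) (h : ‖a‖ = ‖b‖) :
    a.valuation = b.valuation := by
  rw [Padic.norm_eq_zpow_neg_valuation ha, Padic.norm_eq_zpow_neg_valuation hb] at h
  have hq := (Fact.out : q.Prime).one_lt
  have := zpow_right_injective₀ (a := (q : ℝ)) (by positivity) (by exact_mod_cast hq.ne') h
  omega

theorem Padic.norm_eq_of_norm_sub_lt {a b : ℚ_[q]} (h : ‖a - b‖ < ‖b‖) : ‖a‖ = ‖b‖ := by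
  have := Padic.add_eq_max_of_ne h.ne
  rwa [sub_add_cancel, max_eq_right h.le] at this

/-- The points of `D_Λ` outside the primes dividing `n` have even valuations. -/
theorem DHasPoint.even_valuation {n d₁ d₂ d₃ : ℚ_[q]} (hn : ‖n‖ = 1) (h₁ : d₁ ≠ 0) (h₂ : d₂ ≠ 0)
    (h₃ : d₃ ≠ 0) (hs : ∃ s, d₁ * d₂ * d₃ = s ^ 2) (h : DHasPoint ℚ_[q] n d₁ d₂ d₃) :
    Even d₃.valuation ∧ (q ≠ 2 → Even d₁.valuation ∧ Even d₂.valuation) := by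
  have hsum : Even (d₁.valuation + d₂.valuation + d₃.valuation) := by
    obtain ⟨s, hs⟩ := hs
    rw [← Padic.valuation_mul h₁ h₂, ← Padic.valuation_mul (mul_ne_zero h₁ h₂) h₃]
    exact Padic.even_valuation_of_isSquare (mul_ne_zero (mul_ne_zero h₁ h₂) h₃)
      ⟨s, by rw [hs, pow_two]⟩
  rw [Int.even_add, Int.even_add] at hsum
  have par : ∀ {y d u : ℚ_[q]}, d ≠ 0 → y ≠ 0 → y = d * u ^ 2 →
      (Even d.valuation ↔ Even y.valuation) := by
    intro y d u hd hy e
    exact Padic.even_valuation_iff hd hy ⟨d * u, by rw [e]; ring⟩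
  have unit : ∀ {y d u : ℚ_[q]}, d ≠ 0 → ‖y‖ = 1 → y = d * u ^ 2 → Even d.valuation := by
    intro y d u hd hy e
    have hy0 : y ≠ 0 := by rintro rfl; simp at hy
    rw [par hd hy0 e, Padic.valuation_eq_of_norm_eq hy0 one_ne_zero (by rw [hy, norm_one])]
    simp
  rcases h.cases h₁ h₂ h₃ hs with ⟨s₁, s₂, s₃⟩ | ⟨x, u, v, w, k₁, k₂, k₃⟩
  · have sq : ∀ {d : ℚ_[q]}, d ≠ 0 → (∃ r, r ≠ 0 ∧ d = r ^ 2) → Even d.valuation := by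
      rintro d hd ⟨r, -, rfl⟩
      exact Padic.even_valuation_of_isSquare hd ⟨r, pow_two r⟩
    exact ⟨sq h₃ s₃, fun _ => ⟨sq h₁ s₁, sq h₂ s₂⟩⟩
  · rw [sub_neg_eq_add] at k₂
    rw [sub_zero] at k₃
    -- For |x| < 1 both x ± n are units. For |x| = 1 the factor x is a unit and, if q is odd, so is
    -- one of x ± n, since they differ by the unit 2n. For |x| > 1 all three factors have the
    -- valuation of x. In each case the evenness of the sum of the valuations of the dᵢ settles the
    -- rest.
    rcases lt_trichotomy ‖x‖ 1 with hx | hx | hx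
    · have e₁ : ‖x - n‖ = 1 := by
        rw [Padic.norm_eq_of_norm_sub_lt (b := -n) (by simpa [hn] using hx), norm_neg, hn]
      have e₂ : ‖x + n‖ = 1 := by
        rw [Padic.norm_eq_of_norm_sub_lt (b := n) (by simpa [hn] using hx), hn]
      have := unit h₁ e₁ k₁
      have := unit h₂ e₂ k₂
      tauto
    · have p₃ := unit h₃ hx k₃
      refine ⟨p₃, fun hq => ?_⟩
      have hor : ‖x - n‖ = 1 ∨ ‖x + n‖ = 1 := by
        by_cases hlt : ‖x - n‖ < 1
        · right
          rw [Padic.norm_eq_of_norm_sub_lt (b := 2 * n), norm_mul, Padic.norm_two hq, hn, one_mul]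
          rw [norm_mul, Padic.norm_two hq, hn, one_mul]
          convert hlt using 2
          ring
        · left
          refine le_antisymm ?_ (not_lt.mp hlt)
          have := Padic.nonarchimedean x (-n)
          rwa [norm_neg, hx, hn, max_self, ← sub_eq_add_neg] at this
      rcases hor with e | e
      · have := unit h₁ e k₁
        tauto
      · have := unit h₂ e k₂
        tauto
    · have hx0 : x ≠ 0 := by rintro rfl; rw [norm_zero] at hx; linarith
      have e₁ : ‖x - n‖ = ‖x‖ := Padic.norm_eq_of_norm_sub_lt (by simpa [hn] using hx)
      have e₂ : ‖x + n‖ = ‖x‖ := Padic.norm_eq_of_norm_sub_lt (by simpa [hn] using hx)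
      have z₁ : x - n ≠ 0 := norm_ne_zero_iff.mp (by rw [e₁]; linarith)
      have z₂ : x + n ≠ 0 := norm_ne_zero_iff.mp (by rw [e₂]; linarith)
      have p₁ := par h₁ z₁ k₁
      have p₂ := par h₂ z₂ k₂
      have p₃ := par h₃ hx0 k₃
      rw [Padic.valuation_eq_of_norm_eq z₁ hx0 e₁] at p₁
      rw [Padic.valuation_eq_of_norm_eq z₂ hx0 e₂] at p₂
      tauto

/-- At a prime dividing `n` exactly once, the local Kummer image comes from `2`-torsion. -/
theorem DHasPoint.torsion_class {n d₁ d₂ d₃ : ℚ_[q]} (hq : q ≠ 2) (hneg : IsSquare (-1 : ℚ_[q]))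
    (hn : ‖n‖ = (q : ℝ)⁻¹) (h₁ : d₁ ≠ 0) (h₂ : d₂ ≠ 0)
    (h₃ : d₃ ≠ 0) (hs : ∃ s, d₁ * d₂ * d₃ = s ^ 2) (h : DHasPoint ℚ_[q] n d₁ d₂ d₃) :
    (IsSquare d₁ ∧ IsSquare d₂) ∨ (IsSquare (n * d₁) ∧ IsSquare (n * d₂)) ∨
      (IsSquare (2 * d₁) ∧ IsSquare (2 * n * d₂)) ∨
      (IsSquare (2 * n * d₁) ∧ IsSquare (2 * d₂)) := by
  have hq1 : (1 : ℝ) < q := by exact_mod_cast (Fact.out : q.Prime).one_lt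
  have hn0 : n ≠ 0 := norm_ne_zero_iff.mp (by rw [hn]; positivity)
  have h20 : (2 : ℚ_[q]) ≠ 0 := two_ne_zero
  have hn1 : ‖n‖ < 1 := by rw [hn]; exact inv_lt_one_of_one_lt₀ hq1
  have h2n : ‖2 * n‖ = ‖n‖ := by rw [norm_mul, Padic.norm_two hq, one_mul]
  rcases h.cases h₁ h₂ h₃ hs with ⟨⟨r, -, s₁⟩, ⟨r', -, s₂⟩, -⟩ | ⟨x, u, v, w, k₁, k₂, k₃⟩
  · exact .inl ⟨⟨r, by rw [s₁, pow_two]⟩, ⟨r', by rw [s₂, pow_two]⟩⟩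
  rw [sub_neg_eq_add] at k₂
  rw [sub_zero] at k₃
  obtain ⟨s, hs⟩ := hs
  have hs0 : s ≠ 0 := by
    rintro rfl
    exact mul_ne_zero (mul_ne_zero h₁ h₂) h₃ (by rw [hs]; ring)
  have cls : ∀ {y d u c : ℚ_[q]}, y = d * u ^ 2 → ‖y - c‖ < ‖c‖ → IsSquare (c * d) := by
    intro y d u c e hc
    have hy0 : y ≠ 0 := by
      rintro rfl
      rw [zero_sub, norm_neg] at hc
      exact lt_irrefl _ hc
    have := Padic.isSquare_mul_of_norm_sub_lt' hq hc
    rw [mul_comm] at this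
    exact isSquare_mul_trans this ⟨d * u, by rw [e]; ring⟩ hy0
  have third : ∀ {a b c : ℚ_[q]}, a ≠ 0 → b ≠ 0 → IsSquare a → IsSquare b → IsSquare (a * b * c) →
      IsSquare c := by
    intro a b c ha hb sa sb sc
    rw [mul_comm] at sc
    exact isSquare_of_mul sc (sa.mul sb) (mul_ne_zero ha hb)
  have negn : ∀ {c d : ℚ_[q]}, IsSquare (-c * d) → IsSquare (c * d) := by
    intro c d hcd
    have := hneg.mul hcd
    rwa [show -1 * (-c * d) = c * d by ring] at this
  -- The point is compared with the nearest torsion point: (0, 0) for |x| < |n|, one of (±n, 0) for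
  -- |x| = |n|, and O for |x| > |n|. Nearby factors have equal square classes.
  rcases lt_trichotomy ‖x‖ ‖n‖ with hx | hx | hx
  · right; left
    exact ⟨negn (cls k₁ (c := -n) (by simpa using hx)), cls k₂ (by simpa using hx)⟩
  -- Otherwise all three factors have valuation 1, and their product, which is a square, would have
  -- valuation 3.
  · have hor : ‖x - n‖ < ‖n‖ ∨ ‖x + n‖ < ‖n‖ := by
      by_contra! hcon
      have e₁ : ‖x - n‖ = ‖n‖ := by
        refine le_antisymm ?_ hcon.1
        have := Padic.nonarchimedean x (-n)
        rwa [norm_neg, hx, max_self, ← sub_eq_add_neg] at this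
      have e₂ : ‖x + n‖ = ‖n‖ := by
        refine le_antisymm ?_ hcon.2
        have := Padic.nonarchimedean x n
        rwa [hx, max_self] at this
      have nz : ∀ {y : ℚ_[q]}, ‖y‖ = ‖n‖ → y ≠ 0 := fun e => norm_ne_zero_iff.mp
        (by rw [e, hn]; positivity)
      have v1 : n.valuation = 1 := by
        have := Padic.valuation_eq_of_norm_eq (a := n) (b := (q : ℚ_[q])) hn0
          (by exact_mod_cast (Fact.out : q.Prime).ne_zero) (by rw [hn, Padic.norm_p])
        rw [this, Padic.valuation_p]
      have hev : Even ((x - n) * (x + n) * x).valuation := by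
        refine Padic.even_valuation_of_isSquare
          (mul_ne_zero (mul_ne_zero (nz e₁) (nz e₂)) (nz hx)) ⟨s * u * v * w, ?_⟩
        rw [k₁, k₂]
        nth_rewrite 1 [k₃]
        linear_combination (u * v * w) ^ 2 * hs
      rw [Padic.valuation_mul (mul_ne_zero (nz e₁) (nz e₂)) (nz hx),
        Padic.valuation_mul (nz e₁) (nz e₂), Padic.valuation_eq_of_norm_eq (nz e₁) hn0 e₁,
        Padic.valuation_eq_of_norm_eq (nz e₂) hn0 e₂, Padic.valuation_eq_of_norm_eq (nz hx) hn0 hx,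
        v1] at hev
      exact absurd hev (by decide)
    rcases hor with hlt | hlt
    · right; right; left
      have a₂ : IsSquare (2 * n * d₂) := cls k₂ (by
        rw [h2n]
        convert hlt using 2
        ring)
      have a₃ : IsSquare (n * d₃) := cls k₃ hlt
      refine ⟨third (mul_ne_zero (mul_ne_zero h20 hn0) h₂) (mul_ne_zero hn0 h₃) a₂ a₃ ?_, a₂⟩
      exact ⟨2 * n * s, by linear_combination (2 * n) ^ 2 * hs⟩
    · right; right; right
      have a₁ : IsSquare (2 * n * d₁) := negn (cls k₁ (c := -(2 * n)) (by
        rw [norm_neg, h2n]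
        convert hlt using 2
        ring))
      have a₃ : IsSquare (n * d₃) := negn (cls k₃ (c := -n) (by
        rw [norm_neg]
        convert hlt using 2
        ring))
      refine ⟨a₁, third (mul_ne_zero (mul_ne_zero h20 hn0) h₁) (mul_ne_zero hn0 h₃) a₁ a₃ ?_⟩
      exact ⟨2 * n * s, by linear_combination (2 * n) ^ 2 * hs⟩
  · have a₁ : IsSquare (x * d₁) := cls k₁ (by simpa using hx)
    have a₂ : IsSquare (x * d₂) := cls k₂ (by simpa using hx)
    have a₃ : IsSquare (x * d₃) := ⟨d₃ * w, by rw [k₃]; ring⟩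
    have hx0 : x ≠ 0 := norm_ne_zero_iff.mp (by linarith [norm_nonneg n])
    -- All the dᵢ lie in the square class of x, and d₁d₂d₃ is a square, so x³ and hence x is a
    -- square.
    have ax : IsSquare x := by
      refine third (mul_ne_zero hx0 h₁) (mul_ne_zero (mul_ne_zero hx0 h₂) (mul_ne_zero hx0 h₃))
        a₁ (a₂.mul a₃) ⟨x * x * s, by linear_combination x ^ 4 * hs⟩
    exact .inl ⟨isSquare_of_mul (by rwa [mul_comm]) ax hx0,
      isSquare_of_mul (by rwa [mul_comm]) ax hx0⟩

end LocalNecessity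

/-! ### Divisors of n as vectors over 𝔽₂ -/

section VectorsOfPrimes

variable {k : ℕ} (p : Fin k → ℕ)

theorem prodOfVec_zero : prodOfVec p 0 = 1 := by
  simp [prodOfVec]

theorem prodOfVec_one : prodOfVec p 1 = ∏ i, p i := by
  simp [prodOfVec, ZMod.val_one]

theorem prodOfVec_mul (x y : Fin k → ZMod 2) :
    prodOfVec p x * prodOfVec p y = prodOfVec p (x + y) * prodOfVec p (x * y) ^ 2 := by
  have key : ∀ a b : ZMod 2, a.val + b.val = (a + b).val + (a * b).val * 2 := by decide
  simp only [prodOfVec, ← Finset.prod_pow, ← Finset.prod_mul_distrib, ← pow_mul, ← pow_add,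
    Pi.add_apply, Pi.mul_apply, key]

theorem prodOfVec_mul_add_one (x : Fin k → ZMod 2) :
    prodOfVec p x * prodOfVec p (x + 1) = ∏ i, p i := by
  have key : ∀ a : ZMod 2, a.val + (a + 1).val = 1 := by decide
  simp only [prodOfVec, ← Finset.prod_mul_distrib, ← pow_add, Pi.add_apply, Pi.one_apply, key,
    pow_one]

theorem prodOfVec_dvd (x : Fin k → ZMod 2) : prodOfVec p x ∣ ∏ i, p i :=
  ⟨_, (prodOfVec_mul_add_one p x).symm⟩

theorem prodOfVec_modEq (hp : ∀ i, p i ≡ 1 [MOD 4]) (x : Fin k → ZMod 2) :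
    prodOfVec p x ≡ 1 [MOD 4] := by
  rw [← ZMod.natCast_eq_natCast_iff]
  simp only [prodOfVec, Nat.cast_prod, Nat.cast_pow]
  refine Finset.prod_eq_one fun i _ => ?_
  rw [(ZMod.natCast_eq_natCast_iff _ _ _).mpr (hp i)]
  simp

variable {p} in
theorem ne_two_of_modEq (hp : ∀ i, p i ≡ 1 [MOD 4]) (i : Fin k) : p i ≠ 2 := fun h => by
  have := hp i
  rw [h] at this
  exact absurd this (by decide)

variable [∀ i, Fact (p i).Prime]

theorem prodOfVec_ne_zero (x : Fin k → ZMod 2) : prodOfVec p x ≠ 0 :=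
  Finset.prod_ne_zero_iff.mpr fun i _ => pow_ne_zero _ (Fact.out : (p i).Prime).ne_zero

theorem prime_dvd_prodOfVec {q : ℕ} (hq : q.Prime) {x : Fin k → ZMod 2}
    (h : q ∣ prodOfVec p x) : ∃ i, q = p i ∧ x i = 1 := by
  obtain ⟨i, -, hi⟩ := (Prime.dvd_finsetProd_iff hq.prime _).mp h
  refine ⟨i, (Nat.prime_dvd_prime_iff_eq hq Fact.out).mp (hq.dvd_of_dvd_pow hi), ?_⟩
  rcases zmod_two_cases (x i) with h0 | h1
  · rw [h0] at hi
    simp only [ZMod.val_zero, pow_zero, Nat.dvd_one] at hi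
    exact absurd hi hq.one_lt.ne'
  · exact h1

variable {p}

theorem injective_of_squarefree_prod (hsq : Squarefree (∏ i, p i)) : Function.Injective p := by
  intro i j hij
  by_contra hne
  have h1 : p i * p i ∣ ∏ i, p i := by
    nth_rewrite 2 [hij]
    rw [← Finset.prod_pair (f := p) hne]
    exact Finset.prod_dvd_prod_of_subset _ _ _ (Finset.subset_univ _)
  have := Nat.isUnit_iff.mp (hsq _ h1)
  exact (Fact.out : (p i).Prime).one_lt.ne' this

theorem dvd_prodOfVec_iff (hinj : Function.Injective p) (x : Fin k → ZMod 2) (i : Fin k) :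
    p i ∣ prodOfVec p x ↔ x i = 1 := by
  constructor
  · intro h
    obtain ⟨j, hj, hx⟩ := prime_dvd_prodOfVec p Fact.out h
    rwa [hinj hj]
  · intro h
    have : p i ^ (x i).val ∣ prodOfVec p x :=
      Finset.dvd_prod_of_mem (fun i => p i ^ (x i).val) (Finset.mem_univ i)
    rwa [h, ZMod.val_one, pow_one] at this

theorem exists_prodOfVec_eq (hsq : Squarefree (∏ i, p i)) {d : ℕ} (hd : d ∣ ∏ i, p i) :
    ∃ x : Fin k → ZMod 2, prodOfVec p x = d := by
  have hinj := injective_of_squarefree_prod hsq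
  refine ⟨fun i => if p i ∣ d then 1 else 0, ?_⟩
  rw [Nat.Squarefree.ext_iff (hsq.squarefree_of_dvd (prodOfVec_dvd p _))
    (hsq.squarefree_of_dvd hd)]
  intro q hq
  constructor
  · intro h
    obtain ⟨i, rfl, hi⟩ := prime_dvd_prodOfVec p hq h
    by_contra hcon
    simp [hcon] at hi
  · intro h
    obtain ⟨i, -, hi⟩ := (Prime.dvd_finsetProd_iff hq.prime _).mp (h.trans hd)
    have := (Nat.prime_dvd_prime_iff_eq hq Fact.out).mp hi
    subst this
    rw [dvd_prodOfVec_iff hinj]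
    simp [h]

theorem prodOfVec_injective (hinj : Function.Injective p) :
    Function.Injective (prodOfVec p) := by
  intro x y h
  funext i
  have hx := dvd_prodOfVec_iff hinj x i
  have hy := dvd_prodOfVec_iff hinj y i
  rw [h] at hx
  rcases zmod_two_cases (x i) with h1 | h1 <;> rcases zmod_two_cases (y i) with h2 | h2 <;>
    simp_all

/-! ### The matrix `A` and the vector `B` -/

theorem matA_mulVec_one : (matA p).mulVec 1 = 0 := by
  funext i
  simp only [Matrix.mulVec, dotProduct, Pi.one_apply, mul_one, Pi.zero_apply]
  rw [← Finset.add_sum_erase _ _ (Finset.mem_univ i)]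
  have : ∑ j ∈ Finset.univ.erase i, matA p i j =
      ∑ l ∈ Finset.univ.erase i, addLegendre (p l) (p i) :=
    Finset.sum_congr rfl fun j hj => by
      simp [matA, (Finset.ne_of_mem_erase hj).symm]
  rw [this]
  simp only [matA, Matrix.of_apply, if_true]
  exact CharTwo.add_self_eq_zero _

theorem matA_isSymm (hp : ∀ i, p i ≡ 1 [MOD 4]) : (matA p).IsSymm := by
  ext i j
  by_cases h : i = j
  · subst h; rfl
  · simp only [matA, Matrix.transpose_apply, Matrix.of_apply, h, Ne.symm h, if_false, addLegendre]
    rw [legendreSym.quadratic_reciprocity_one_mod_four (hp i) (ne_two_of_modEq hp j)]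

theorem natCast_zmod_ne_zero_of_prime (hinj : Function.Injective p) {i j : Fin k} (h : j ≠ i) :
    ((p j : ℤ) : ZMod (p i)) ≠ 0 := by
  rw [Int.cast_natCast, Ne, ZMod.natCast_eq_zero_iff,
    Nat.prime_dvd_prime_iff_eq Fact.out Fact.out]
  exact fun e => h (hinj e.symm)

theorem matA_mulVec_of_eq_zero (hinj : Function.Injective p) {x : Fin k → ZMod 2} {i : Fin k}
    (hx : x i = 0) : (matA p).mulVec x i = addLegendre (prodOfVec p x) (p i) := by
  have e : (prodOfVec p x : ℤ) = ∏ j ∈ Finset.univ.erase i, (p j : ℤ) ^ (x j).val := by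
    rw [prodOfVec, ← Finset.mul_prod_erase _ _ (Finset.mem_univ i), hx]
    simp
  rw [e, addLegendre_prod, Matrix.mulVec, dotProduct,
    ← Finset.add_sum_erase _ _ (Finset.mem_univ i), hx, mul_zero, zero_add]
  · refine Finset.sum_congr rfl fun j hj => ?_
    rw [addLegendre_pow_val, mul_comm]
    simp [matA, (Finset.ne_of_mem_erase hj).symm]
  · intro j hj
    push_cast
    have := natCast_zmod_ne_zero_of_prime hinj (Finset.ne_of_mem_erase hj)
    exact pow_ne_zero _ (by simpa using this)

/-- The part of `d = ∏ p_j ^ x_j`, up to the factor `n`, that is prime to `p_i`. -/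
def coprimePart (p : Fin k → ℕ) (x : Fin k → ZMod 2) (i : Fin k) : ℕ :=
  prodOfVec p (if x i = 0 then x else x + 1)

/-- If p_i divides d, then x may be replaced by x + 1, that is d by n / d, which is prime to p_i.
This does not change `A x` because the rows of A sum to zero. -/
theorem matA_mulVec_eq (hinj : Function.Injective p) (x : Fin k → ZMod 2) (i : Fin k) :
    (matA p).mulVec x i = addLegendre (coprimePart p x i) (p i) := by
  unfold coprimePart
  rcases zmod_two_cases (x i) with h | h
  · rw [if_pos h, matA_mulVec_of_eq_zero hinj h]
  · rw [if_neg (by rw [h]; decide), ← matA_mulVec_of_eq_zero hinj (by simp [h]; decide),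
      Matrix.mulVec_add, matA_mulVec_one, add_zero]

theorem coprimePart_cast_ne_zero (hinj : Function.Injective p) (x : Fin k → ZMod 2) (i : Fin k) :
    (coprimePart p x i : ZMod (p i)) ≠ 0 := by
  rw [Ne, ZMod.natCast_eq_zero_iff, coprimePart, dvd_prodOfVec_iff hinj]
  rcases zmod_two_cases (x i) with h | h
  · rw [if_pos h, h]; decide
  · rw [if_neg (by rw [h]; decide), Pi.add_apply, Pi.one_apply, h]; decide

theorem two_cast_ne_zero (hp : ∀ i, p i ≡ 1 [MOD 4]) (i : Fin k) : (2 : ZMod (p i)) ≠ 0 :=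
  Ring.two_ne_zero (by rw [ZMod.ringChar_zmod_n]; exact ne_two_of_modEq hp i)

/-- The common dictionary between linear equations and Legendre symbols. With a scalar e it serves
both the Selmer conditions, where e = z i, and the Rédei condition, where e records the prime above
2. -/
theorem mulVec_add_mul_vecB_eq_zero_iff (hp : ∀ i, p i ≡ 1 [MOD 4]) (hinj : Function.Injective p)
    (x : Fin k → ZMod 2) (e : ZMod 2) (i : Fin k) :
    (matA p).mulVec x i + e * vecB p i = 0 ↔
      IsSquare ((2 : ZMod (p i)) ^ e.val * coprimePart p x i) := by
  have h2 : (((2 : ℤ) ^ e.val : ℤ) : ZMod (p i)) ≠ 0 := by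
    push_cast
    exact pow_ne_zero _ (two_cast_ne_zero hp i)
  have hc : (((coprimePart p x i : ℕ) : ℤ) : ZMod (p i)) ≠ 0 := by
    simpa using coprimePart_cast_ne_zero hinj x i
  rw [matA_mulVec_eq hinj, vecB, ← addLegendre_pow_val, add_comm, ← addLegendre_mul h2 hc,
    addLegendre_eq_zero_iff (by rw [Int.cast_mul]; exact mul_ne_zero h2 hc)]
  push_cast
  rfl

theorem mulVec_add_mul_vecB_eq_zero_iff_padic (hp : ∀ i, p i ≡ 1 [MOD 4])
    (hinj : Function.Injective p) (x : Fin k → ZMod 2) (e : ZMod 2) (i : Fin k) :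
    (matA p).mulVec x i + e * vecB p i = 0 ↔
      IsSquare ((2 : ℚ_[p i]) ^ e.val * coprimePart p x i) := by
  rw [mulVec_add_mul_vecB_eq_zero_iff hp hinj]
  have := Padic.isSquare_intCast_iff (ne_two_of_modEq hp i)
    (m := 2 ^ e.val * (coprimePart p x i : ℕ)) (by
      push_cast
      exact mul_ne_zero (pow_ne_zero _ (two_cast_ne_zero hp i)) (coprimePart_cast_ne_zero hinj x i))
  push_cast at this
  exact this.symm

/-- Modulo `8`, the product attached to `x` is `5 ^ (B · x)`. -/
theorem prodOfVec_cast_eight (hp : ∀ i, p i ≡ 1 [MOD 4]) (x : Fin k → ZMod 2) :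
    (prodOfVec p x : ZMod 8) = 5 ^ (vecB p ⬝ᵥ x).val := by
  have hadd : ∀ a b : ZMod 2, (5 : ZMod 8) ^ (a + b).val = 5 ^ a.val * 5 ^ b.val := by decide
  have hone : ∀ i, (p i : ZMod 8) = 5 ^ (vecB p i).val := by
    intro i
    have h4 := hp i
    -- The second supplementary law. As p i ≡ 1 mod 4, the entry of B vanishes exactly when p i ≡ 1
    -- mod 8 and equals 1 when p i ≡ 5.
    have hB : vecB p i = 0 ↔ p i % 8 = 1 ∨ p i % 8 = 7 := by
      rw [← ZMod.exists_sq_eq_two_iff (ne_two_of_modEq hp i), vecB,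
        addLegendre_eq_zero_iff (by exact_mod_cast two_cast_ne_zero hp i)]
      norm_cast
    have h8 : p i % 8 = 1 ∨ p i % 8 = 5 := by
      simp only [Nat.ModEq] at h4; omega
    rcases h8 with h | h
    · rw [hB.mpr (.inl h), ← ZMod.natCast_mod, h]; decide
    · have : vecB p i = 1 := (zmod_two_cases _).resolve_left fun h0 => by
        have := hB.mp h0; omega
      rw [this, ← ZMod.natCast_mod, h]; decide
  have hpow : ∀ a b : ZMod 2, ((5 : ZMod 8) ^ a.val) ^ b.val = 5 ^ (a * b).val := by decide
  have hsum : ∀ s : Finset (Fin k), (5 : ZMod 8) ^ (∑ i ∈ s, vecB p i * x i).val =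
      ∏ i ∈ s, 5 ^ (vecB p i * x i).val := by
    intro s
    induction s using Finset.induction_on with
    | empty => simp
    | insert i s hi ih => rw [Finset.sum_insert hi, Finset.prod_insert hi, hadd, ih]
  rw [dotProduct, hsum]
  simp only [prodOfVec, Nat.cast_prod, Nat.cast_pow, hone, hpow]

theorem vecB_dotProduct_eq_zero_iff (hp : ∀ i, p i ≡ 1 [MOD 4]) (x : Fin k → ZMod 2) :
    vecB p ⬝ᵥ x = 0 ↔ prodOfVec p x ≡ 1 [MOD 8] := by
  rw [← ZMod.natCast_eq_natCast_iff, prodOfVec_cast_eight hp]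
  generalize vecB p ⬝ᵥ x = a
  revert a
  decide

end VectorsOfPrimes

/-! ## Linear algebra over `𝔽₂` -/

section LinearAlgebra

/-- For each admissible t the solutions form a coset of ker f. Choosing one solution per t
trivialises the fibration. Both kernels below are counted in this way. -/
theorem card_solutions {V W T : Type*} [AddCommGroup V] [AddCommGroup W] (f : V →+ W) (g : T → W) :
    Nat.card {q : V × T // f q.1 = g q.2} = Nat.card f.ker * Nat.card {t // g t ∈ f.range} := by
  classical
  have hs : ∀ t : {t // g t ∈ f.range}, ∃ v, f v = g t := fun t => t.2
  choose s hs using hs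
  rw [← Nat.card_prod]
  refine Nat.card_congr
    { toFun := fun q => (⟨q.1.1 - s ⟨q.1.2, q.1.1, q.2⟩, ?_⟩, ⟨q.1.2, q.1.1, q.2⟩)
      invFun := fun r => ⟨(r.1.1 + s r.2, r.2.1), ?_⟩
      left_inv := ?_
      right_inv := ?_ }
  · rw [AddMonoidHom.mem_ker, map_sub, hs, q.2, sub_self]
  · have := r.1.2
    rw [AddMonoidHom.mem_ker] at this
    simp only
    rw [map_add, hs, this, zero_add]
  · rintro ⟨⟨x, t⟩, h⟩
    simp
  · rintro ⟨⟨x, hx⟩, ⟨t, ht⟩⟩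
    simp

variable {k : ℕ} {A : Matrix (Fin k) (Fin k) (ZMod 2)} {B : Fin k → ZMod 2}

/-- For a symmetric matrix, the image is the orthogonal complement of the kernel. -/
theorem exists_mulVec_eq_iff (hA : A.IsSymm) :
    (∃ x, A.mulVec x = B) ↔ ∀ w, A.mulVec w = 0 → B ⬝ᵥ w = 0 := by
  have adj : ∀ v w, A.mulVec v ⬝ᵥ w = v ⬝ᵥ A.mulVec w := by
    intro v w
    rw [Matrix.dotProduct_mulVec, ← Matrix.mulVec_transpose, hA.eq]
  constructor
  · rintro ⟨x, rfl⟩ w hw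
    rw [adj, hw, dotProduct_zero]
  · intro h
    by_contra hB
    have hB' : B ∉ LinearMap.range A.mulVecLin := by
      rintro ⟨x, hx⟩
      exact hB ⟨x, hx⟩
    -- A functional that kills the image of A but not B is pairing with some w. Symmetry of A turns
    -- the vanishing on the image into A w = 0, so the hypothesis contradicts φ(B) ≠ 0.
    obtain ⟨φ, hφB, hφ⟩ := Submodule.exists_le_ker_of_notMem hB'
    obtain ⟨w, hw⟩ : ∃ w : Fin k → ZMod 2, ∀ v, φ v = v ⬝ᵥ w := by
      refine ⟨fun i => φ (Pi.single i 1), fun v => ?_⟩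
      conv_lhs => rw [pi_eq_sum_univ' v]
      rw [map_sum]
      refine Finset.sum_congr rfl fun i _ => ?_
      rw [map_smul, smul_eq_mul]
    apply hφB
    rw [hw]
    apply h
    apply dotProduct_eq_zero
    intro v
    have : φ (A.mulVec v) = 0 := hφ ⟨v, rfl⟩
    rw [hw, adj, dotProduct_comm] at this
    exact this

/-- The pairs `(x, z)` with `A z = 0` and `A x = B z`, the product being taken componentwise. -/
def monskyKernel (A : Matrix (Fin k) (Fin k) (ZMod 2)) (B : Fin k → ZMod 2) :
    AddSubgroup ((Fin k → ZMod 2) × (Fin k → ZMod 2)) where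
  carrier := {q | A.mulVec q.2 = 0 ∧ A.mulVec q.1 = B * q.2}
  zero_mem' := by simp
  add_mem' := by
    rintro q q' ⟨h, h'⟩ ⟨k, k'⟩
    simp [Matrix.mulVec_add, h, h', k, k', mul_add]
  neg_mem' := by
    rintro q ⟨h, h'⟩
    simp [Matrix.mulVec_neg, h, h']

/-- The pairs `(x, e)` with `A x = e B`. -/
def redeiKernel (A : Matrix (Fin k) (Fin k) (ZMod 2)) (B : Fin k → ZMod 2) :
    AddSubgroup ((Fin k → ZMod 2) × ZMod 2) where
  carrier := {q | A.mulVec q.1 = q.2 • B}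
  zero_mem' := by simp
  add_mem' := by
    rintro q q' h k
    simp only [Set.mem_ofPred_eq] at h k
    simp [Matrix.mulVec_add, h, k, add_smul]
  neg_mem' := by
    rintro q h
    simp only [Set.mem_ofPred_eq] at h
    simp only [Set.mem_ofPred_eq, Prod.fst_neg, Prod.snd_neg, Matrix.mulVec_neg, h, neg_smul]

theorem card_monskyKernel : Nat.card (monskyKernel A B) =
    Nat.card {x // A.mulVec x = 0} * Nat.card {t : {x // A.mulVec x = 0} // ∃ x, A.mulVec x = B * t.1} := by
  have := card_solutions A.mulVecLin.toAddMonoidHom (fun t : {x // A.mulVec x = 0} => B * t.1)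
  refine Eq.trans (Nat.card_congr ?_) this
  exact
    { toFun := fun q => ⟨(q.1.1, ⟨q.1.2, q.2.1⟩), q.2.2⟩
      invFun := fun q => ⟨(q.1.1, q.1.2.1), q.1.2.2, q.2⟩
      left_inv := fun _ => rfl
      right_inv := fun _ => rfl }

theorem card_redeiKernel : Nat.card (redeiKernel A B) =
    Nat.card {x // A.mulVec x = 0} * Nat.card {e : ZMod 2 // ∃ x, A.mulVec x = e • B} :=
  card_solutions A.mulVecLin.toAddMonoidHom (fun e : ZMod 2 => e • B)

theorem card_smul_mem_range_of_mem (h : ∃ x, A.mulVec x = B) :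
    Nat.card {e : ZMod 2 // ∃ x, A.mulVec x = e • B} = 2 := by
  obtain ⟨x, rfl⟩ := h
  rw [Nat.card_congr (Equiv.subtypeUnivEquiv fun e => ⟨e • x, by rw [Matrix.mulVec_smul]⟩)]
  simp

theorem card_smul_mem_range_of_notMem (h : ¬ ∃ x, A.mulVec x = B) :
    Nat.card {e : ZMod 2 // ∃ x, A.mulVec x = e • B} = 1 := by
  rw [Nat.card_eq_one_iff_exists]
  refine ⟨⟨0, 0, by simp⟩, ?_⟩
  rintro ⟨e, he⟩
  rcases zmod_two_cases e with rfl | rfl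
  · rfl
  · rw [one_smul] at he
    exact absurd he h

theorem eq_zero_or_one_of_card_ker (hk : k ≠ 0) (h1 : A.mulVec 1 = 0)
    (hc : Nat.card {x // A.mulVec x = 0} = 2) {t : Fin k → ZMod 2} (ht : A.mulVec t = 0) :
    t = 0 ∨ t = 1 := by
  classical
  have : NeZero k := ⟨hk⟩
  by_contra! hcon
  have h01 : (0 : Fin k → ZMod 2) ≠ 1 := zero_ne_one
  rw [Nat.card_eq_fintype_card, Fintype.card_subtype] at hc
  have hsub : ({0, 1, t} : Finset (Fin k → ZMod 2)) ⊆ Finset.univ.filter (A.mulVec · = 0) := by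
    intro y
    simp only [Finset.mem_insert, Finset.mem_singleton, Finset.mem_filter, Finset.mem_univ,
      true_and]
    rintro (rfl | rfl | rfl)
    · simp
    · exact h1
    · exact ht
  have := Finset.card_le_card hsub
  rw [hc, Finset.card_eq_three.mpr ⟨0, 1, t, h01, hcon.1.symm, hcon.2.symm, rfl⟩] at this
  omega

theorem eq_of_card_ker_eq_four (hk : k ≠ 0) (h1 : A.mulVec 1 = 0)
    (hc : Nat.card {x // A.mulVec x = 0} = 4) {t w : Fin k → ZMod 2} (ht : A.mulVec t = 0)
    (ht0 : t ≠ 0) (ht1 : t ≠ 1) (hw : A.mulVec w = 0) :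
    w = 0 ∨ w = 1 ∨ w = t ∨ w = t + 1 := by
  classical
  have : NeZero k := ⟨hk⟩
  have h01 : (0 : Fin k → ZMod 2) ≠ 1 := zero_ne_one
  have h11 : (1 : Fin k → ZMod 2) + 1 = 0 := by
    funext i
    exact CharTwo.add_self_eq_zero (1 : ZMod 2)
  have hcard : ({0, 1, t, t + 1} : Finset (Fin k → ZMod 2)).card = 4 := by
    rw [Finset.card_insert_of_notMem, Finset.card_insert_of_notMem, Finset.card_insert_of_notMem,
      Finset.card_singleton]
    · simp
    · simp only [Finset.mem_insert, Finset.mem_singleton, not_or]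
      exact ⟨ht1.symm, fun h => ht0 (by simpa using h.symm)⟩
    · simp only [Finset.mem_insert, Finset.mem_singleton, not_or]
      refine ⟨h01, ht0.symm, fun h => ht1 ?_⟩
      calc t = t + (1 + 1) := by rw [h11, add_zero]
        _ = (t + 1) + 1 := (add_assoc _ _ _).symm
        _ = 1 := by rw [← h, zero_add]
  rw [Nat.card_eq_fintype_card, Fintype.card_subtype] at hc
  have hsub : ({0, 1, t, t + 1} : Finset (Fin k → ZMod 2)) ⊆
      Finset.univ.filter (A.mulVec · = 0) := by
    intro y
    simp only [Finset.mem_insert, Finset.mem_singleton, Finset.mem_filter, Finset.mem_univ,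
      true_and]
    rintro (rfl | rfl | rfl | rfl)
    · simp
    · exact h1
    · exact ht
    · rw [Matrix.mulVec_add, ht, h1, add_zero]
  have heq := Finset.eq_of_subset_of_card_le hsub (by rw [hc, hcard])
  have : w ∈ Finset.univ.filter (A.mulVec · = 0) := by simpa using hw
  rw [← heq] at this
  simpa using this

/-- The kernel is {0, 1}, and B is orthogonal to both vectors. -/
theorem exists_mulVec_eq_of_card_ker (hk : k ≠ 0) (hA : A.IsSymm) (h1 : A.mulVec 1 = 0)
    (hB : B ⬝ᵥ 1 = 0) (hc : Nat.card {x // A.mulVec x = 0} = 2) : ∃ x, A.mulVec x = B := by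
  rw [exists_mulVec_eq_iff hA]
  intro w hw
  rcases eq_zero_or_one_of_card_ker hk h1 hc hw with rfl | rfl
  · exact dotProduct_zero _
  · exact hB

/-- The vector t = 1 would put B itself in the image. For t ≠ 0, 1, pairing B * t with the kernel
vector 1 gives B·t = 0, so B is orthogonal to the whole kernel {0, 1, t, t + 1} and again lies in
the image. -/
theorem eq_zero_of_mulVec_eq_mul (hk : k ≠ 0) (hA : A.IsSymm) (h1 : A.mulVec 1 = 0)
    (hB : B ⬝ᵥ 1 = 0) (hc : Nat.card {x // A.mulVec x = 0} = 4) (hBr : ¬ ∃ x, A.mulVec x = B)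
    {t : Fin k → ZMod 2} (ht : A.mulVec t = 0) (htr : ∃ x, A.mulVec x = B * t) : t = 0 := by
  by_contra ht0
  by_cases ht1 : t = 1
  · rw [ht1, mul_one] at htr
    exact hBr htr
  apply hBr
  rw [exists_mulVec_eq_iff hA]
  have hBt : B ⬝ᵥ t = 0 := by
    have := (exists_mulVec_eq_iff hA).mp htr 1 h1
    rw [dotProduct_one] at this
    exact this
  intro w hw
  rcases eq_of_card_ker_eq_four hk h1 hc ht ht0 ht1 hw with rfl | rfl | rfl | rfl
  · exact dotProduct_zero _
  · exact hB
  · exact hBt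
  · rw [dotProduct_add, hB, hBt, add_zero]

theorem card_ker_ge_two (hk : k ≠ 0) (h1 : A.mulVec 1 = 0) :
    2 ≤ Nat.card {x // A.mulVec x = 0} := by
  have : NeZero k := ⟨hk⟩
  refine Nat.succ_le_of_lt (Finite.one_lt_card_iff_nontrivial.mpr ⟨⟨0, by simp⟩, ⟨1, h1⟩, ?_⟩)
  intro h
  exact zero_ne_one (congrArg Subtype.val h)

/-- The two ways in which the Rédei kernel can have four elements. -/
theorem card_redeiKernel_eq_four : Nat.card (redeiKernel A B) = 4 ↔
      (Nat.card {x // A.mulVec x = 0} = 2 ∧ ∃ x, A.mulVec x = B) ∨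
      (Nat.card {x // A.mulVec x = 0} = 4 ∧ ¬ ∃ x, A.mulVec x = B) := by
  rw [card_redeiKernel]
  by_cases h : ∃ x, A.mulVec x = B
  · rw [card_smul_mem_range_of_mem h]
    simp only [h, not_true_eq_false, and_true, and_false, or_false]
    omega
  · rw [card_smul_mem_range_of_notMem h]
    simp only [h, not_false_eq_true, and_true, and_false, false_or]
    omega

/-- The order of the Monsky kernel is |ker A| times the number of t in ker A with B * t in the
image. The second factor is full if ker A = {0, 1}, and for |ker A| = 4 it is 1 exactly when B is
not in the image. -/
theorem card_monskyKernel_eq_four (hk : k ≠ 0) (hA : A.IsSymm) (h1 : A.mulVec 1 = 0)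
    (hB : B ⬝ᵥ 1 = 0) :
    Nat.card (monskyKernel A B) = 4 ↔ Nat.card (redeiKernel A B) = 4 := by
  have : NeZero k := ⟨hk⟩
  rw [card_redeiKernel_eq_four, card_monskyKernel]
  have hge := card_ker_ge_two hk h1
  set Z := {t : {x // A.mulVec x = 0} // ∃ x, A.mulVec x = B * t.1} with hZ
  have hz0 : ∃ x, A.mulVec x = B * (0 : Fin k → ZMod 2) := ⟨0, by simp⟩
  constructor
  · intro h
    have h24 : Nat.card {x // A.mulVec x = 0} = 2 ∨ Nat.card {x // A.mulVec x = 0} = 4 := by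
      have hdvd : Nat.card {x // A.mulVec x = 0} ∣ 4 := ⟨_, h.symm⟩
      have := Nat.le_of_dvd (by norm_num) hdvd
      interval_cases Nat.card {x // A.mulVec x = 0} <;> omega
    rcases h24 with h2 | h4
    · exact .inl ⟨h2, exists_mulVec_eq_of_card_ker hk hA h1 hB h2⟩
    · refine .inr ⟨h4, fun hBr => ?_⟩
      rw [h4] at h
      -- If B were in the image, then t = 1 would be admissible besides t = 0.
      have hZ1 : Nat.card Z = 1 := by omega
      obtain ⟨a, ha⟩ := Nat.card_eq_one_iff_exists.mp hZ1
      have e := (ha ⟨⟨0, by simp⟩, hz0⟩).trans (ha ⟨⟨1, h1⟩, by simpa using hBr⟩).symm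
      exact zero_ne_one (congrArg (fun t => t.1.1) e)
  · rintro (⟨h2, hBr⟩ | ⟨h4, hBr⟩)
    · have : Nat.card Z = 2 := by
        rw [← h2]
        refine Nat.card_congr (Equiv.subtypeUnivEquiv ?_)
        rintro ⟨t, ht⟩
        rcases eq_zero_or_one_of_card_ker hk h1 h2 ht with rfl | rfl
        · exact hz0
        · simpa using hBr
      rw [h2, this]
    · have : Nat.card Z = 1 := by
        rw [Nat.card_eq_one_iff_exists]
        refine ⟨⟨⟨0, by simp⟩, hz0⟩, ?_⟩
        rintro ⟨⟨t, ht⟩, htr⟩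
        have := eq_zero_of_mulVec_eq_mul hk hA h1 hB h4 hBr ht htr
        subst this
        rfl
      rw [h4, this]

theorem card_ker_mulVec : Nat.card {x // A.mulVec x = 0} = 2 ^ (k - A.rank) := by
  have hrank := A.mulVecLin.finrank_range_add_finrank_ker
  rw [Module.finrank_fin_fun] at hrank
  have : Nat.card {x // A.mulVec x = 0} = Nat.card (LinearMap.ker A.mulVecLin) :=
    Nat.card_congr (Equiv.subtypeEquivRight fun x => by simp)
  rw [this, Module.natCard_eq_pow_finrank (K := ZMod 2), Nat.card_zmod, Matrix.rank]
  congr 1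
  omega

end LinearAlgebra

/-! ## Square classes and the `2`-Selmer group -/

section SqClass

theorem sqClass_of_ne_zero {a : ℚ} (ha : a ≠ 0) :
    sqClass a = QuotientGroup.mk (Units.mk0 a ha) := dif_neg ha

theorem sqClass_units (a : ℚˣ) : sqClass a = QuotientGroup.mk a := by
  rw [sqClass_of_ne_zero a.ne_zero, Units.mk0_val]

theorem mk_eq_mk_iff_isSquare {a b : ℚˣ} :
    (QuotientGroup.mk a : SqClass) = QuotientGroup.mk b ↔ IsSquare ((a : ℚ) * b) := by
  rw [QuotientGroup.eq]
  constructor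
  · rintro ⟨c, hc⟩
    simp only [powMonoidHom_apply] at hc
    refine ⟨a * c, ?_⟩
    have hb : b = a * c ^ 2 := by rw [hc, mul_inv_cancel_left]
    rw [hb]
    push_cast
    ring
  · rintro ⟨c, hc⟩
    have hc0 : c ≠ 0 := by
      rintro rfl
      exact mul_ne_zero a.ne_zero b.ne_zero (by rw [hc, zero_mul])
    refine ⟨a⁻¹ * Units.mk0 c hc0, ?_⟩
    simp only [powMonoidHom_apply]
    rw [eq_inv_mul_iff_mul_eq]
    apply Units.ext
    push_cast
    rw [Units.val_mk0]
    have := a.ne_zero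
    field_simp
    linear_combination -hc

theorem sqClass_eq_iff {a b : ℚ} (ha : a ≠ 0) (hb : b ≠ 0) :
    sqClass a = sqClass b ↔ IsSquare (a * b) := by
  rw [sqClass_of_ne_zero ha, sqClass_of_ne_zero hb, mk_eq_mk_iff_isSquare]
  rfl

theorem sqClass_mul {a b : ℚ} (ha : a ≠ 0) (hb : b ≠ 0) :
    sqClass (a * b) = sqClass a * sqClass b := by
  rw [sqClass_of_ne_zero ha, sqClass_of_ne_zero hb, sqClass_of_ne_zero (mul_ne_zero ha hb),
    ← QuotientGroup.mk_mul]
  congr 1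
  exact Units.ext rfl

theorem sqTriple_mul {a b c a' b' c' : ℚ} (ha : a ≠ 0) (hb : b ≠ 0) (hc : c ≠ 0) (ha' : a' ≠ 0)
    (hb' : b' ≠ 0) (hc' : c' ≠ 0) :
    sqTriple a b c * sqTriple a' b' c' = sqTriple (a * a') (b * b') (c * c') := by
  simp only [sqTriple, Prod.mk_mul_mk, sqClass_mul, *, ne_eq, not_false_eq_true]

theorem sqTriple_eq_iff {a b c a' b' c' : ℚ} (ha : a ≠ 0) (hb : b ≠ 0) (hc : c ≠ 0) (ha' : a' ≠ 0)
    (hb' : b' ≠ 0) (hc' : c' ≠ 0) : sqTriple a b c = sqTriple a' b' c' ↔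
      IsSquare (a * a') ∧ IsSquare (b * b') ∧ IsSquare (c * c') := by
  simp only [sqTriple, Prod.mk.injEq, sqClass_eq_iff, *, ne_eq, not_false_eq_true]

theorem sqTriple_mul_self (g : SqClass × SqClass × SqClass) : g * g = 1 := by
  rw [← pow_two, sqTriple_sq]

theorem sqTriple_inv (g : SqClass × SqClass × SqClass) : g⁻¹ = g :=
  inv_eq_of_mul_eq_one_left (sqTriple_mul_self g)

theorem exists_sq_of_isSquare_mul {F : Type*} [Field F] [CharZero F] {a b : ℚ} (ha : a ≠ 0)
    (hb : b ≠ 0) (h : IsSquare (a * b)) : ∃ e : F, (∃ r, r ≠ 0 ∧ e = r ^ 2) ∧ (b : F) = e * a := by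
  obtain ⟨c, hc⟩ := h
  have hc0 : c ≠ 0 := by
    rintro rfl
    exact mul_ne_zero ha hb (by rw [hc, zero_mul])
  refine ⟨((c / a : ℚ) : F) ^ 2, ⟨((c / a : ℚ) : F), ?_, rfl⟩, ?_⟩
  · exact_mod_cast div_ne_zero hc0 ha
  · have : b = (c / a) ^ 2 * a := by
      field_simp
      linear_combination hc
    exact_mod_cast congrArg (Rat.cast : ℚ → F) this

theorem DHasPoint.of_sqTriple_eq {F : Type*} [Field F] [CharZero F] {m : F} {a b c a' b' c' : ℚ}
    (ha : a ≠ 0) (hb : b ≠ 0) (hc : c ≠ 0) (ha' : a' ≠ 0)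
    (hb' : b' ≠ 0) (hc' : c' ≠ 0) (h : sqTriple a b c = sqTriple a' b' c')
    (hD : DHasPoint F m a b c) : DHasPoint F m a' b' c' := by
  rw [sqTriple_eq_iff ha hb hc ha' hb' hc'] at h
  obtain ⟨e₁, s₁, k₁⟩ := exists_sq_of_isSquare_mul (F := F) ha ha' h.1
  obtain ⟨e₂, s₂, k₂⟩ := exists_sq_of_isSquare_mul (F := F) hb hb' h.2.1
  obtain ⟨e₃, s₃, k₃⟩ := exists_sq_of_isSquare_mul (F := F) hc hc' h.2.2
  rw [k₁, k₂, k₃]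
  exact hD.scale s₁ s₂ s₃

/-- Membership in the Selmer group only asks for some representatives. Rescaling by squares shows
that any representatives will do. -/
theorem sqTriple_mem_sel2_iff {n : ℕ} {a b c : ℚ} (ha : a ≠ 0) (hb : b ≠ 0) (hc : c ≠ 0) :
    sqTriple a b c ∈ Sel2 n ↔ IsSquare (a * b * c) ∧ DHasAdelicPoint n a b c := by
  constructor
  · rintro ⟨d₁, d₂, d₃, e, hs, hD⟩
    have e' : sqTriple d₁ d₂ d₃ = sqTriple a b c := by
      rw [e]
      simp only [sqTriple, sqClass_units]
    refine ⟨?_, hD.1.of_sqTriple_eq d₁.ne_zero d₂.ne_zero d₃.ne_zero ha hb hc e',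
      fun p _ => (hD.2 p).of_sqTriple_eq d₁.ne_zero d₂.ne_zero d₃.ne_zero ha hb hc e'⟩
    rw [sqTriple_eq_iff d₁.ne_zero d₂.ne_zero d₃.ne_zero ha hb hc] at e'
    have hs' : IsSquare ((d₁ : ℚ) * d₂ * d₃) := by
      obtain ⟨r, hr⟩ := hs
      exact ⟨r, by exact_mod_cast congrArg Units.val hr⟩
    refine isSquare_of_mul (b := (d₁ : ℚ) * d₂ * d₃) ?_ hs' (by simp)
    have := (e'.1.mul e'.2.1).mul e'.2.2
    rwa [show a * b * c * (d₁ * d₂ * d₃) = d₁ * a * (d₂ * b) * (d₃ * c) by ring]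
  · rintro ⟨⟨r, hr⟩, hD⟩
    refine ⟨Units.mk0 a ha, Units.mk0 b hb, Units.mk0 c hc, ?_, ?_, hD⟩
    · simp only [sqTriple, sqClass_of_ne_zero, ha, hb, hc, ne_eq, not_false_eq_true]
    · have hr0 : r ≠ 0 := by
        rintro rfl
        exact mul_ne_zero (mul_ne_zero ha hb) hc (by rw [hr, zero_mul])
      exact ⟨Units.mk0 r hr0, Units.ext (by simpa using hr)⟩

theorem exists_sqTriple_eq (g : SqClass × SqClass × SqClass) :
    ∃ a b c : ℚˣ, g = sqTriple a b c := by
  obtain ⟨a, b, c⟩ := g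
  induction a using QuotientGroup.induction_on with | H a =>
  induction b using QuotientGroup.induction_on with | H b =>
  induction c using QuotientGroup.induction_on with | H c =>
  exact ⟨a, b, c, by simp only [sqTriple, sqClass_units]⟩

end SqClass

/-! ## The image of the torsion -/

section Torsion

variable {n : ℕ}

theorem DHasAdelicPoint.of_rat {a b c : ℚ} (h : DHasPoint ℚ (n : ℚ) a b c) :
    DHasAdelicPoint n a b c := by
  have gen : ∀ (F : Type) [Field F] [CharZero F], DHasPoint F (n : F) (a : F) (b : F) (c : F) := by
    intro F _ _
    obtain ⟨t, u₁, u₂, u₃, h0, k₁, k₂, k₃⟩ := h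
    refine ⟨t, u₁, u₂, u₃, ?_, ?_, ?_, ?_⟩
    · simpa using h0
    · exact_mod_cast congrArg (Rat.cast : ℚ → F) k₁
    · exact_mod_cast congrArg (Rat.cast : ℚ → F) k₂
    · exact_mod_cast congrArg (Rat.cast : ℚ → F) k₃
  exact ⟨gen ℝ, fun p _ => gen ℚ_[p]⟩

/-- The image of the `2`-torsion point `(0, 0)`. -/
noncomputable def torsionTripleZero (n : ℕ) : SqClass × SqClass × SqClass :=
  sqTriple (-n) n (-n * n)

/-- The image of the `2`-torsion point `(n, 0)`. -/
noncomputable def torsionTriple (n : ℕ) : SqClass × SqClass × SqClass :=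
  sqTriple (2 * n * n) (2 * n) n

theorem torsionTripleZero_mem (hn : n ≠ 0) : torsionTripleZero n ∈ Sel2 n := by
  have hn' : (n : ℚ) ≠ 0 := by exact_mod_cast hn
  have hz := mul_ne_zero (neg_ne_zero.mpr hn') hn'
  rw [torsionTripleZero, sqTriple_mem_sel2_iff (neg_ne_zero.mpr hn') hn' hz]
  exact ⟨⟨-n * n, by ring⟩, .of_rat (.of_isSquare 0 (neg_ne_zero.mpr hn') hn' hz
    ⟨n, by ring⟩ ⟨n, by ring⟩ ⟨0, by ring⟩)⟩

theorem torsionTriple_mem (hn : n ≠ 0) : torsionTriple n ∈ Sel2 n := by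
  have hn' : (n : ℚ) ≠ 0 := by exact_mod_cast hn
  have h2n : (2 * n : ℚ) ≠ 0 := mul_ne_zero two_ne_zero hn'
  rw [torsionTriple, sqTriple_mem_sel2_iff (mul_ne_zero h2n hn') h2n hn']
  exact ⟨⟨2 * n * n, by ring⟩, .of_rat (.of_isSquare n (mul_ne_zero h2n hn') h2n hn'
    ⟨0, by ring⟩ ⟨2 * n, by ring⟩ ⟨n, by ring⟩)⟩

theorem kummerMap_zero (hn : n ≠ 0) {y : ℚ} (h : (congruentCurve n).Nonsingular 0 y) :
    kummerMap n (.some 0 y h) = torsionTripleZero n := by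
  simp [kummerMap, torsionTripleZero, hn]

theorem kummerMap_self (hn : n ≠ 0) {y : ℚ} (h : (congruentCurve n).Nonsingular n y) :
    kummerMap n (.some n y h) = torsionTriple n := by
  have hn' : (n : ℚ) ≠ 0 := by exact_mod_cast hn
  have hnn : (n : ℚ) + n ≠ 0 := by
    rw [← two_mul]
    exact mul_ne_zero two_ne_zero hn'
  simp only [kummerMap, torsionTriple, sub_self, if_true, hnn, hn', if_false]
  simp only [two_mul]

theorem kummerMap_neg (hn : n ≠ 0) {y : ℚ} (h : (congruentCurve n).Nonsingular (-n) y) :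
    kummerMap n (.some (-n) y h) = torsionTripleZero n * torsionTriple n := by
  have hn' : (n : ℚ) ≠ 0 := by exact_mod_cast hn
  have h2n : (2 * n : ℚ) ≠ 0 := mul_ne_zero two_ne_zero hn'
  have hnn' : -(n : ℚ) - n ≠ 0 := by
    rw [← neg_add', ← two_mul]
    exact neg_ne_zero.mpr h2n
  have hneg := neg_ne_zero.mpr hn'
  simp only [kummerMap, torsionTripleZero, torsionTriple, neg_add_cancel, if_true, hnn',
    neg_eq_zero, hn', if_false]
  rw [sqTriple_mul hneg hn' (mul_ne_zero hneg hn') (mul_ne_zero h2n hn') h2n hn',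
    sqTriple_eq_iff hnn' (mul_ne_zero hnn' hneg) hneg
      (mul_ne_zero hneg (mul_ne_zero h2n hn')) (mul_ne_zero hn' h2n)
      (mul_ne_zero (mul_ne_zero hneg hn') hn')]
  exact ⟨⟨2 * n * n, by ring⟩, ⟨2 * n * n, by ring⟩, ⟨n * n, by ring⟩⟩

/-- A 2-torsion point has y = 0, hence x ∈ {0, n, -n}, and the image of (-n, 0) is the product of
the other two. -/
theorem torsionImage_eq (hn : n ≠ 0) :
    torsionImage n = Subgroup.closure {torsionTripleZero n, torsionTriple n} := by
  have hn' : (n : ℚ) ≠ 0 := by exact_mod_cast hn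
  have h2n : (2 * n : ℚ) ≠ 0 := mul_ne_zero two_ne_zero hn'
  have neg_y : ∀ x y : ℚ, (congruentCurve n).negY x y = -y := by
    intro x y
    simp [WeierstrassCurve.Affine.negY, congruentCurve]
  have hpt : ∀ x : ℚ, x ^ 3 - n ^ 2 * x = 0 → (3 * x ^ 2 - n ^ 2 ≠ 0) →
      (congruentCurve n).Nonsingular x 0 := by
    intro x hx hx'
    rw [WeierstrassCurve.Affine.nonsingular_iff, WeierstrassCurve.Affine.equation_iff]
    simp only [congruentCurve]
    refine ⟨by linear_combination -hx, .inl ?_⟩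
    intro h
    apply hx'
    linear_combination -h
  have himage : ∀ (x : ℚ) (hns : (congruentCurve n).Nonsingular x 0),
      kummerMap n (.some x 0 hns) ∈ torsionImage n := by
    intro x hns
    refine Subgroup.subset_closure ⟨_, ?_, rfl⟩
    exact WeierstrassCurve.Affine.Point.add_self_of_Y_eq (by rw [neg_y, neg_zero])
  apply le_antisymm
  · rw [torsionImage, Subgroup.closure_le]
    rintro _ ⟨P, hP, rfl⟩
    match P, hP with
    | .zero, _ => exact Subgroup.one_mem _
    | .some x y h, hP =>
      have hy : y = 0 := by
        by_contra hy
        have hne : y ≠ (congruentCurve n).negY x y := by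
          rw [neg_y]
          intro h
          exact hy (by linarith)
        have : (WeierstrassCurve.Affine.Point.some x y h : (congruentCurve n).Point) +
          .some x y h = 0 := hP
        rw [WeierstrassCurve.Affine.Point.add_self_of_Y_ne hne] at this
        exact WeierstrassCurve.Affine.Point.some_ne_zero _ this
      subst hy
      have heq := (WeierstrassCurve.Affine.nonsingular_iff _ _).mp h
      have hx := (WeierstrassCurve.Affine.equation_iff _ _).mp heq.1
      simp only [congruentCurve] at hx
      have hx' : x * ((x - n) * (x + n)) = 0 := by linear_combination -hx
      have hmem₀ : torsionTripleZero n ∈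
          Subgroup.closure {torsionTripleZero n, torsionTriple n} :=
        Subgroup.subset_closure (by simp)
      have hmem₁ : torsionTriple n ∈ Subgroup.closure {torsionTripleZero n, torsionTriple n} :=
        Subgroup.subset_closure (by simp)
      rcases mul_eq_zero.mp hx' with h0 | h0
      · subst h0
        rw [kummerMap_zero hn]
        exact hmem₀
      rcases mul_eq_zero.mp h0 with h0 | h0
      · obtain rfl : x = n := by linarith
        rw [kummerMap_self hn]
        exact hmem₁
      · obtain rfl : x = -n := by linarith
        rw [kummerMap_neg hn]
        exact Subgroup.mul_mem _ hmem₀ hmem₁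
  · rw [Subgroup.closure_le]
    rintro _ (rfl | rfl)
    · rw [← kummerMap_zero hn (hpt 0 (by ring) (by simpa using hn))]
      exact himage _ _
    · rw [← kummerMap_self hn (hpt n (by ring) ?_)]
      · exact himage _ _
      · rw [show (3 * n ^ 2 - n ^ 2 : ℚ) = 2 * n * n by ring]
        exact mul_ne_zero h2n hn'

theorem mem_torsionImage_iff (hn : n ≠ 0) {g : SqClass × SqClass × SqClass} :
    g ∈ torsionImage n ↔ g = 1 ∨ g = torsionTripleZero n ∨ g = torsionTriple n ∨
      g = torsionTripleZero n * torsionTriple n := by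
  rw [torsionImage_eq hn, Subgroup.mem_closure_pair]
  have hpow : ∀ (g : SqClass × SqClass × SqClass) (m : ℤ), g ^ m = 1 ∨ g ^ m = g := by
    intro g m
    rcases Int.even_or_odd' m with ⟨c, rfl | rfl⟩
    · left
      rw [zpow_mul, zpow_ofNat, sqTriple_sq, one_zpow]
    · right
      rw [zpow_add, zpow_mul, zpow_ofNat, sqTriple_sq, one_zpow, one_mul, zpow_one]
  constructor
  · rintro ⟨a, b, rfl⟩
    rcases hpow (torsionTripleZero n) a with h | h <;> rcases hpow (torsionTriple n) b with h' | h' <;>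
      rw [h, h'] <;> simp
  · rintro (rfl | rfl | rfl | rfl)
    · exact ⟨0, 0, by simp⟩
    · exact ⟨1, 0, by simp⟩
    · exact ⟨0, 1, by simp⟩
    · exact ⟨1, 1, by simp⟩

theorem torsionImage_le_sel2 (hn : n ≠ 0) : torsionImage n ≤ Sel2 n := by
  rw [torsionImage_eq hn, Subgroup.closure_le]
  rintro _ (rfl | rfl)
  · exact torsionTripleZero_mem hn
  · exact torsionTriple_mem hn

end Torsion

/-! ### Selmer classes modulo torsion as pairs of vectors -/

section SelmerTriples

theorem Padic.valuation_natCast_of_not_dvd {q : ℕ} [Fact q.Prime] {m : ℕ} (h : ¬ q ∣ m) :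
    (m : ℚ_[q]).valuation = 0 := by
  rw [Padic.valuation_natCast, padicValNat.eq_zero_of_not_dvd h, Nat.cast_zero]

theorem Padic.valuation_natCast_of_squarefree {q : ℕ} [Fact q.Prime] {m : ℕ} (hm : Squarefree m)
    (h : q ∣ m) : (m : ℚ_[q]).valuation = 1 := by
  have hq : q.Prime := Fact.out
  obtain ⟨c, rfl⟩ := h
  have hc : ¬ q ∣ c := by
    rintro ⟨e, rfl⟩
    exact hq.one_lt.ne' (Nat.isUnit_iff.mp (hm q ⟨e, by ring⟩))
  have hc0 : c ≠ 0 := by rintro rfl; exact hc (dvd_zero q)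
  rw [Nat.cast_mul, Padic.valuation_mul (by exact_mod_cast hq.ne_zero) (by exact_mod_cast hc0),
    Padic.valuation_p, Padic.valuation_natCast_of_not_dvd hc, add_zero]

variable {k : ℕ} {p : Fin k → ℕ} [∀ i, Fact (p i).Prime] {n : ℕ}

/-- The valuation at p_i of 2ᵉ n^f d has the parity of f + x i, so a square needs x i = f. The
remaining unit is then 2ᵉ times the part of d prime to p_i, up to squares. -/
theorem isSquare_twist_iff (hp : ∀ i, p i ≡ 1 [MOD 4]) (hsq : Squarefree n)
    (hprod : n = ∏ i, p i) (x : Fin k → ZMod 2) (i : Fin k) (e f : ZMod 2) :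
    IsSquare ((2 : ℚ_[p i]) ^ e.val * (n : ℚ_[p i]) ^ f.val * prodOfVec p x) ↔
      x i = f ∧ (matA p).mulVec x i + e * vecB p i = 0 := by
  have hinj : Function.Injective p := injective_of_squarefree_prod (hprod ▸ hsq)
  -- For x i = 0 both sides are d. For x i = 1 the identity is n·d = (n/d)·d².
  have hrel : n ^ (x i).val * prodOfVec p x =
      coprimePart p x i * (prodOfVec p x ^ (x i).val * prodOfVec p x ^ (x i).val) := by
    unfold coprimePart
    rcases zmod_two_cases (x i) with h | h
    · rw [if_pos h, h]; simp
    · rw [if_neg (by rw [h]; decide), h, ZMod.val_one, pow_one, pow_one, hprod,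
        ← prodOfVec_mul_add_one p x]
      ring
  have hrel' : (n : ℚ_[p i]) ^ (x i).val * prodOfVec p x = coprimePart p x i *
      ((prodOfVec p x : ℚ_[p i]) ^ (x i).val * (prodOfVec p x : ℚ_[p i]) ^ (x i).val) := by
    exact_mod_cast congrArg (Nat.cast : ℕ → ℚ_[p i]) hrel
  have hD : (prodOfVec p x : ℚ_[p i]) ≠ 0 := by exact_mod_cast prodOfVec_ne_zero p x
  have hDD : (prodOfVec p x : ℚ_[p i]) ^ (x i).val * (prodOfVec p x : ℚ_[p i]) ^ (x i).val ≠ 0 :=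
    mul_ne_zero (pow_ne_zero _ hD) (pow_ne_zero _ hD)
  have h2 : (2 : ℚ_[p i]) ^ e.val ≠ 0 := pow_ne_zero _ two_ne_zero
  have hn0 : (n : ℚ_[p i]) ≠ 0 := by exact_mod_cast hsq.ne_zero
  rw [mulVec_add_mul_vecB_eq_zero_iff_padic hp hinj]
  by_cases hf : x i = f
  · subst hf
    rw [mul_assoc, hrel', ← mul_assoc]
    simp only [true_and]
    exact ⟨fun h => isSquare_of_mul h ⟨_, rfl⟩ hDD, fun h => h.mul ⟨_, rfl⟩⟩
  · simp only [hf, false_and, iff_false]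
    intro hsquare
    have hcp : ¬ p i ∣ 2 ^ e.val * coprimePart p x i := by
      rw [(Fact.out : (p i).Prime).dvd_mul, not_or, ← ZMod.natCast_eq_zero_iff,
        ← ZMod.natCast_eq_zero_iff (coprimePart p x i)]
      refine ⟨?_, coprimePart_cast_ne_zero hinj x i⟩
      push_cast
      exact pow_ne_zero _ (two_cast_ne_zero hp i)
    have hev : Even ((2 : ℚ_[p i]) ^ e.val * coprimePart p x i).valuation := by
      have := Padic.valuation_natCast_of_not_dvd (q := p i) hcp
      push_cast at this
      rw [this]
      exact Even.zero
    have hcp0 : (2 : ℚ_[p i]) ^ e.val * coprimePart p x i ≠ 0 := by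
      have : 2 ^ e.val * coprimePart p x i ≠ 0 := fun h => hcp (h ▸ dvd_zero _)
      exact_mod_cast this
    have hfx : (n : ℚ_[p i]) ^ f.val * (n : ℚ_[p i]) ^ (x i).val = n := by
      rw [← pow_add]
      have : ∀ a b : ZMod 2, a ≠ b → b.val + a.val = 1 := by decide
      rw [this _ _ hf, pow_one]
    have hnsq : IsSquare ((n : ℚ_[p i]) * ((2 : ℚ_[p i]) ^ e.val * coprimePart p x i)) := by
      have key : (n : ℚ_[p i]) * ((2 : ℚ_[p i]) ^ e.val * coprimePart p x i) *
          ((prodOfVec p x : ℚ_[p i]) ^ (x i).val * (prodOfVec p x : ℚ_[p i]) ^ (x i).val) =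
          (2 : ℚ_[p i]) ^ e.val * (n : ℚ_[p i]) ^ f.val * prodOfVec p x *
            ((n : ℚ_[p i]) ^ (x i).val * (n : ℚ_[p i]) ^ (x i).val) := by
        nth_rewrite 1 [← hfx]
        linear_combination (-(n : ℚ_[p i]) ^ f.val * (n : ℚ_[p i]) ^ (x i).val *
          (2 : ℚ_[p i]) ^ e.val) * hrel'
      refine isSquare_of_mul ?_ ⟨_, rfl⟩ hDD
      rw [key]
      exact hsquare.mul ⟨_, rfl⟩
    rw [← Padic.even_valuation_iff hn0 hcp0 hnsq, Padic.valuation_natCast_of_squarefree hsq] at hev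
    · exact absurd hev (by decide)
    · rw [hprod]
      exact Finset.dvd_prod_of_mem p (Finset.mem_univ i)

/-- The triple of square classes `(d₁, d₂, d₁ d₂)` attached to two exponent vectors. -/
noncomputable def vecTriple (p : Fin k → ℕ) (x y : Fin k → ZMod 2) : SqClass × SqClass × SqClass :=
  sqTriple (prodOfVec p x) (prodOfVec p y) (prodOfVec p x * prodOfVec p y)

theorem isSquare_neg_one_padic (hp : ∀ i, p i ≡ 1 [MOD 4]) (i : Fin k) :
    IsSquare (-1 : ℚ_[p i]) := by
  have h : IsSquare (-1 : ZMod (p i)) := ZMod.exists_sq_eq_neg_one_iff.mpr (by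
    have := hp i
    simp only [Nat.ModEq] at this
    omega)
  have := (Padic.isSquare_intCast_iff (ne_two_of_modEq hp i) (m := -1) (by simp)).mpr
    (by simpa using h)
  simpa using this

/-- The four torsion classes are (2ᵉ n^f, 2ᵉ n^{f+e}) with e, f in 𝔽₂. Comparing parities of
valuations forces f = x i and e = z i, and the two unit conditions then become the two linear
equations. -/
theorem dHasPoint_padic_vec_iff (hp : ∀ i, p i ≡ 1 [MOD 4]) (hsq : Squarefree n)
    (hprod : n = ∏ i, p i) (x z : Fin k → ZMod 2) (i : Fin k) :
    DHasPoint ℚ_[p i] n (prodOfVec p x) (prodOfVec p (x + z))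
        (prodOfVec p x * prodOfVec p (x + z)) ↔
      (matA p).mulVec z i = 0 ∧ (matA p).mulVec x i = vecB p i * z i := by
  have hD : ∀ x, (prodOfVec p x : ℚ_[p i]) ≠ 0 := fun x => by
    exact_mod_cast prodOfVec_ne_zero p x
  have hloc : (∃ e f : ZMod 2,
      IsSquare ((2 : ℚ_[p i]) ^ e.val * (n : ℚ_[p i]) ^ f.val * prodOfVec p x) ∧
      IsSquare ((2 : ℚ_[p i]) ^ e.val * (n : ℚ_[p i]) ^ (f + e).val * prodOfVec p (x + z))) ↔
      (matA p).mulVec z i = 0 ∧ (matA p).mulVec x i = vecB p i * z i := by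
    simp only [isSquare_twist_iff hp hsq hprod, Matrix.mulVec_add, Pi.add_apply]
    generalize (matA p).mulVec z i = a
    generalize (matA p).mulVec x i = b
    generalize vecB p i = c
    generalize x i = d
    generalize z i = g
    revert a b c d g
    decide
  rw [← hloc]
  constructor
  · intro h
    have hdvd : p i ∣ n := by
      rw [hprod]
      exact Finset.dvd_prod_of_mem p (Finset.mem_univ i)
    have hnorm : ‖(n : ℚ_[p i])‖ = (p i : ℝ)⁻¹ := by
      rw [Padic.norm_eq_zpow_neg_valuation (by exact_mod_cast hsq.ne_zero),
        Padic.valuation_natCast_of_squarefree hsq hdvd, zpow_neg, zpow_one]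
    rcases h.torsion_class (ne_two_of_modEq hp i) (isSquare_neg_one_padic hp i) hnorm (hD _) (hD _)
      (mul_ne_zero (hD _) (hD _)) ⟨prodOfVec p x * prodOfVec p (x + z), by ring⟩ with
      ⟨s, s'⟩ | ⟨s, s'⟩ | ⟨s, s'⟩ | ⟨s, s'⟩
    · exact ⟨0, 0, by simpa using s, by simpa using s'⟩
    · exact ⟨0, 1, by simpa [ZMod.val_one] using s, by simpa [ZMod.val_one] using s'⟩
    · exact ⟨1, 0, by simpa [ZMod.val_one] using s, by simpa [ZMod.val_one] using s'⟩
    · exact ⟨1, 1, by simpa [ZMod.val_one] using s,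
        by simpa [ZMod.val_one, CharTwo.add_self_eq_zero] using s'⟩
  · rintro ⟨e, f, s, s'⟩
    refine .of_torsion_class two_ne_zero (isSquare_neg_one_padic hp i) (hD _) (hD _) ?_
    rcases zmod_two_cases e with rfl | rfl <;> rcases zmod_two_cases f with rfl | rfl
    · exact .inl ⟨by simpa using s, by simpa using s'⟩
    · exact .inr (.inl ⟨by simpa [ZMod.val_one] using s, by simpa [ZMod.val_one] using s'⟩)
    · exact .inr (.inr (.inl
        ⟨by simpa [ZMod.val_one] using s, by simpa [ZMod.val_one] using s'⟩))
    · exact .inr (.inr (.inr ⟨by simpa [ZMod.val_one] using s,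
        by simpa [ZMod.val_one, CharTwo.add_self_eq_zero] using s'⟩))

/-- Only the primes dividing n contribute conditions. The condition at 2 is a consequence of those,
and the other places are always solvable. -/
theorem vecTriple_mem_sel2_iff (hp : ∀ i, p i ≡ 1 [MOD 4]) (hsq : Squarefree n)
    (hprod : n = ∏ i, p i) (hn : n ≡ 1 [MOD 8]) (x z : Fin k → ZMod 2) :
    vecTriple p x (x + z) ∈ Sel2 n ↔ (x, z) ∈ monskyKernel (matA p) (vecB p) := by
  have hD : ∀ x, (prodOfVec p x : ℚ) ≠ 0 := fun x => by
    exact_mod_cast prodOfVec_ne_zero p x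
  rw [vecTriple, sqTriple_mem_sel2_iff (hD _) (hD _) (mul_ne_zero (hD _) (hD _))]
  constructor
  · rintro ⟨-, -, h⟩
    have := fun i => (dHasPoint_padic_vec_iff hp hsq hprod x z i).mp
      (by have := h (p i); push_cast at this; exact this)
    exact ⟨funext fun i => (this i).1, funext fun i => (this i).2⟩
  · rintro ⟨hz, hx⟩
    simp only at hz hx
    refine ⟨⟨prodOfVec p x * prodOfVec p (x + z), by ring⟩, ?_, fun q hq => ?_⟩
    · push_cast
      exact dHasPoint_real (prodOfVec_ne_zero p _) (prodOfVec_ne_zero p _)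
    push_cast
    by_cases hqn : q ∣ n
    · rw [hprod] at hqn
      obtain ⟨i, -, hi⟩ := (Prime.dvd_finsetProd_iff hq.out.prime _).mp hqn
      obtain rfl := (Nat.prime_dvd_prime_iff_eq hq.out Fact.out).mp hi
      exact (dHasPoint_padic_vec_iff hp hsq hprod x z i).mpr ⟨congrFun hz i, congrFun hx i⟩
    by_cases hq2 : q = 2
    · subst hq2
      refine dHasPoint_two hn (prodOfVec_modEq p hp _) (prodOfVec_modEq p hp _) ?_
      -- The vector B * z lies in the image of A, hence is orthogonal to the kernel vector 1. This
      -- makes d₁d₂ ≡ 5^(2 B·x) ≡ 1 mod 8.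
      have hBz : vecB p ⬝ᵥ z = 0 := by
        have := (exists_mulVec_eq_iff (matA_isSymm hp)).mp ⟨x, hx⟩ 1 matA_mulVec_one
        rwa [dotProduct_one] at this
      rw [← ZMod.natCast_eq_natCast_iff]
      push_cast
      rw [prodOfVec_cast_eight hp, prodOfVec_cast_eight hp, dotProduct_add, hBz, add_zero]
      generalize vecB p ⬝ᵥ x = a
      revert a
      decide
    · have hnd : ∀ x, ¬ q ∣ prodOfVec p x := fun x h =>
        hqn (h.trans (hprod ▸ prodOfVec_dvd p x))
      exact dHasPoint_padic_of_coprime hq2 hqn (hnd _) (hnd _)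

theorem vecTriple_mul (x y x' y' : Fin k → ZMod 2) :
    vecTriple p x y * vecTriple p x' y' = vecTriple p (x + x') (y + y') := by
  have hD : ∀ x, (prodOfVec p x : ℚ) ≠ 0 := fun x => by
    exact_mod_cast prodOfVec_ne_zero p x
  have hm : ∀ x x', (prodOfVec p x : ℚ) * prodOfVec p x' =
      prodOfVec p (x + x') * prodOfVec p (x * x') ^ 2 := fun x x' => by
    exact_mod_cast prodOfVec_mul p x x'
  have h3 := fun x y => mul_ne_zero (hD x) (hD y)
  rw [vecTriple, vecTriple, vecTriple, sqTriple_mul (hD _) (hD _) (h3 _ _) (hD _) (hD _) (h3 _ _),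
    sqTriple_eq_iff (h3 _ _) (h3 _ _) (mul_ne_zero (h3 _ _) (h3 _ _)) (hD _) (hD _) (h3 _ _)]
  have s : ∀ x x', IsSquare ((prodOfVec p x : ℚ) * prodOfVec p x' * prodOfVec p (x + x')) :=
    fun x x' => ⟨prodOfVec p (x + x') * prodOfVec p (x * x'), by rw [hm]; ring⟩
  refine ⟨s x x', s y y', ?_⟩
  obtain ⟨u, hu⟩ := s x x'
  obtain ⟨v, hv⟩ := s y y'
  exact ⟨u * v, by
    linear_combination prodOfVec p y * prodOfVec p y' * prodOfVec p (y + y') * hu + u * u * hv⟩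

theorem eq_zero_of_isSquare_prodOfVec (hsq : Squarefree n) (hprod : n = ∏ i, p i)
    {x : Fin k → ZMod 2} (h : IsSquare (prodOfVec p x : ℚ)) : x = 0 := by
  have hinj : Function.Injective p := injective_of_squarefree_prod (hprod ▸ hsq)
  rw [Rat.isSquare_natCast_iff] at h
  obtain ⟨r, hr⟩ := h
  have hsf : Squarefree (prodOfVec p x) :=
    hsq.squarefree_of_dvd (hprod ▸ prodOfVec_dvd p x)
  have hr1 : r = 1 := Nat.isUnit_iff.mp (hsf r ⟨1, by rw [hr, mul_one]⟩)
  apply prodOfVec_injective hinj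
  rw [hr, hr1, prodOfVec_zero]

/-- The images of (0, 0) and (-n, 0) have a negative first component, while products of the p i are
positive. The image of (n, 0) has first component 2 up to squares, and 2d ≡ 2 mod 4 is not a square.
-/
theorem vecTriple_mem_torsionImage (hp : ∀ i, p i ≡ 1 [MOD 4]) (hsq : Squarefree n)
    (hprod : n = ∏ i, p i) {x y : Fin k → ZMod 2} (h : vecTriple p x y ∈ torsionImage n) :
    x = 0 ∧ y = 0 := by
  have hD : ∀ x, (prodOfVec p x : ℚ) ≠ 0 := fun x => by
    exact_mod_cast prodOfVec_ne_zero p x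
  have hpos : ∀ x, (0 : ℚ) < prodOfVec p x := fun x =>
    lt_of_le_of_ne (Nat.cast_nonneg _) (hD x).symm
  have hn0 : (n : ℚ) ≠ 0 := by exact_mod_cast hsq.ne_zero
  have hnpos : (0 : ℚ) < n := lt_of_le_of_ne (Nat.cast_nonneg _) hn0.symm
  have hneg := neg_ne_zero.mpr hn0
  have h2n : (2 * n : ℚ) ≠ 0 := mul_ne_zero two_ne_zero hn0
  have notneg : ∀ {a : ℚ}, a < 0 → ¬ IsSquare a := fun ha hs => not_le.mpr ha hs.nonneg
  rcases (mem_torsionImage_iff hsq.ne_zero).mp h with h | h | h | h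
  · have h1 : (1 : SqClass × SqClass × SqClass) = sqTriple 1 1 1 := by
      have : sqClass 1 = 1 := by
        rw [sqClass_of_ne_zero one_ne_zero, Units.mk0_one, QuotientGroup.mk_one]
      simp only [sqTriple, this]
      rfl
    rw [h1, vecTriple, sqTriple_eq_iff (hD _) (hD _) (mul_ne_zero (hD _) (hD _)) one_ne_zero
      one_ne_zero one_ne_zero, mul_one, mul_one] at h
    exact ⟨eq_zero_of_isSquare_prodOfVec hsq hprod h.1,
      eq_zero_of_isSquare_prodOfVec hsq hprod h.2.1⟩
  · rw [torsionTripleZero, vecTriple, sqTriple_eq_iff (hD _) (hD _) (mul_ne_zero (hD _) (hD _))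
      hneg hn0 (mul_ne_zero hneg hn0)] at h
    exact absurd h.1 (notneg (mul_neg_of_pos_of_neg (hpos _) (by linarith)))
  · rw [torsionTriple, vecTriple, sqTriple_eq_iff (hD _) (hD _) (mul_ne_zero (hD _) (hD _))
      (mul_ne_zero h2n hn0) h2n hn0] at h
    have h2 : IsSquare ((2 * prodOfVec p x : ℕ) : ℚ) := by
      refine isSquare_of_mul (b := n * n) ?_ ⟨_, rfl⟩ (mul_ne_zero hn0 hn0)
      obtain ⟨u, hu⟩ := h.1
      exact ⟨u, by push_cast; linear_combination hu⟩
    rw [Rat.isSquare_natCast_iff] at h2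
    obtain ⟨r, hr⟩ := h2
    have h4 := prodOfVec_modEq p hp x
    simp only [Nat.ModEq] at h4
    have hr4 : (r * r) % 4 = 0 ∨ (r * r) % 4 = 1 := by
      have : r % 4 < 4 := Nat.mod_lt _ (by norm_num)
      rw [Nat.mul_mod]
      interval_cases r % 4 <;> simp
    omega
  · rw [torsionTripleZero, torsionTriple, sqTriple_mul hneg hn0 (mul_ne_zero hneg hn0)
      (mul_ne_zero h2n hn0) h2n hn0, vecTriple, sqTriple_eq_iff (hD _) (hD _)
      (mul_ne_zero (hD _) (hD _)) (mul_ne_zero hneg (mul_ne_zero h2n hn0)) (mul_ne_zero hn0 h2n)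
      (mul_ne_zero (mul_ne_zero hneg hn0) hn0)] at h
    refine absurd h.1 (notneg (mul_neg_of_pos_of_neg (hpos _) ?_))
    exact mul_neg_of_neg_of_pos (by linarith) (by positivity)

/-- A positive rational number with even valuations outside `n` has the class of a divisor. -/
theorem exists_sqClass_eq_prodOfVec (hsq : Squarefree n) (hprod : n = ∏ i, p i) {r : ℚ}
    (hr : 0 < r) (hev : ∀ (q : ℕ) [Fact q.Prime], ¬ q ∣ n → Even (r : ℚ_[q]).valuation) :
    ∃ x : Fin k → ZMod 2, sqClass r = sqClass (prodOfVec p x) := by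
  -- The square-free part a of numerator times denominator has the class of r. A prime dividing a
  -- has odd valuation at r, so it divides n, and a ∣ n follows.
  obtain ⟨a, b, hab, ha⟩ := Nat.sq_mul_squarefree (r.num.natAbs * r.den)
  have hnum : ((r.num.natAbs : ℕ) : ℚ) = r.num := by
    rw [← Int.cast_natCast, Int.natAbs_of_nonneg (Rat.num_pos.mpr hr).le]
  have hab' : (b : ℚ) ^ 2 * a = r * r.den ^ 2 := by
    have h1 : (b : ℚ) ^ 2 * a = r.num * r.den := by
      rw [← hnum]
      exact_mod_cast congrArg (Nat.cast : ℕ → ℚ) hab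
    rw [h1]
    have := Rat.mul_den_eq_num r
    linear_combination (-(r.den : ℚ)) * this
  have hden : (r.den : ℚ) ≠ 0 := by exact_mod_cast r.den_ne_zero
  have ha0 : (a : ℚ) ≠ 0 := by exact_mod_cast ha.ne_zero
  have hsquare : IsSquare (r * a) := by
    refine isSquare_of_mul (b := (r.den : ℚ) * r.den) ?_ ⟨_, rfl⟩ (mul_ne_zero hden hden)
    exact ⟨b * a, by linear_combination (-(a : ℚ)) * hab'⟩
  have hdvd : a ∣ n := by
    rw [← Nat.prod_primeFactors_of_squarefree ha]
    refine (Finset.prod_dvd_prod_of_subset _ _ _ ?_).trans (Nat.prod_primeFactors_dvd n)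
    intro q hq
    have hqp := Nat.prime_of_mem_primeFactors hq
    have : Fact q.Prime := ⟨hqp⟩
    rw [Nat.mem_primeFactors_of_ne_zero hsq.ne_zero]
    refine ⟨hqp, ?_⟩
    by_contra hqn
    have h1 := hev q hqn
    have hs : IsSquare ((r : ℚ_[q]) * (a : ℚ_[q])) := by
      obtain ⟨c, hc⟩ := hsquare
      exact ⟨c, by exact_mod_cast congrArg (Rat.cast : ℚ → ℚ_[q]) hc⟩
    rw [Padic.even_valuation_iff (by exact_mod_cast hr.ne') (by exact_mod_cast ha.ne_zero) hs,
      Padic.valuation_natCast_of_squarefree ha (Nat.dvd_of_mem_primeFactors hq)] at h1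
    exact absurd h1 (by decide)
  obtain ⟨x, hx⟩ := exists_prodOfVec_eq (p := p) (hprod ▸ hsq) (hprod ▸ hdvd)
  exact ⟨x, by rw [hx, sqClass_eq_iff hr.ne' ha0]; exact hsquare⟩

/-- Multiplying by the image of (0, 0) corrects the sign of d₁, and by that of (n, 0) the parity of
its valuation at 2. The local conditions make d₂ positive, make the valuations outside 2n even, and
make that of d₃ at 2 even, which passes to d₂. -/
theorem exists_torsion_mul_vecTriple (hp : ∀ i, p i ≡ 1 [MOD 4]) (hsq : Squarefree n)
    (hprod : n = ∏ i, p i) {g : SqClass × SqClass × SqClass} (hg : g ∈ Sel2 n) :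
    ∃ τ ∈ torsionImage n, ∃ x y, g = τ * vecTriple p x y := by
  have hn0 : (n : ℚ) ≠ 0 := by exact_mod_cast hsq.ne_zero
  have hnpos : (0 : ℚ) < n := lt_of_le_of_ne (Nat.cast_nonneg _) hn0.symm
  have hneg := neg_ne_zero.mpr hn0
  have h2n : (2 * n : ℚ) ≠ 0 := mul_ne_zero two_ne_zero hn0
  have hT₀ : torsionTripleZero n ∈ torsionImage n :=
    (mem_torsionImage_iff hsq.ne_zero).mpr (by simp)
  have hT₁ : torsionTriple n ∈ torsionImage n :=
    (mem_torsionImage_iff hsq.ne_zero).mpr (by simp)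
  have hnodd : ¬ 2 ∣ n := by
    rw [hprod]
    intro h
    obtain ⟨i, -, hi⟩ := (Prime.dvd_finsetProd_iff Nat.prime_two.prime _).mp h
    exact ne_two_of_modEq hp i ((Nat.prime_dvd_prime_iff_eq Nat.prime_two Fact.out).mp hi).symm
  -- the local conditions at the real place and outside `n`
  have cond : ∀ {a b c : ℚ}, a ≠ 0 → b ≠ 0 → c ≠ 0 → sqTriple a b c ∈ Sel2 n → 0 < b ∧
      IsSquare (a * b * c) ∧
      ∀ (q : ℕ) [Fact q.Prime], ¬ q ∣ n → Even (c : ℚ_[q]).valuation ∧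
        (q ≠ 2 → Even (a : ℚ_[q]).valuation ∧ Even (b : ℚ_[q]).valuation) := by
    intro a b c ha hb hc h
    obtain ⟨⟨s, hs⟩, hr, hq⟩ := (sqTriple_mem_sel2_iff ha hb hc).mp h
    have hF : ∀ (F : Type) [Field F] [CharZero F], ∃ s : F, (a : F) * b * c = s ^ 2 :=
      fun F _ _ => ⟨s, by rw [pow_two]; exact_mod_cast congrArg (Rat.cast : ℚ → F) hs⟩
    refine ⟨?_, ⟨s, hs⟩, fun q _ hqn => ?_⟩
    · exact_mod_cast hr.real_pos (by exact_mod_cast hnpos) (by exact_mod_cast ha)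
        (by exact_mod_cast hb) (by exact_mod_cast hc) (hF ℝ)
    · exact (hq q).even_valuation (Padic.norm_natCast_eq_one_iff.mpr
        ((Nat.Prime.coprime_iff_not_dvd Fact.out).mpr hqn)) (by exact_mod_cast ha)
        (by exact_mod_cast hb) (by exact_mod_cast hc) (hF _)
  -- positive triples whose first entry has even valuation at `2`
  have main : ∀ {a b c : ℚ}, a ≠ 0 → b ≠ 0 → c ≠ 0 → sqTriple a b c ∈ Sel2 n → 0 < a →
      Even (a : ℚ_[2]).valuation → ∃ x y, sqTriple a b c = vecTriple p x y := by
    intro a b c ha hb hc h hapos ha2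
    obtain ⟨hbpos, ⟨s, hs⟩, hq⟩ := cond ha hb hc h
    obtain ⟨x, hx⟩ := exists_sqClass_eq_prodOfVec hsq hprod hapos fun q _ hqn => by
      by_cases hq2 : q = 2
      · subst hq2; exact ha2
      · exact ((hq q hqn).2 hq2).1
    obtain ⟨y, hy⟩ := exists_sqClass_eq_prodOfVec hsq hprod hbpos fun q _ hqn => by
      by_cases hq2 : q = 2
      · subst hq2
        have hc2 := (hq 2 hqn).1
        have hs2 : IsSquare ((a : ℚ_[2]) * b * c) :=
          ⟨s, by exact_mod_cast congrArg (Rat.cast : ℚ → ℚ_[2]) hs⟩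
        have hab : (a : ℚ_[2]) * b ≠ 0 := by exact_mod_cast mul_ne_zero ha hb
        rw [← Padic.even_valuation_iff hab (by exact_mod_cast hc) hs2,
          Padic.valuation_mul (by exact_mod_cast ha) (by exact_mod_cast hb), Int.even_add] at hc2
        exact hc2.mp ha2
      · exact ((hq q hqn).2 hq2).2
    refine ⟨x, y, ?_⟩
    have hD : ∀ x, (prodOfVec p x : ℚ) ≠ 0 := fun x => by
      exact_mod_cast prodOfVec_ne_zero p x
    rw [vecTriple, sqTriple, sqTriple, hx, hy, sqClass_mul (hD _) (hD _), ← hx, ← hy,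
      ← sqClass_mul ha hb, (sqClass_eq_iff hc (mul_ne_zero ha hb)).mpr ⟨s, by rw [← hs]; ring⟩]
  -- remove the sign and the factor `2`
  have pos : ∀ {a b c : ℚ}, a ≠ 0 → b ≠ 0 → c ≠ 0 → sqTriple a b c ∈ Sel2 n → 0 < a →
      ∃ τ ∈ torsionImage n, ∃ x y, sqTriple a b c = τ * vecTriple p x y := by
    intro a b c ha hb hc h hapos
    by_cases ha2 : Even (a : ℚ_[2]).valuation
    · obtain ⟨x, y, hxy⟩ := main ha hb hc h hapos ha2
      exact ⟨1, Subgroup.one_mem _, x, y, by rw [one_mul, hxy]⟩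
    · have hmul := sqTriple_mul (mul_ne_zero h2n hn0) h2n hn0 ha hb hc
      have hv : Even (((2 * n * n * a : ℚ) : ℚ) : ℚ_[2]).valuation := by
        have hn2 : (n : ℚ_[2]) ≠ 0 := by exact_mod_cast hsq.ne_zero
        have h20 : (2 : ℚ_[2]) ≠ 0 := two_ne_zero
        have hv2 : (2 : ℚ_[2]).valuation = 1 := by
          exact_mod_cast Padic.valuation_p (p := 2)
        push_cast
        rw [Padic.valuation_mul (mul_ne_zero (mul_ne_zero h20 hn2) hn2) (by exact_mod_cast ha),
          Padic.valuation_mul (mul_ne_zero h20 hn2) hn2, Padic.valuation_mul h20 hn2, hv2,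
          Padic.valuation_natCast_of_not_dvd hnodd, Int.even_add]
        simpa using ha2
      obtain ⟨x, y, hxy⟩ := main (mul_ne_zero (mul_ne_zero h2n hn0) ha) (mul_ne_zero h2n hb)
        (mul_ne_zero hn0 hc)
        (hmul ▸ Subgroup.mul_mem _ (torsionTriple_mem hsq.ne_zero) h) (by positivity) hv
      refine ⟨_, hT₁, x, y, ?_⟩
      rw [← hxy, ← hmul, torsionTriple, ← mul_assoc, sqTriple_mul_self, one_mul]
  obtain ⟨a, b, c, rfl⟩ := exists_sqTriple_eq g
  rcases lt_or_gt_of_ne a.ne_zero with ha | ha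
  · have hmul := sqTriple_mul hneg hn0 (mul_ne_zero hneg hn0) a.ne_zero b.ne_zero c.ne_zero
    obtain ⟨τ, hτ, x, y, hxy⟩ := pos (mul_ne_zero hneg a.ne_zero) (mul_ne_zero hn0 b.ne_zero)
      (mul_ne_zero (mul_ne_zero hneg hn0) c.ne_zero)
      (hmul ▸ Subgroup.mul_mem _ (torsionTripleZero_mem hsq.ne_zero) hg)
      (mul_pos_of_neg_of_neg (by linarith) ha)
    refine ⟨_, Subgroup.mul_mem _ hT₀ hτ, x, y, ?_⟩
    rw [mul_assoc, ← hxy, ← hmul, torsionTripleZero, ← mul_assoc, sqTriple_mul_self, one_mul]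
  · exact pos a.ne_zero b.ne_zero c.ne_zero hg ha

end SelmerTriples

/-! ### The pure Selmer group and its generators -/

section PureSelmer

theorem card_eq_two_pow_rankF2 (V : Type*) [CommGroup V] [Finite V] (h : ∀ v : V, v ^ 2 = 1) :
    Nat.card V = 2 ^ rankF2 V h := by
  let _ : Module (ZMod 2) (Additive V) :=
    AddCommGroup.zmodModule fun v => congrArg Additive.ofMul (h v.toMul)
  have : Module.Finite (ZMod 2) (Additive V) := Module.Finite.of_finite
  have key := Module.natCard_eq_pow_finrank (K := ZMod 2) (V := Additive V)
  rw [Nat.card_zmod] at key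
  exact key

variable {k : ℕ} {p : Fin k → ℕ} {n : ℕ}

theorem sqTriple_self_eq_vecTriple (hsq : Squarefree n) (hprod : n = ∏ i, p i) :
    sqTriple n n 1 = vecTriple p 1 (1 + 0) := by
  have hn0 : (n : ℚ) ≠ 0 := by exact_mod_cast hsq.ne_zero
  rw [add_zero, vecTriple, prodOfVec_one, ← hprod,
    sqTriple_eq_iff hn0 hn0 one_ne_zero hn0 hn0 (mul_ne_zero hn0 hn0)]
  exact ⟨⟨n, rfl⟩, ⟨n, rfl⟩, ⟨n, by ring⟩⟩

variable [∀ i, Fact (p i).Prime]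

/-- The map from the Monsky kernel to the pure Selmer group. -/
noncomputable def pureSelmerMap (hp : ∀ i, p i ≡ 1 [MOD 4]) (hsq : Squarefree n)
    (hprod : n = ∏ i, p i) (hn : n ≡ 1 [MOD 8]) (q : monskyKernel (matA p) (vecB p)) :
    PureSel2 n :=
  QuotientGroup.mk ⟨vecTriple p q.1.1 (q.1.1 + q.1.2),
    (vecTriple_mem_sel2_iff hp hsq hprod hn _ _).mpr q.2⟩

theorem pureSelmerMap_bijective (hp : ∀ i, p i ≡ 1 [MOD 4]) (hsq : Squarefree n)
    (hprod : n = ∏ i, p i) (hn : n ≡ 1 [MOD 8]) :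
    Function.Bijective (pureSelmerMap hp hsq hprod hn) := by
  constructor
  · rintro ⟨⟨x, z⟩, h⟩ ⟨⟨x', z'⟩, h'⟩ he
    simp only [pureSelmerMap] at he
    rw [QuotientGroup.eq, Subgroup.mem_subgroupOf] at he
    simp only [Subgroup.coe_mul, Subgroup.coe_inv, sqTriple_inv, vecTriple_mul] at he
    obtain ⟨h1, h2⟩ := vecTriple_mem_torsionImage hp hsq hprod he
    have hx : x = x' := by
      funext i
      exact CharTwo.add_eq_zero.mp (congrFun h1 i)
    subst hx
    have hz : z = z' := by
      funext i
      have h3 : x i + z i + (x i + z' i) = 0 := congrFun h2 i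
      exact add_left_cancel (CharTwo.add_eq_zero.mp h3)
    subst hz
    rfl
  · intro v
    induction v using QuotientGroup.induction_on with | H g =>
    obtain ⟨g, hg⟩ := g
    obtain ⟨τ, hτ, x, y, rfl⟩ := exists_torsion_mul_vecTriple hp hsq hprod hg
    have hy : x + (x + y) = y := by
      funext i
      simp only [Pi.add_apply]
      rw [← add_assoc, CharTwo.add_self_eq_zero, zero_add]
    have hmem : vecTriple p x (x + (x + y)) ∈ Sel2 n := by
      rw [hy]
      have := Subgroup.mul_mem _ (torsionImage_le_sel2 hsq.ne_zero hτ) hg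
      rwa [← mul_assoc, sqTriple_mul_self, one_mul] at this
    refine ⟨⟨(x, x + y), (vecTriple_mem_sel2_iff hp hsq hprod hn _ _).mp hmem⟩, ?_⟩
    rw [pureSelmerMap, QuotientGroup.eq, Subgroup.mem_subgroupOf]
    simp only [Subgroup.coe_mul, Subgroup.coe_inv, sqTriple_inv, hy]
    rwa [mul_comm τ, ← mul_assoc, sqTriple_mul_self, one_mul]

theorem s2_eq_two_iff (hp : ∀ i, p i ≡ 1 [MOD 4]) (hsq : Squarefree n)
    (hprod : n = ∏ i, p i) (hn : n ≡ 1 [MOD 8]) :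
    s2 n = 2 ↔ Nat.card (monskyKernel (matA p) (vecB p)) = 4 := by
  have hb := pureSelmerMap_bijective hp hsq hprod hn
  have : Finite (PureSel2 n) := Finite.of_surjective _ hb.2
  rw [Nat.card_congr (Equiv.ofBijective _ hb), card_eq_two_pow_rankF2 _ (pureSel2_sq n), s2]
  exact (Nat.pow_right_injective le_rfl).eq_iff (b := 2).symm

/-- The bijection from the Monsky kernel turns sums into products, so generators may be tested on
vectors. -/
theorem pureSel2GeneratedBy_of_monskyKernel (hp : ∀ i, p i ≡ 1 [MOD 4]) (hsq : Squarefree n)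
    (hprod : n = ∏ i, p i) (hn : n ≡ 1 [MOD 8]) {x z x' z' : Fin k → ZMod 2}
    (h : (x, z) ∈ monskyKernel (matA p) (vecB p)) (h' : (x', z') ∈ monskyKernel (matA p) (vecB p))
    (hgen : ∀ q ∈ monskyKernel (matA p) (vecB p),
      q = 0 ∨ q = (x, z) ∨ q = (x', z') ∨ q = (x, z) + (x', z')) :
    PureSel2GeneratedBy n (vecTriple p x (x + z)) (vecTriple p x' (x' + z')) := by
  refine ⟨(vecTriple_mem_sel2_iff hp hsq hprod hn _ _).mpr h,
    (vecTriple_mem_sel2_iff hp hsq hprod hn _ _).mpr h', ?_⟩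
  rw [eq_top_iff]
  rintro v -
  obtain ⟨⟨q, hq⟩, rfl⟩ := (pureSelmerMap_bijective hp hsq hprod hn).2 v
  have hmul : ∀ a b : monskyKernel (matA p) (vecB p), pureSelmerMap hp hsq hprod hn (a + b) =
      pureSelmerMap hp hsq hprod hn a * pureSelmerMap hp hsq hprod hn b := by
    intro a b
    simp only [pureSelmerMap, ← QuotientGroup.mk_mul]
    congr 1
    apply Subtype.ext
    simp only [Subgroup.coe_mul, vecTriple_mul, AddSubgroup.coe_add, Prod.fst_add, Prod.snd_add]
    rw [add_add_add_comm]
  have m1 := Subgroup.subset_closure (k := {pureSelmerMap hp hsq hprod hn ⟨_, h⟩,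
    pureSelmerMap hp hsq hprod hn ⟨_, h'⟩}) (Set.mem_insert _ _)
  have m2 := Subgroup.subset_closure (k := {pureSelmerMap hp hsq hprod hn ⟨_, h⟩,
    pureSelmerMap hp hsq hprod hn ⟨_, h'⟩}) (Set.mem_insert_of_mem _ rfl)
  have m0 : pureSelmerMap hp hsq hprod hn 0 = 1 := by
    have e : vecTriple p 0 (0 + 0) = 1 := by
      rw [← sqTriple_mul_self (vecTriple p 0 0), vecTriple_mul, add_zero]
    refine (QuotientGroup.eq_one_iff _).mpr ?_
    rw [Subgroup.mem_subgroupOf]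
    change vecTriple p 0 (0 + 0) ∈ torsionImage n
    rw [e]
    exact Subgroup.one_mem _
  rcases hgen q hq with rfl | rfl | rfl | rfl
  · have e : pureSelmerMap hp hsq hprod hn ⟨0, hq⟩ = 1 := m0
    rw [e]
    exact Subgroup.one_mem _
  · exact m1
  · exact m2
  · have e : pureSelmerMap hp hsq hprod hn ⟨(x, z) + (x', z'), hq⟩ = _ := hmul ⟨_, h⟩ ⟨_, h'⟩
    rw [e]
    exact Subgroup.mul_mem _ m1 m2

theorem vecB_dotProduct_one (hp : ∀ i, p i ≡ 1 [MOD 4]) (hprod : n = ∏ i, p i)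
    (hn : n ≡ 1 [MOD 8]) : vecB p ⬝ᵥ 1 = 0 := by
  rw [vecB_dotProduct_eq_zero_iff hp, prodOfVec_one, ← hprod]
  exact hn

/-- Here |ker A| = 4 and B is not in the image, so z = 0 throughout and the Monsky kernel is ker A ×
0, spanned by (1, 0) and (x, 0). -/
theorem generators_of_rank_eq (hp : ∀ i, p i ≡ 1 [MOD 4]) (hsq : Squarefree n)
    (hprod : n = ∏ i, p i) (hn : n ≡ 1 [MOD 8])
    (h4 : Nat.card (redeiKernel (matA p) (vecB p)) = 4) (hr : (matA p).rank + 2 = k) :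
    (∃ x : Fin k → ZMod 2, (matA p).mulVec x = 0 ∧ x ≠ 0 ∧ x ≠ 1) ∧
      ∀ x : Fin k → ZMod 2, (matA p).mulVec x = 0 → x ≠ 0 → x ≠ 1 →
        PureSel2GeneratedBy n (sqTriple n n 1)
          (sqTriple (prodOfVec p x) (prodOfVec p x) (prodOfVec p x * prodOfVec p x)) := by
  have hk : k ≠ 0 := by omega
  have hA := matA_isSymm hp
  have h1 := matA_mulVec_one (p := p)
  have hB := vecB_dotProduct_one hp hprod hn
  have hc : Nat.card {x // (matA p).mulVec x = 0} = 4 := by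
    rw [card_ker_mulVec, show k - (matA p).rank = 2 by omega]
    norm_num
  have hBr : ¬ ∃ x, (matA p).mulVec x = vecB p := by
    rcases card_redeiKernel_eq_four.mp h4 with h | h
    · omega
    · exact h.2
  constructor
  · by_contra! hcon
    have hle : Nat.card {x // (matA p).mulVec x = 0} ≤
        Nat.card ({0, 1} : Finset (Fin k → ZMod 2)) := by
      refine Nat.card_mono (s := {x | (matA p).mulVec x = 0}) (Finset.finite_toSet _) ?_
      intro x hx
      by_cases h0 : x = 0
      · simp [h0]
      · simp [hcon x hx h0]
    rw [hc, Nat.card_eq_fintype_card, Fintype.card_coe] at hle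
    have := Finset.card_le_two (a := (0 : Fin k → ZMod 2)) (b := 1)
    omega
  · intro x hx hx0 hx1
    have := pureSel2GeneratedBy_of_monskyKernel hp hsq hprod hn (x := 1) (z := 0) (x' := x)
      (z' := 0) ⟨by simp, by simp [h1]⟩ ⟨by simp, by simp [hx]⟩ ?_
    · rw [sqTriple_self_eq_vecTriple hsq hprod]
      rwa [add_zero x] at this
    · rintro ⟨w, z⟩ ⟨hz, hw⟩
      simp only at hz hw
      obtain rfl := eq_zero_of_mulVec_eq_mul hk hA h1 hB hc hBr hz ⟨w, hw⟩
      rw [mul_zero] at hw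
      rcases eq_of_card_ker_eq_four hk h1 hc hx hx0 hx1 hw with rfl | rfl | rfl | rfl
      · simp
      · simp
      · simp
      · right; right; right
        simp [add_comm]

/-- Here ker A = {0, 1} and B is in the image, so the Monsky kernel is spanned by (1, 0) and (x, 1)
with A x = B. The second exponent vector x + 1 is that of n / d. -/
theorem generators_of_rank_ne (hp : ∀ i, p i ≡ 1 [MOD 4]) (hsq : Squarefree n)
    (hprod : n = ∏ i, p i) (hn : n ≡ 1 [MOD 8]) (hk : k ≠ 0)
    (h4 : Nat.card (redeiKernel (matA p) (vecB p)) = 4) (hr : (matA p).rank + 2 ≠ k) :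
    (∃ x : Fin k → ZMod 2, (matA p).mulVec x = vecB p) ∧
      ∀ x : Fin k → ZMod 2, (matA p).mulVec x = vecB p →
        PureSel2GeneratedBy n (sqTriple n n 1)
          (sqTriple (prodOfVec p x) (n / prodOfVec p x)
            (prodOfVec p x * (n / prodOfVec p x))) := by
  have h1 := matA_mulVec_one (p := p)
  have hc : Nat.card {x // (matA p).mulVec x = 0} ≠ 4 := by
    rw [card_ker_mulVec]
    intro h
    have : k - (matA p).rank = 2 := Nat.pow_right_injective le_rfl (h.trans (by norm_num))
    omega
  rcases card_redeiKernel_eq_four.mp h4 with ⟨h2, hex⟩ | h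
  swap
  · exact absurd h.1 hc
  refine ⟨hex, fun x hx => ?_⟩
  have := pureSel2GeneratedBy_of_monskyKernel hp hsq hprod hn (x := 1) (z := 0) (x' := x)
    (z' := 1) ⟨by simp, by simp [h1]⟩ ⟨h1, by simp [hx]⟩ ?_
  · rw [sqTriple_self_eq_vecTriple hsq hprod]
    have hd : (prodOfVec p x : ℚ) ≠ 0 := by exact_mod_cast prodOfVec_ne_zero p x
    have hq : (n : ℚ) / prodOfVec p x = prodOfVec p (x + 1) := by
      rw [div_eq_iff hd, hprod, ← prodOfVec_mul_add_one p x]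
      push_cast
      ring
    rw [hq]
    exact this
  · rintro ⟨w, z⟩ ⟨hz, hw⟩
    simp only at hz hw
    rcases eq_zero_or_one_of_card_ker hk h1 h2 hz with rfl | rfl
    · rw [mul_zero] at hw
      rcases eq_zero_or_one_of_card_ker hk h1 h2 hw with rfl | rfl <;> simp
    · have hwx : (matA p).mulVec (w - x) = 0 := by
        rw [Matrix.mulVec_sub, hw, hx, mul_one, sub_self]
      rcases eq_zero_or_one_of_card_ker hk h1 h2 hwx with h | h
      · rw [sub_eq_zero] at h
        simp [h]
      · rw [sub_eq_iff_eq_add] at h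
        simp [h]

theorem mainTheorem_of_card_redeiKernel (hsq : Squarefree n) (hprod : n = ∏ i, p i)
    (hn : n ≡ 1 [MOD 8]) (hp : ∀ i, p i ≡ 1 [MOD 4])
    (hh : h4 n = 1 ↔ Nat.card (redeiKernel (matA p) (vecB p)) = 4) :
    (s2 n = 2 ↔ h4 n = 1) ∧
    (h4 n = 1 →
      ((matA p).rank + 2 = k →
        (∃ x : Fin k → ZMod 2, (matA p).mulVec x = 0 ∧ x ≠ 0 ∧ x ≠ 1) ∧
        ∀ x : Fin k → ZMod 2, (matA p).mulVec x = 0 → x ≠ 0 → x ≠ 1 →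
          PureSel2GeneratedBy n (sqTriple n n 1)
            (sqTriple (prodOfVec p x) (prodOfVec p x) (prodOfVec p x * prodOfVec p x))) ∧
      ((matA p).rank + 2 ≠ k →
        (∃ x : Fin k → ZMod 2, (matA p).mulVec x = vecB p) ∧
        ∀ x : Fin k → ZMod 2, (matA p).mulVec x = vecB p →
          PureSel2GeneratedBy n (sqTriple n n 1)
            (sqTriple (prodOfVec p x) (n / prodOfVec p x)
              (prodOfVec p x * (n / prodOfVec p x))))) := by
  rw [s2_eq_two_iff hp hsq hprod hn, hh]
  -- For k = 0 the Monsky kernel has one element and A has a trivial kernel, so neither kernel has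
  -- four elements and nothing is claimed about generators.
  by_cases hk : k = 0
  · subst hk
    have hm : Nat.card (monskyKernel (matA p) (vecB p)) ≠ 4 := by
      rw [Nat.card_unique]; norm_num
    have hred : Nat.card (redeiKernel (matA p) (vecB p)) ≠ 4 := by
      rw [Ne, card_redeiKernel_eq_four]
      have : Nat.card {x // (matA p).mulVec x = 0} = 1 := by
        rw [card_ker_mulVec]; simp
      omega
    exact ⟨⟨fun h => absurd h hm, fun h => absurd h hred⟩, fun h => absurd h hred⟩
  · exact ⟨card_monskyKernel_eq_four hk (matA_isSymm hp) matA_mulVec_one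
      (vecB_dotProduct_one hp hprod hn), fun h =>
      ⟨generators_of_rank_eq hp hsq hprod hn h, generators_of_rank_ne hp hsq hprod hn hk h⟩⟩

end PureSelmer

/-! ## The ring of integers of `ℚ(√-n)` -/

section RingOfIntegers

/-- After division by the gcd of m and c, the square of the cofactor of m divides n, so that
cofactor is a unit. -/
theorem dvd_of_sq_dvd_squarefree_mul_sq {n m c : ℤ} (hn : Squarefree n) (hm : m ≠ 0)
    (h : m ^ 2 ∣ n * c ^ 2) : m ∣ c := by
  by_cases hc : c = 0
  · rw [hc]; exact dvd_zero m
  obtain ⟨g, m', c', hg, hcop, rfl, rfl⟩ : ∃ g m' c' : ℤ, g ≠ 0 ∧ IsCoprime m' c' ∧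
      m = g * m' ∧ c = g * c' := by
    have hg : (Int.gcd m c : ℤ) ≠ 0 := by
      rw [Ne, Int.natCast_eq_zero, Int.gcd_eq_zero_iff]
      exact fun h => hm h.1
    refine ⟨Int.gcd m c, m / Int.gcd m c, c / Int.gcd m c, hg, ?_, ?_, ?_⟩
    · rw [Int.isCoprime_iff_gcd_eq_one]
      exact Int.gcd_ediv_gcd_ediv_gcd (Int.gcd_pos_of_ne_zero_left _ hm)
    · rw [Int.mul_ediv_cancel' (Int.gcd_dvd_left ..)]
    · rw [Int.mul_ediv_cancel' (Int.gcd_dvd_right ..)]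
  have h' : m' ^ 2 ∣ n * c' ^ 2 := by
    rw [mul_pow, mul_pow, mul_left_comm] at h
    exact (mul_dvd_mul_iff_left (pow_ne_zero 2 hg)).mp h
  have hmn : m' * m' ∣ n := by
    rw [← pow_two]
    exact (hcop.pow (m := 2) (n := 2)).dvd_of_dvd_mul_right h'
  exact mul_dvd_mul_left g ((hn m' hmn).dvd)

/-- An element `a + b √-n` whose trace and norm are divisible by `m` and `m²` is divisible
by `m`. -/
theorem dvd_and_dvd_of_dvd_trace_of_dvd_norm {n m a b : ℤ} (hn : Squarefree n)
    (hn4 : n % 4 = 1) (hm : m ≠ 0) (ha : m ∣ 2 * a) (hab : m ^ 2 ∣ a ^ 2 + n * b ^ 2) :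
    m ∣ a ∧ m ∣ b := by
  have hb : m ∣ 2 * b := by
    apply dvd_of_sq_dvd_squarefree_mul_sq hn hm
    have h1 : m ^ 2 ∣ (2 * a) ^ 2 := pow_dvd_pow_of_dvd ha 2
    have h2 : n * (2 * b) ^ 2 = 4 * (a ^ 2 + n * b ^ 2) - (2 * a) ^ 2 := by ring
    rw [h2]
    exact dvd_sub (hab.mul_left 4) h1
  obtain ⟨u, hu⟩ := ha
  obtain ⟨v, hv⟩ := hb
  obtain ⟨w, hw⟩ := hab
  have h4 : u ^ 2 + n * v ^ 2 = 4 * w := by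
    apply mul_left_cancel₀ (pow_ne_zero 2 hm)
    linear_combination 4 * hw - (2 * a + m * u) * hu - n * (2 * b + m * v) * hv
  -- As n ≡ 1 mod 4, the sum u² + v² is divisible by 4, which excludes odd u or v. This is why no
  -- half-integers occur in the ring of integers.
  have hpar : u % 2 = 0 ∧ v % 2 = 0 := by
    have h5 : (u ^ 2 + n * v ^ 2) % 4 = 0 := by rw [h4]; simp
    rw [Int.add_emod, Int.mul_emod, hn4, one_mul, Int.emod_emod_of_dvd _ dvd_rfl, pow_two, pow_two,
      Int.mul_emod u u, Int.mul_emod v v] at h5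
    have hu4 : u % 4 = 0 ∨ u % 4 = 1 ∨ u % 4 = 2 ∨ u % 4 = 3 := by omega
    have hv4 : v % 4 = 0 ∨ v % 4 = 1 ∨ v % 4 = 2 ∨ v % 4 = 3 := by omega
    rcases hu4 with h | h | h | h <;> rcases hv4 with h' | h' | h' | h' <;>
      rw [h, h'] at h5 <;> omega
  obtain ⟨u', rfl⟩ := Int.dvd_of_emod_eq_zero hpar.1
  obtain ⟨v', rfl⟩ := Int.dvd_of_emod_eq_zero hpar.2
  exact ⟨⟨u', by linarith⟩, ⟨v', by linarith⟩⟩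

/-- The generator `√-n = i √n` of `ℚ(√-n)`. -/
noncomputable def sqrtNeg (n : ℕ) : ℂ := Complex.I * (Real.sqrt n : ℂ)

variable {n : ℕ}

theorem sqrtNeg_mul_self (n : ℕ) : sqrtNeg n * sqrtNeg n = -(n : ℂ) := by
  have h : (Real.sqrt n : ℂ) * (Real.sqrt n : ℂ) = n := by
    rw [← Complex.ofReal_mul, Real.mul_self_sqrt (Nat.cast_nonneg n), Complex.ofReal_natCast]
  unfold sqrtNeg
  linear_combination Complex.I * Complex.I * h + n * Complex.I_mul_I

theorem conj_sqrtNeg (n : ℕ) : (starRingEnd ℂ) (sqrtNeg n) = -sqrtNeg n := by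
  simp [sqrtNeg]

theorem isIntegral_sqrtNeg (A : Type*) [CommRing A] [Algebra A ℂ] (n : ℕ) :
    IsIntegral A (sqrtNeg n) := by
  refine IsIntegral.of_pow (n := 2) two_pos ?_
  rw [pow_two, sqrtNeg_mul_self]
  have := (isIntegral_algebraMap (R := A) (A := ℂ) (x := -(n : A)))
  simpa using this

instance imagQuadField_numberField (n : ℕ) : NumberField (imagQuadField n) where
  to_charZero := inferInstance
  to_finiteDimensional :=
    IntermediateField.adjoin.finiteDimensional (isIntegral_sqrtNeg ℚ n)

theorem sqrtNeg_mem (n : ℕ) : sqrtNeg n ∈ imagQuadField n :=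
  IntermediateField.mem_adjoin_simple_self ℚ _

theorem exists_rat_of_mem_imagQuadField {x : ℂ} (hx : x ∈ imagQuadField n) :
    ∃ a b : ℚ, x = a + b * sqrtNeg n := by
  have hx' : x ∈ Algebra.adjoin ℚ {sqrtNeg n} := by
    rw [← IntermediateField.adjoin_simple_toSubalgebra_of_isAlgebraic
      (isIntegral_sqrtNeg ℚ n).isAlgebraic]
    exact hx
  induction hx' using Algebra.adjoin_induction with
  | mem y hy =>
    rw [Set.mem_singleton_iff.mp hy]
    exact ⟨0, 1, by simp⟩
  | algebraMap r => exact ⟨r, 0, by simp⟩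
  | add y z hy hz h h' =>
    obtain ⟨a, b, rfl⟩ := h ((Algebra.adjoin_le_iff.mpr (by simpa using sqrtNeg_mem n) :
      Algebra.adjoin ℚ {sqrtNeg n} ≤ (imagQuadField n).toSubalgebra) hy)
    obtain ⟨c, d, rfl⟩ := h' ((Algebra.adjoin_le_iff.mpr (by simpa using sqrtNeg_mem n) :
      Algebra.adjoin ℚ {sqrtNeg n} ≤ (imagQuadField n).toSubalgebra) hz)
    exact ⟨a + c, b + d, by push_cast; ring⟩
  | mul y z hy hz h h' =>
    obtain ⟨a, b, rfl⟩ := h ((Algebra.adjoin_le_iff.mpr (by simpa using sqrtNeg_mem n) :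
      Algebra.adjoin ℚ {sqrtNeg n} ≤ (imagQuadField n).toSubalgebra) hy)
    obtain ⟨c, d, rfl⟩ := h' ((Algebra.adjoin_le_iff.mpr (by simpa using sqrtNeg_mem n) :
      Algebra.adjoin ℚ {sqrtNeg n} ≤ (imagQuadField n).toSubalgebra) hz)
    exact ⟨a * c - n * b * d, a * d + b * c, by
      push_cast
      linear_combination (b * d : ℂ) * sqrtNeg_mul_self n⟩

theorem exists_int_of_isIntegral (hsq : Squarefree n) (hn4 : n % 4 = 1) {a b : ℚ}
    (h : IsIntegral ℤ ((a : ℂ) + b * sqrtNeg n)) : ∃ u v : ℤ, a = u ∧ b = v := by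
  have hconj : IsIntegral ℤ ((a : ℂ) - b * sqrtNeg n) := by
    have := h.map ((starRingEnd ℂ).toIntAlgHom)
    convert this using 1
    simp [conj_sqrtNeg, sub_eq_add_neg]
  have toInt : ∀ r : ℚ, IsIntegral ℤ (r : ℂ) → ∃ t : ℤ, r = t := by
    intro r hr
    have : IsIntegral ℤ r :=
      (isIntegral_algebraMap_iff (algebraMap ℚ ℂ).injective).mp (by simpa using hr)
    obtain ⟨t, ht⟩ := IsIntegrallyClosed.isIntegral_iff.mp this
    exact ⟨t, by simpa using ht.symm⟩
  obtain ⟨u, hu⟩ := toInt (2 * a) (by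
    have e : ((2 * a : ℚ) : ℂ) = a + b * sqrtNeg n + (a - b * sqrtNeg n) := by
      push_cast
      ring
    rw [e]
    exact h.add hconj)
  obtain ⟨v, hv⟩ := toInt (a ^ 2 + n * b ^ 2) (by
    have e : ((a ^ 2 + n * b ^ 2 : ℚ) : ℂ) = (a + b * sqrtNeg n) * (a - b * sqrtNeg n) := by
      push_cast
      linear_combination (b : ℂ) ^ 2 * sqrtNeg_mul_self n
    rw [e]
    exact h.mul hconj)
  -- With the common denominator m, the integers m a and m b satisfy the trace and norm
  -- divisibilities by m and m², so both are divisible by m.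
  obtain ⟨m, hm⟩ : ∃ m : ℤ, m = a.den * b.den := ⟨_, rfl⟩
  have hm0 : m ≠ 0 := by
    rw [hm]
    exact mul_ne_zero (by exact_mod_cast a.den_ne_zero) (by exact_mod_cast b.den_ne_zero)
  have hmQ : (m : ℚ) ≠ 0 := by exact_mod_cast hm0
  have hA : ((a.num * b.den : ℤ) : ℚ) = m * a := by
    rw [hm]
    push_cast
    linear_combination (-(b.den : ℚ)) * Rat.mul_den_eq_num a
  have hB : ((b.num * a.den : ℤ) : ℚ) = m * b := by
    rw [hm]
    push_cast
    linear_combination (-(a.den : ℚ)) * Rat.mul_den_eq_num b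
  have hsqZ : Squarefree (n : ℤ) := Int.squarefree_natCast.mpr hsq
  obtain ⟨⟨s, hs⟩, ⟨t, ht⟩⟩ := dvd_and_dvd_of_dvd_trace_of_dvd_norm (a := a.num * b.den)
    (b := b.num * a.den) hsqZ (by omega) hm0
    ⟨u, by
      have : ((2 * (a.num * b.den) : ℤ) : ℚ) = ((m * u : ℤ) : ℚ) := by
        rw [Int.cast_mul, hA, Int.cast_mul, ← hu, Int.cast_ofNat]
        ring
      exact_mod_cast this⟩
    ⟨v, by
      have : (((a.num * b.den) ^ 2 + n * (b.num * a.den) ^ 2 : ℤ) : ℚ) = ((m ^ 2 * v : ℤ) : ℚ) := by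
        rw [Int.cast_add, Int.cast_pow, hA, Int.cast_mul (n : ℤ), Int.cast_pow, hB, Int.cast_mul,
          ← hv, Int.cast_natCast, Int.cast_pow]
        ring
      exact_mod_cast this⟩
  refine ⟨s, t, ?_, ?_⟩
  · rw [hs] at hA
    push_cast at hA
    exact (mul_left_cancel₀ hmQ hA).symm
  · rw [ht] at hB
    push_cast at hB
    exact (mul_left_cancel₀ hmQ hB).symm

/-- The embedding `ℤ[√-n] → ℚ(√-n)`. -/
noncomputable def zsqrtdToField (n : ℕ) : ℤ√(-(n : ℤ)) →+* imagQuadField n :=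
  Zsqrtd.lift ⟨⟨sqrtNeg n, sqrtNeg_mem n⟩, by
    apply Subtype.ext
    simpa using sqrtNeg_mul_self n⟩

theorem coe_zsqrtdToField (z : ℤ√(-(n : ℤ))) :
    (zsqrtdToField n z : ℂ) = z.re + z.im * sqrtNeg n := by
  simp [zsqrtdToField]

theorem zsqrtdToField_injective (hn : n ≠ 0) : Function.Injective (zsqrtdToField n) := by
  rw [injective_iff_map_eq_zero]
  intro z hz
  have h := coe_zsqrtdToField z
  rw [hz] at h
  have hz0 : ((z.re : ℂ) + z.im * sqrtNeg n) * (z.re - z.im * sqrtNeg n) = 0 := by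
    rw [← h]; simp
  have hz1 : ((z.norm : ℤ) : ℂ) = 0 := by
    rw [← hz0, Zsqrtd.norm_def]
    push_cast
    linear_combination (z.im : ℂ) ^ 2 * sqrtNeg_mul_self n
  have hneg : -(n : ℤ) < 0 := by
    have := Nat.pos_of_ne_zero hn
    omega
  exact (Zsqrtd.norm_eq_zero_iff hneg z).mp (by exact_mod_cast hz1)

theorem isIntegralClosure_zsqrtd (hsq : Squarefree n) (hn4 : n % 4 = 1) :
    let _ : Algebra (ℤ√(-(n : ℤ))) (imagQuadField n) := (zsqrtdToField n).toAlgebra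
    IsIntegralClosure (ℤ√(-(n : ℤ))) ℤ (imagQuadField n) := by
  intro _
  refine ⟨zsqrtdToField_injective hsq.ne_zero, fun {x} => ?_⟩
  have hx : IsIntegral ℤ x ↔ IsIntegral ℤ (x : ℂ) :=
    (isIntegral_algebraMap_iff (algebraMap (imagQuadField n) ℂ).injective).symm
  rw [hx]
  constructor
  · intro h
    obtain ⟨a, b, hab⟩ := exists_rat_of_mem_imagQuadField x.2
    rw [hab] at h
    obtain ⟨u, v, rfl, rfl⟩ := exists_int_of_isIntegral hsq hn4 h
    refine ⟨⟨u, v⟩, Subtype.ext ?_⟩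
    rw [hab]
    refine (coe_zsqrtdToField _).trans ?_
    simp
  · rintro ⟨y, rfl⟩
    have e : ((algebraMap (ℤ√(-(n : ℤ))) (imagQuadField n) y : imagQuadField n) : ℂ) =
        y.re + y.im * sqrtNeg n := coe_zsqrtdToField y
    rw [e]
    have hint : ∀ t : ℤ, IsIntegral ℤ (t : ℂ) := fun t => by
      simpa using isIntegral_algebraMap (R := ℤ) (A := ℂ) (x := t)
    exact (hint _).add ((hint _).mul (isIntegral_sqrtNeg ℤ n))

theorem isDedekindDomain_zsqrtd (hsq : Squarefree n) (hn4 : n % 4 = 1) :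
    IsDedekindDomain (ℤ√(-(n : ℤ))) := by
  let _ : Algebra (ℤ√(-(n : ℤ))) (imagQuadField n) := (zsqrtdToField n).toAlgebra
  have := isIntegralClosure_zsqrtd hsq hn4
  have : IsDomain (ℤ√(-(n : ℤ))) := (zsqrtdToField_injective hsq.ne_zero).isDomain
  exact IsIntegralClosure.isDedekindDomain ℤ ℚ (imagQuadField n) _

/-- The ring of integers of `ℚ(√-n)` is `ℤ[√-n]`. -/
noncomputable def ringOfIntegersEquiv (hsq : Squarefree n) (hn4 : n % 4 = 1) :
    NumberField.RingOfIntegers (imagQuadField n) ≃+* ℤ√(-(n : ℤ)) :=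
  let _ : Algebra (ℤ√(-(n : ℤ))) (imagQuadField n) := (zsqrtdToField n).toAlgebra
  have := isIntegralClosure_zsqrtd hsq hn4
  NumberField.RingOfIntegers.equiv (ℤ√(-(n : ℤ)))

end RingOfIntegers

/-! ## A ternary quadratic equation -/

section TernaryForm

/-- The composition identity (dZ² + d'Y²)(X² + dd') = d(ZX + d'Y)² + d'(YX - dZ)² turns the left
side of the hypothesis into a solution with X' = X² + n. -/
theorem ternary_of_eq_mul_add {d d' c n X Y Z : ℤ} (hn : d * d' = n) (hn0 : 0 < n)
    (h : d * Z ^ 2 + d' * Y ^ 2 = c * (X ^ 2 + n)) :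
    ∃ X' Y' Z' : ℤ, X' ≠ 0 ∧ d * Z' ^ 2 + d' * Y' ^ 2 = c * X' ^ 2 := by
  refine ⟨X ^ 2 + n, Y * X - d * Z, Z * X + d' * Y, by positivity, ?_⟩
  linear_combination (X ^ 2 + n) * h + (d * Z ^ 2 + d' * Y ^ 2) * hn

/-- Pigeonhole on the box of points with coordinates from 0 to ⌊√a⌋, ⌊√b⌋, ⌊√c⌋. As (⌊√m⌋ + 1)² > m,
the non-strict hypothesis already makes the box larger than G. -/
theorem exists_ne_small_of_card_lt {G : Type*} [AddCommGroup G] [Fintype G] (f : (ℤ × ℤ × ℤ) →+ G)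
    {a b c : ℕ} (h : Fintype.card G ^ 2 ≤ a * b * c) :
    ∃ X Y Z : ℤ, (X, Y, Z) ≠ 0 ∧ X ^ 2 ≤ a ∧ Y ^ 2 ≤ b ∧ Z ^ 2 ≤ c ∧ f (X, Y, Z) = 0 := by
  classical
  let g : Fin (a.sqrt + 1) × Fin (b.sqrt + 1) × Fin (c.sqrt + 1) → G :=
    fun q => f (q.1.1, q.2.1.1, q.2.2.1)
  have hcard : Fintype.card G <
      Fintype.card (Fin (a.sqrt + 1) × Fin (b.sqrt + 1) × Fin (c.sqrt + 1)) := by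
    rw [Fintype.card_prod, Fintype.card_prod, Fintype.card_fin, Fintype.card_fin, Fintype.card_fin]
    apply lt_of_pow_lt_pow_left₀ 2 (Nat.zero_le _)
    refine h.trans_lt ?_
    have ha := Nat.lt_succ_sqrt' a
    have hb := Nat.lt_succ_sqrt' b
    have hc := Nat.lt_succ_sqrt' c
    rw [mul_pow, mul_pow, mul_assoc]
    exact mul_lt_mul'' ha (mul_lt_mul'' hb hc (Nat.zero_le _) (Nat.zero_le _)) (Nat.zero_le _)
      (Nat.zero_le _)
  obtain ⟨q, r, hne, hqr⟩ := Fintype.exists_ne_map_eq_of_card_lt g hcard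
  have hsmall : ∀ {m : ℕ} (u v : Fin (m.sqrt + 1)), ((u.1 : ℤ) - v.1) ^ 2 ≤ m := by
    intro m u v
    have hu : (u.1 : ℤ) ≤ m.sqrt := by exact_mod_cast Nat.lt_succ_iff.mp u.2
    have hv : (v.1 : ℤ) ≤ m.sqrt := by exact_mod_cast Nat.lt_succ_iff.mp v.2
    have hm : (m.sqrt : ℤ) ^ 2 ≤ m := by exact_mod_cast Nat.sqrt_le' m
    refine le_trans (sq_le_sq' ?_ ?_) hm
    · have := Int.natCast_nonneg u.1
      linarith
    · have := Int.natCast_nonneg v.1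
      linarith
  refine ⟨q.1.1 - r.1.1, q.2.1.1 - r.2.1.1, q.2.2.1 - r.2.2.1, ?_, hsmall _ _, hsmall _ _,
    hsmall _ _, ?_⟩
  · intro h0
    simp only [Prod.mk_eq_zero, sub_eq_zero, Nat.cast_inj] at h0
    exact hne (Prod.ext (Fin.ext h0.1) (Prod.ext (Fin.ext h0.2.1) (Fin.ext h0.2.2)))
  · rw [← Prod.mk_sub_mk, ← Prod.mk_sub_mk, map_sub, sub_eq_zero]
    exact hqr

/-- The bounds place dZ² + d'Y² - cX² = nc·j between -nc and 2nc. The extreme j = -1 makes n a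
square, and j = 2 makes the square-free numbers cd and cd' squares; both force n = 1. The value j =
0 is a solution, and j = 1 is treated by the composition identity. -/
theorem ternary_solution_of_small {n d d' c : ℕ} {X Y Z : ℤ} (hsq : Squarefree n)
    (hc12 : c = 1 ∨ c = 2) (hcop : n.Coprime c) (hn1 : n ≠ 1) (hdd : d * d' = n)
    (hne : (X, Y, Z) ≠ 0) (hX : X ^ 2 ≤ n) (hY : Y ^ 2 ≤ c * d) (hZ : Z ^ 2 ≤ c * d')
    (hdvd : (n * c : ℤ) ∣ d * Z ^ 2 + d' * Y ^ 2 - c * X ^ 2) :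
    ∃ X Y Z : ℤ, X ≠ 0 ∧ d * Z ^ 2 + d' * Y ^ 2 = c * X ^ 2 := by
  obtain ⟨j, hj⟩ := hdvd
  have hd0 : 0 < d := Nat.pos_of_ne_zero fun h => hsq.ne_zero (by rw [← hdd, h, zero_mul])
  have hd0' : 0 < d' := Nat.pos_of_ne_zero fun h => hsq.ne_zero (by rw [← hdd, h, mul_zero])
  have hn0 : 0 < n := Nat.pos_of_ne_zero hsq.ne_zero
  have hnc : (0 : ℤ) < n * c := by
    have : 0 < c := by omega
    exact_mod_cast Nat.mul_pos hn0 this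
  have hdd' : (d : ℤ) * d' = n := by exact_mod_cast hdd
  have hcpos : (0 : ℤ) < c := by
    have : 0 < c := by omega
    exact_mod_cast this
  have hdpos : (0 : ℤ) < d := by exact_mod_cast hd0
  have hdpos' : (0 : ℤ) < d' := by exact_mod_cast hd0'
  have bZ : (d : ℤ) * Z ^ 2 ≤ n * c := by
    have : (d : ℤ) * (c * d') = n * c := by rw [← hdd']; ring
    rw [← this]
    exact mul_le_mul_of_nonneg_left hZ hdpos.le
  have bY : (d' : ℤ) * Y ^ 2 ≤ n * c := by
    have : (d' : ℤ) * (c * d) = n * c := by rw [← hdd']; ring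
    rw [← this]
    exact mul_le_mul_of_nonneg_left hY hdpos'.le
  have bX : (c : ℤ) * X ^ 2 ≤ n * c := by
    rw [mul_comm (n : ℤ)]
    exact mul_le_mul_of_nonneg_left hX hcpos.le
  have b0 : (0 : ℤ) ≤ d * Z ^ 2 := by positivity
  have b1 : (0 : ℤ) ≤ d' * Y ^ 2 := by positivity
  have b2 : (0 : ℤ) ≤ c * X ^ 2 := by positivity
  -- a squarefree number times `c` is a square only when it is `1`
  have hsqf : ∀ {m : ℕ} {W : ℤ}, m ∣ n → W ^ 2 = c * m → m = 1 := by
    intro m W hm hW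
    have hcm : Squarefree (c * m) := by
      have h2 : c.Coprime m := hcop.symm.coprime_dvd_right hm
      refine (Nat.squarefree_mul h2).mpr ⟨?_, hsq.squarefree_of_dvd hm⟩
      rcases hc12 with h1 | h2
      · rw [h1]; exact squarefree_one
      · rw [h2]; exact Nat.prime_two.prime.squarefree
    have hW' : W.natAbs * W.natAbs = c * m := by
      have h3 := congrArg Int.natAbs hW
      rwa [pow_two, Int.natAbs_mul, ← Nat.cast_mul, Int.natAbs_natCast] at h3
    have := Nat.isUnit_iff.mp (hcm W.natAbs ⟨1, by rw [hW', mul_one]⟩)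
    rw [this] at hW'
    exact (mul_eq_one.mp hW'.symm).2
  have hjlo : -1 ≤ j := by
    by_contra hlt
    have : n * c * j ≤ n * c * (-2) := mul_le_mul_of_nonneg_left (by omega) hnc.le
    linarith
  have hjhi : j ≤ 2 := by
    by_contra hlt
    have : n * c * 3 ≤ n * c * j := mul_le_mul_of_nonneg_left (by omega) hnc.le
    linarith
  obtain rfl | rfl | rfl | rfl : j = -1 ∨ j = 0 ∨ j = 1 ∨ j = 2 := by omega
  · exfalso
    have hXn : (c : ℤ) * X ^ 2 = c * n := by linarith
    have hX2 : X ^ 2 = n := mul_left_cancel₀ hcpos.ne' hXn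
    have hX3 : X.natAbs * X.natAbs = n := by
      have h3 := congrArg Int.natAbs hX2
      rwa [pow_two, Int.natAbs_mul, Int.natAbs_natCast] at h3
    have := Nat.isUnit_iff.mp (hsq X.natAbs ⟨1, by rw [hX3, mul_one]⟩)
    rw [this] at hX3
    exact hn1 hX3.symm
  · refine ⟨X, Y, Z, ?_, by linarith⟩
    rintro rfl
    apply hne
    have hY0 : (d' : ℤ) * Y ^ 2 = 0 := by linarith
    have hZ0 : (d : ℤ) * Z ^ 2 = 0 := by linarith
    have hY1 : Y = 0 := by simpa [hd0'.ne'] using hY0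
    have hZ1 : Z = 0 := by simpa [hd0.ne'] using hZ0
    rw [hY1, hZ1]
    rfl
  · exact ternary_of_eq_mul_add (c := (c : ℤ)) (X := X) (Y := Y) (Z := Z) hdd' (by exact_mod_cast hn0)
      (by linarith)
  · exfalso
    have hZn : (d : ℤ) * Z ^ 2 = d * (c * d') := by
      have : (d : ℤ) * (c * d') = n * c := by rw [← hdd']; ring
      linarith
    have hYn : (d' : ℤ) * Y ^ 2 = d' * (c * d) := by
      have : (d' : ℤ) * (c * d) = n * c := by rw [← hdd']; ring
      linarith
    have e1 := hsqf ⟨d, by rw [← hdd, mul_comm]⟩ (mul_left_cancel₀ hdpos.ne' hZn)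
    have e2 := hsqf ⟨d', hdd.symm⟩ (mul_left_cancel₀ hdpos'.ne' hYn)
    rw [e1, e2] at hdd
    exact hn1 hdd.symm

variable {k : ℕ} {p : Fin k → ℕ} [∀ i, Fact (p i).Prime]

/-- Solvability of `d Z² + d' Y² = 2ᵉ X²` with `d d' = n`, by the pigeonhole principle. -/
theorem exists_ternary_solution (hsq : Squarefree (∏ i, p i)) (hp : ∀ i, p i ≡ 1 [MOD 4])
    (x : Fin k → ZMod 2) (e : ZMod 2)
    (h : ∀ i, IsSquare ((2 : ZMod (p i)) ^ e.val * coprimePart p x i)) :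
    ∃ X Y Z : ℤ, X ≠ 0 ∧
      prodOfVec p x * Z ^ 2 + prodOfVec p (x + 1) * Y ^ 2 = 2 ^ e.val * X ^ 2 := by
  obtain ⟨n, hn⟩ : ∃ n, n = ∏ i, p i := ⟨_, rfl⟩
  obtain ⟨d, hd⟩ : ∃ d, d = prodOfVec p x := ⟨_, rfl⟩
  obtain ⟨d', hd'⟩ : ∃ d', d' = prodOfVec p (x + 1) := ⟨_, rfl⟩
  obtain ⟨c, hc⟩ : ∃ c : ℕ, c = 2 ^ e.val := ⟨_, rfl⟩
  have hinj := injective_of_squarefree_prod hsq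
  have hdd : d * d' = n := by rw [hd, hd', prodOfVec_mul_add_one, hn]
  have hc12 : c = 1 ∨ c = 2 := by
    rw [hc]
    rcases zmod_two_cases e with rfl | rfl
    · left; simp
    · right; simp [ZMod.val_one]
  have hd0 : 0 < d := Nat.pos_of_ne_zero (hd ▸ prodOfVec_ne_zero p x)
  have hd0' : 0 < d' := Nat.pos_of_ne_zero (hd' ▸ prodOfVec_ne_zero p _)
  have hn0 : 0 < n := hdd ▸ Nat.mul_pos hd0 hd0'
  have hodd : d % 2 = 1 ∧ d' % 2 = 1 := by
    have h1 := prodOfVec_modEq p hp x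
    have h2 := prodOfVec_modEq p hp (x + 1)
    rw [← hd] at h1
    rw [← hd'] at h2
    simp only [Nat.ModEq] at h1 h2
    omega
  rw [hn.symm] at hsq
  suffices hgoal : ∃ X Y Z : ℤ, X ≠ 0 ∧ d * Z ^ 2 + d' * Y ^ 2 = c * X ^ 2 by
    rw [← hd, ← hd']
    rw [hc] at hgoal
    exact_mod_cast hgoal
  -- The pigeonhole argument excludes its extreme cases only for n ≠ 1.
  by_cases hn1 : n = 1
  · rw [hn1] at hdd
    obtain ⟨rfl, rfl⟩ := mul_eq_one.mp hdd
    rcases hc12 with rfl | rfl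
    · exact ⟨1, 0, 1, by simp, by simp⟩
    · exact ⟨1, 1, 1, by simp, by norm_num⟩
  -- a lattice of index `c n` on which the form vanishes modulo `c n`
  choose r hr using h
  have : NeZero c := ⟨by omega⟩
  -- At p i one of d, d' vanishes and r i² is c times the other, so cX = r i Z (or r i Y) gives cX²
  -- = dZ² (or d'Y²). For c = 2 the condition on Y + Z makes the form even, as d and d' are odd.
  let f : (ℤ × ℤ × ℤ) →+ (∀ i, ZMod (p i)) × ZMod c :=
    { toFun := fun q => (fun i => c * q.1 - r i * (if x i = 0 then q.2.2 else q.2.1), q.2.1 + q.2.2)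
      map_zero' := by
        ext <;> simp
      map_add' := by
        intro q q'
        ext i
        · by_cases hx : x i = 0
          · simp [hx]; ring
          · simp [hx]; ring
        · simp; ring }
  have hcard : Fintype.card ((∀ i, ZMod (p i)) × ZMod c) = n * c := by
    rw [Fintype.card_prod, Fintype.card_pi, ZMod.card, hn]
    simp only [ZMod.card]
  obtain ⟨X, Y, Z, hne, hX, hY, hZ, hf⟩ := exists_ne_small_of_card_lt f (a := n) (b := c * d)
    (c := c * d') (by rw [hcard, ← hdd]; exact le_of_eq (by ring))
  have hfi : ∀ i, (c : ZMod (p i)) * X = r i * (if x i = 0 then (Z : ZMod (p i)) else Y) := by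
    intro i
    have := congrFun (congrArg Prod.fst hf) i
    rw [← sub_eq_zero]
    simpa [f] using this
  have hf2 : (Y : ZMod c) + Z = 0 := by
    have := congrArg Prod.snd hf
    simpa [f] using this
  have hdvdn : ∀ i, ((p i : ℕ) : ℤ) ∣ d * Z ^ 2 + d' * Y ^ 2 - c * X ^ 2 := by
    intro i
    rw [← ZMod.intCast_zmod_eq_zero_iff_dvd]
    have hc0 : (c : ZMod (p i)) ≠ 0 := by
      rw [hc]
      push_cast
      exact pow_ne_zero _ (two_cast_ne_zero hp i)
    have h1 := hfi i
    have h2 := hr i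
    have hcc : ((2 : ZMod (p i)) ^ e.val) = c := by rw [hc]; push_cast; rfl
    rw [hcc] at h2
    apply mul_left_cancel₀ hc0
    rw [mul_zero]
    push_cast
    unfold coprimePart at h2
    rcases zmod_two_cases (x i) with hx | hx
    · have hd'0 : (d' : ZMod (p i)) = 0 := by
        rw [ZMod.natCast_eq_zero_iff, hd', dvd_prodOfVec_iff hinj, Pi.add_apply, Pi.one_apply, hx]
        decide
      rw [if_pos hx] at h1 h2
      rw [← hd] at h2
      rw [hd'0]
      linear_combination (Z : ZMod (p i)) ^ 2 * h2 - (c * X + r i * Z) * h1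
    · have hx0 : ¬ x i = 0 := by rw [hx]; decide
      have hd'0 : (d : ZMod (p i)) = 0 := by
        rw [ZMod.natCast_eq_zero_iff, hd, dvd_prodOfVec_iff hinj, hx]
      rw [if_neg hx0] at h1 h2
      rw [← hd'] at h2
      rw [hd'0]
      linear_combination (Y : ZMod (p i)) ^ 2 * h2 - (c * X + r i * Y) * h1
  have hdvd_n : (n : ℤ) ∣ d * Z ^ 2 + d' * Y ^ 2 - c * X ^ 2 := by
    rw [hn]
    push_cast
    refine Finset.prod_dvd_of_coprime (fun i _ j _ hij => ?_) fun i _ => hdvdn i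
    exact Nat.isCoprime_iff_coprime.mpr
      ((Nat.coprime_primes Fact.out Fact.out).mpr fun e => hij (hinj e))
  have hdvd_c : (c : ℤ) ∣ d * Z ^ 2 + d' * Y ^ 2 - c * X ^ 2 := by
    rcases hc12 with h1 | h2
    · rw [h1]; simp
    · refine dvd_sub ?_ (dvd_mul_right _ _)
      rw [← Int.cast_add, ZMod.intCast_zmod_eq_zero_iff_dvd] at hf2
      rw [h2] at hf2 ⊢
      have e1 : (d : ℤ) * Z ^ 2 + d' * Y ^ 2 = d * ((Y + Z) * (Z - Y)) + (d + d') * Y ^ 2 := by ring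
      rw [e1]
      refine dvd_add ((hf2.mul_right _).mul_left _) (Dvd.dvd.mul_right ?_ _)
      push_cast
      omega
  have hcop : IsCoprime (n : ℤ) c := by
    rw [Nat.isCoprime_iff_coprime]
    rcases hc12 with h1 | h2
    · rw [h1]; simp
    · rw [h2, Nat.coprime_two_right, ← hdd]
      exact (Nat.odd_iff.mpr hodd.1).mul (Nat.odd_iff.mpr hodd.2)
  push_cast at hY hZ
  exact ternary_solution_of_small hsq hc12 (Nat.isCoprime_iff_coprime.mp hcop) hn1 hdd hne hX hY hZ
    (hcop.mul_dvd hdvd_n hdvd_c)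

end TernaryForm

/-! ## Ideals of `ℤ[√-n]` and complex conjugation -/

/-- The ring `ℤ[√-n]`. -/
abbrev ZSqrtNeg (n : ℕ) : Type := ℤ√(-(n : ℤ))

section Ideals

/-- If I² = J², then (I + J)² = (I + J)I, and I + J cancels. Ideals are compared below through their
squares, which are often generated by integers. -/
theorem Ideal.eq_of_sq_eq_sq {R : Type*} [CommRing R] [IsDedekindDomain R] {I J : Ideal R}
    (h : I ^ 2 = J ^ 2) : I = J := by
  have key : ∀ {I J : Ideal R}, I ^ 2 = J ^ 2 → J ≤ I := by
    intro I J h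
    by_cases hI : I = ⊥
    · rw [hI, Ideal.bot_pow two_ne_zero] at h
      have : J = ⊥ := eq_zero_of_pow_eq_zero h.symm
      rw [this]
      exact bot_le
    have hne : I ⊔ J ≠ ⊥ := fun h' => hI (eq_bot_iff.mpr (h' ▸ le_sup_left))
    have : (I ⊔ J) * (I ⊔ J) = (I ⊔ J) * I := by
      rw [Ideal.sup_mul, Ideal.mul_sup, Ideal.mul_sup, ← pow_two, ← pow_two, ← h, Ideal.sup_mul,
        ← pow_two, mul_comm J I, sup_comm (I * J) (I ^ 2), sup_idem]
    exact (le_sup_right).trans (mul_left_cancel₀ hne this).le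
  exact le_antisymm (key h.symm) (key h)

variable {n : ℕ}

/-- The conjugate of an ideal. -/
def conjIdeal (I : Ideal (ZSqrtNeg n)) : Ideal (ZSqrtNeg n) :=
  I.map (starRingEnd (ZSqrtNeg n))

theorem mem_conjIdeal {I : Ideal (ZSqrtNeg n)} {x : ZSqrtNeg n} : x ∈ conjIdeal I ↔ star x ∈ I := by
  rw [conjIdeal, Ideal.mem_map_iff_of_surjective _ 
    (fun x => ⟨star x, by rw [starRingEnd_apply, star_star]⟩)]
  constructor
  · rintro ⟨y, hy, rfl⟩
    rwa [starRingEnd_apply, star_star]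
  · intro h
    exact ⟨star x, h, by rw [starRingEnd_apply, star_star]⟩

theorem conjIdeal_mul (I J : Ideal (ZSqrtNeg n)) :
    conjIdeal (I * J) = conjIdeal I * conjIdeal J := Ideal.map_mul _ _ _

theorem conjIdeal_sup (I J : Ideal (ZSqrtNeg n)) :
    conjIdeal (I ⊔ J) = conjIdeal I ⊔ conjIdeal J := Ideal.map_sup _ _ _

theorem conjIdeal_span (x : ZSqrtNeg n) :
    conjIdeal (Ideal.span {x}) = Ideal.span {star x} := by
  rw [conjIdeal, Ideal.map_span, Set.image_singleton, starRingEnd_apply]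

theorem zsqrtd_star_intCast (m : ℤ) : star (m : ZSqrtNeg n) = m := by
  ext <;> simp

theorem zsqrtd_intCast_ne_zero {m : ℤ} (hm : m ≠ 0) : (m : ZSqrtNeg n) ≠ 0 := by
  intro h
  exact hm (by simpa using congrArg Zsqrtd.re h)

theorem span_intCast_ne_bot {m : ℤ} (hm : m ≠ 0) : Ideal.span {(m : ZSqrtNeg n)} ≠ ⊥ := by
  rw [Ne, Ideal.span_singleton_eq_bot]
  exact zsqrtd_intCast_ne_zero hm

theorem eq_of_span_intCast_eq {a b : ℤ} (ha : 0 ≤ a) (hb : 0 ≤ b)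
    (h : Ideal.span {(a : ZSqrtNeg n)} = Ideal.span {(b : ZSqrtNeg n)}) : a = b := by
  have h1 : (a : ZSqrtNeg n) ∣ b := by
    rw [← Ideal.span_singleton_le_span_singleton, h]
  have h2 : (b : ZSqrtNeg n) ∣ a := by
    rw [← Ideal.span_singleton_le_span_singleton, h]
  rw [Zsqrtd.intCast_dvd_intCast] at h1 h2
  exact Int.dvd_antisymm ha hb h1 h2

theorem zsqrtd_norm_eq (z : ZSqrtNeg n) : z.norm = z.re ^ 2 + n * z.im ^ 2 := by
  rw [Zsqrtd.norm_def]
  ring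

theorem zsqrtd_norm_nonneg (z : ZSqrtNeg n) : 0 ≤ z.norm :=
  Zsqrtd.norm_nonneg (by omega) z

theorem zsqrtd_norm_ne_zero (hn : n ≠ 0) {z : ZSqrtNeg n} (hz : z ≠ 0) : z.norm ≠ 0 := by
  intro h
  exact hz ((Zsqrtd.norm_eq_zero_iff (by omega) z).mp h)

/-- The product of an ideal and its conjugate is generated by a positive integer. -/
theorem exists_mul_conjIdeal (hsq : Squarefree n) (hn4 : n % 4 = 1) {I : Ideal (ZSqrtNeg n)}
    (hI : I ≠ ⊥) : ∃ m : ℤ, 0 < m ∧ I * conjIdeal I = Ideal.span {(m : ZSqrtNeg n)} := by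
  -- The generator m of the ideal of ℤ spanned by the norms of elements of I will generate the
  -- product of I and its conjugate.
  let H : Ideal ℤ := Ideal.span {t | ∃ x ∈ I, t = x.norm}
  obtain ⟨m, hm⟩ := (IsPrincipalIdealRing.principal H).principal
  have hmem : ∀ x ∈ I, m ∣ x.norm := by
    intro x hx
    rw [← Ideal.mem_span_singleton, ← Ideal.submodule_span_eq, ← hm]
    exact Ideal.subset_span ⟨x, hx, rfl⟩
  have hm0 : m ≠ 0 := by
    rintro rfl
    obtain ⟨x, hx, hx0⟩ := Submodule.exists_mem_ne_zero_of_ne_bot hI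
    exact zsqrtd_norm_ne_zero hsq.ne_zero hx0 (zero_dvd_iff.mp (hmem x hx))
  have hspan : I * conjIdeal I = Ideal.span {(m : ZSqrtNeg n)} := by
    apply le_antisymm
    · rw [Ideal.mul_le]
      intro x hx y hy
      rw [mem_conjIdeal] at hy
      rw [Ideal.mem_span_singleton, Zsqrtd.intCast_dvd]
      -- Polarisation of the norm makes the trace of x y divisible by m, and multiplicativity makes
      -- its norm divisible by m². Integral closedness, in the form proved above, then gives m ∣ x
      -- y.
      have htr : m ∣ 2 * (x * y).re := by
        have e : 2 * (x * y).re = (x + star y).norm - x.norm - (star y).norm := by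
          simp only [zsqrtd_norm_eq, Zsqrtd.re_mul, Zsqrtd.re_add, Zsqrtd.im_add, Zsqrtd.re_star,
            Zsqrtd.im_star]
          ring
        rw [e]
        exact dvd_sub (dvd_sub (hmem _ (I.add_mem hx hy)) (hmem _ hx)) (hmem _ hy)
      have hnm : m ^ 2 ∣ (x * y).re ^ 2 + n * (x * y).im ^ 2 := by
        rw [← zsqrtd_norm_eq, Zsqrtd.norm_mul, ← Zsqrtd.norm_conj y, pow_two]
        exact mul_dvd_mul (hmem _ hx) (hmem _ hy)
      exact dvd_and_dvd_of_dvd_trace_of_dvd_norm (Int.squarefree_natCast.mpr hsq) (by omega) hm0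
        htr hnm
    · rw [Ideal.span_singleton_le_iff_mem]
      have hle : H ≤ (I * conjIdeal I).comap (Int.castRingHom (ZSqrtNeg n)) := by
        rw [Ideal.span_le]
        rintro _ ⟨x, hx, rfl⟩
        simp only [SetLike.mem_coe, Ideal.mem_comap, eq_intCast]
        rw [Zsqrtd.norm_eq_mul_conj]
        exact Ideal.mul_mem_mul hx (mem_conjIdeal.mpr (by rwa [star_star]))
      have hmH : m ∈ H := by
        rw [hm]
        exact Submodule.mem_span_singleton_self m
      simpa using hle hmH
  rcases lt_or_gt_of_ne hm0 with h | h
  · refine ⟨-m, by omega, ?_⟩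
    rw [hspan, Int.cast_neg, Ideal.span_singleton_neg]
  · exact ⟨m, h, hspan⟩

/-! ### Ideals whose square is generated by an integer -/

/-- The ideal `(a, √-n)`. -/
def primeOver (n a : ℕ) : Ideal (ZSqrtNeg n) :=
  Ideal.span {(a : ZSqrtNeg n), (Zsqrtd.sqrtd : ZSqrtNeg n)}

/-- The ideal `(2, 1 + √-n)`. -/
def primeOverTwo (n : ℕ) : Ideal (ZSqrtNeg n) :=
  Ideal.span {(2 : ZSqrtNeg n), 1 + (Zsqrtd.sqrtd : ZSqrtNeg n)}

theorem sqrtd_mul_self : (Zsqrtd.sqrtd : ZSqrtNeg n) * Zsqrtd.sqrtd = -(n : ZSqrtNeg n) := by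
  ext <;> simp

/-- The square is generated by a², a√-n and ab up to sign, that is by a times (a, √-n, b), and a, b
are coprime. -/
theorem primeOver_sq {a b : ℕ} (hab : a * b = n) (hcop : IsCoprime (a : ℤ) (b : ℤ)) :
    primeOver n a ^ 2 = Ideal.span {(a : ZSqrtNeg n)} := by
  have hn : (n : ZSqrtNeg n) = a * b := by rw [← hab]; push_cast; rfl
  rw [primeOver, pow_two, Ideal.span_pair_mul_span_pair]
  apply le_antisymm
  · rw [Ideal.span_le]
    rintro _ (rfl | rfl | rfl | rfl) <;> rw [SetLike.mem_coe, Ideal.mem_span_singleton]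
    · exact ⟨a, rfl⟩
    · exact ⟨Zsqrtd.sqrtd, rfl⟩
    · exact ⟨Zsqrtd.sqrtd, mul_comm _ _⟩
    · exact ⟨-b, by rw [sqrtd_mul_self, hn]; ring⟩
  · rw [Ideal.span_singleton_le_iff_mem]
    obtain ⟨u, v, huv⟩ := hcop
    have huv' : (u : ZSqrtNeg n) * (a : ZSqrtNeg n) + (v : ZSqrtNeg n) * (b : ZSqrtNeg n) = 1 := by
      have := congrArg (Int.cast : ℤ → ZSqrtNeg n) huv
      push_cast at this
      exact this
    have e : (a : ZSqrtNeg n) = (u : ZSqrtNeg n) * ((a : ZSqrtNeg n) * (a : ZSqrtNeg n)) -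
        (v : ZSqrtNeg n) * (Zsqrtd.sqrtd * Zsqrtd.sqrtd) := by
      rw [sqrtd_mul_self, hn]
      linear_combination (-(a : ZSqrtNeg n)) * huv'
    generalize hI : Ideal.span (α := ZSqrtNeg n) _ = I
    rw [e, ← hI]
    exact Ideal.sub_mem _ (Ideal.mul_mem_left _ _ (Ideal.subset_span (by simp)))
      (Ideal.mul_mem_left _ _ (Ideal.subset_span (by simp)))

theorem primeOverTwo_sq (hn4 : n % 4 = 1) :
    primeOverTwo n ^ 2 = Ideal.span {(2 : ZSqrtNeg n)} := by
  obtain ⟨c, hc⟩ : ∃ c : ℕ, n = 4 * c + 1 := ⟨n / 4, by omega⟩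
  have hn : (n : ZSqrtNeg n) = 4 * c + 1 := by
    have := congrArg (Nat.cast : ℕ → ZSqrtNeg n) hc
    rw [this]
    push_cast
    rfl
  have hw := sqrtd_mul_self (n := n)
  rw [hn] at hw
  rw [primeOverTwo, pow_two, Ideal.span_pair_mul_span_pair]
  set w : ZSqrtNeg n := Zsqrtd.sqrtd
  apply le_antisymm
  · rw [Ideal.span_le]
    rintro _ (rfl | rfl | rfl | rfl) <;> rw [SetLike.mem_coe, Ideal.mem_span_singleton]
    · exact ⟨2, rfl⟩
    · exact ⟨1 + w, rfl⟩
    · exact ⟨1 + w, mul_comm _ _⟩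
    · exact ⟨w - 2 * c, by linear_combination hw⟩
  · rw [Ideal.span_singleton_le_iff_mem]
    have e : 2 * (1 + w) - (1 + w) * (1 + w) - c * (2 * 2) = (2 : ZSqrtNeg n) := by
      linear_combination -hw
    exact (congrArg (· ∈ Ideal.span {2 * 2, 2 * (1 + w), (1 + w) * 2, (1 + w) * (1 + w)}) e).mp
      (Ideal.sub_mem _ (Ideal.sub_mem _ (Ideal.subset_span (by simp))
        (Ideal.subset_span (by simp))) (Ideal.mul_mem_left _ _ (Ideal.subset_span (by simp))))

/-- The square-root property determines the ideal and makes it stable under conjugation. -/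
theorem conjIdeal_eq_of_sq [IsDedekindDomain (ZSqrtNeg n)] {I : Ideal (ZSqrtNeg n)} {s : ℤ}
    (h : I ^ 2 = Ideal.span {(s : ZSqrtNeg n)}) : conjIdeal I = I := by
  apply Ideal.eq_of_sq_eq_sq
  rw [pow_two, ← conjIdeal_mul, ← pow_two, h, conjIdeal_span, zsqrtd_star_intCast]

end Ideals

/-! ### Ideal classes of order two and squares of ideal classes -/

section IdealClasses

/-- The class of a non-zero ideal. -/
noncomputable def idealClass {R : Type*} [CommRing R] [IsDedekindDomain R] (I : Ideal R)
    (hI : I ≠ ⊥) : ClassGroup R :=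
  ClassGroup.mk0 ⟨I, mem_nonZeroDivisors_of_ne_zero hI⟩

theorem span_singleton_ne_bot {R : Type*} [CommRing R] {x : R} (hx : x ≠ 0) :
    Ideal.span {x} ≠ ⊥ := by
  rwa [Ne, Ideal.span_singleton_eq_bot]

section General

variable {R : Type*} [CommRing R] [IsDedekindDomain R]

theorem idealClass_mul {I J : Ideal R} (hI : I ≠ ⊥) (hJ : J ≠ ⊥) :
    idealClass (I * J) (mul_ne_zero hI hJ) = idealClass I hI * idealClass J hJ := by
  rw [idealClass, idealClass, idealClass, ← map_mul]
  rfl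

theorem idealClass_eq_iff {I J : Ideal R} {hI : I ≠ ⊥} {hJ : J ≠ ⊥} :
    idealClass I hI = idealClass J hJ ↔
      ∃ x y : R, x ≠ 0 ∧ y ≠ 0 ∧ Ideal.span {x} * I = Ideal.span {y} * J := by
  rw [idealClass, idealClass, ClassGroup.mk0_eq_mk0_iff]
  simp only [exists_prop]

theorem idealClass_eq_one_iff {I : Ideal R} {hI : I ≠ ⊥} :
    idealClass I hI = 1 ↔ ∃ x : R, x ≠ 0 ∧ I = Ideal.span {x} := by
  rw [idealClass, ClassGroup.mk0_eq_one_iff]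
  constructor
  · rintro ⟨x, hx⟩
    refine ⟨x, ?_, hx⟩
    rintro rfl
    exact hI (by simpa using hx)
  · rintro ⟨x, -, hx⟩
    exact ⟨x, hx⟩

theorem exists_idealClass_eq (c : ClassGroup R) : ∃ (I : Ideal R) (hI : I ≠ ⊥),
    idealClass I hI = c := by
  obtain ⟨⟨I, hI⟩, h⟩ := ClassGroup.mk0_surjective c
  exact ⟨I, nonZeroDivisors.ne_zero hI, h⟩

end General

variable {n : ℕ} [IsDedekindDomain (ZSqrtNeg n)]

/-- A class of order two contains an ideal that is stable under conjugation. -/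
theorem exists_conjIdeal_eq_self (hsq : Squarefree n) (hn4 : n % 4 = 1) {I : Ideal (ZSqrtNeg n)}
    (hI : I ≠ ⊥) (h : idealClass I hI ^ 2 = 1) :
    ∃ (J : Ideal (ZSqrtNeg n)) (hJ : J ≠ ⊥), conjIdeal J = J ∧
      idealClass J hJ = idealClass I hI := by
  rw [pow_two, ← idealClass_mul, idealClass_eq_one_iff] at h
  obtain ⟨γ, hγ, hI2⟩ := h
  obtain ⟨m, hm, hIm⟩ := exists_mul_conjIdeal hsq hn4 hI
  have hnorm : γ.norm = m ^ 2 := by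
    refine eq_of_span_intCast_eq (n := n) (zsqrtd_norm_nonneg γ) (sq_nonneg m) ?_
    rw [Zsqrtd.norm_eq_mul_conj, ← Ideal.span_singleton_mul_span_singleton, ← conjIdeal_span, ← hI2,
      conjIdeal_mul, mul_mul_mul_comm, hIm, Ideal.span_singleton_mul_span_singleton, pow_two,
      Int.cast_mul]
  have hnorm' : γ * star γ = (m : ZSqrtNeg n) * m := by
    rw [← Zsqrtd.norm_eq_mul_conj, hnorm, pow_two, Int.cast_mul]
  -- Hilbert 90 by hand: I² = (γ) and γ has norm m², so β = m + γ satisfies β m = β̄ γ, which makes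
  -- β̄ I stable under conjugation. If β = 0 then I² = (m) is I times its conjugate, and I is
  -- already stable.
  by_cases hβ : (m : ZSqrtNeg n) + γ = 0
  · refine ⟨I, hI, mul_left_cancel₀ hI ?_, rfl⟩
    rw [hIm, hI2, eq_neg_of_add_eq_zero_left hβ, Ideal.span_singleton_neg]
  · set β := (m : ZSqrtNeg n) + γ with hβdef
    have hβ' : star β ≠ 0 := star_ne_zero.mpr hβ
    refine ⟨Ideal.span {star β} * I, mul_ne_zero (span_singleton_ne_bot hβ') hI, ?_, ?_⟩
    · rw [conjIdeal_mul, conjIdeal_span, star_star]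
      refine mul_right_cancel₀ hI ?_
      rw [mul_assoc, mul_comm (conjIdeal I), hIm, mul_assoc, hI2,
        Ideal.span_singleton_mul_span_singleton, Ideal.span_singleton_mul_span_singleton]
      congr 2
      rw [hβdef, star_add, zsqrtd_star_intCast]
      linear_combination -hnorm'
    · rw [idealClass_eq_iff]
      refine ⟨1, star β, one_ne_zero, hβ', ?_⟩
      rw [Ideal.span_singleton_one, Ideal.top_mul]

/-- A conjugation stable ideal is an integer multiple of an ideal whose square is generated by a
square-free integer. -/
theorem exists_sq_eq_span_squarefree (hsq : Squarefree n) (hn4 : n % 4 = 1)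
    {J : Ideal (ZSqrtNeg n)} (hJ : J ≠ ⊥) (h : conjIdeal J = J) :
    ∃ (J' : Ideal (ZSqrtNeg n)) (hJ' : J' ≠ ⊥) (s : ℕ), Squarefree s ∧
      J' ^ 2 = Ideal.span {((s : ℤ) : ZSqrtNeg n)} ∧ idealClass J' hJ' = idealClass J hJ := by
  obtain ⟨m, hm, hJm⟩ := exists_mul_conjIdeal hsq hn4 hJ
  rw [h] at hJm
  lift m to ℕ using hm.le
  obtain ⟨s, r, hrs, hs⟩ := Nat.sq_mul_squarefree m
  have hr : (r : ℤ) ≠ 0 := by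
    rintro h0
    have : r = 0 := by exact_mod_cast h0
    subst this
    simp at hrs
    omega
  -- Since J² = (r² s), each x in J satisfies r² ∣ x², and integral closedness gives r ∣ x.
  have hle : J ≤ Ideal.span {((r : ℤ) : ZSqrtNeg n)} := by
    intro x hx
    rw [Ideal.mem_span_singleton, ← IsIntegrallyClosed.pow_dvd_pow_iff two_ne_zero]
    have hx2 : x ^ 2 ∈ J * J := by
      rw [pow_two]
      exact Ideal.mul_mem_mul hx hx
    rw [hJm, Ideal.mem_span_singleton] at hx2
    refine dvd_trans ?_ hx2
    rw [← hrs]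
    push_cast
    exact dvd_mul_right _ _
  obtain ⟨J', hJ'⟩ := Ideal.dvd_iff_le.mpr hle
  have hJ'0 : J' ≠ ⊥ := by
    rintro rfl
    exact hJ (by rw [hJ', Ideal.mul_bot])
  refine ⟨J', hJ'0, s, hs, ?_, ?_⟩
  · refine mul_left_cancel₀ (pow_ne_zero 2 (span_intCast_ne_bot (n := n) hr)) ?_
    rw [← mul_pow, ← hJ', pow_two, hJm, Ideal.span_singleton_pow,
      Ideal.span_singleton_mul_span_singleton, ← hrs]
    push_cast
    rfl
  · rw [idealClass_eq_iff]
    refine ⟨((r : ℤ) : ZSqrtNeg n), 1, zsqrtd_intCast_ne_zero hr, one_ne_zero, ?_⟩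
    rw [Ideal.span_singleton_one, Ideal.top_mul, hJ']

/-- Only ramified primes divide the square-free generator of the square of an ideal. -/
theorem dvd_two_mul_of_sq_eq_span {J : Ideal (ZSqrtNeg n)} {s : ℕ} (hn : n ≠ 0)
    (hs : Squarefree s) (h : J ^ 2 = Ideal.span {((s : ℤ) : ZSqrtNeg n)}) : s ∣ 2 * n := by
  rw [← Nat.prod_primeFactors_of_squarefree hs]
  refine dvd_trans (Finset.prod_dvd_prod_of_subset _ _ _ ?_) (Nat.prod_primeFactors_dvd (2 * n))
  intro l hl
  have hlp := Nat.prime_of_mem_primeFactors hl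
  have hls := Nat.dvd_of_mem_primeFactors hl
  rw [Nat.mem_primeFactors_of_ne_zero (by omega)]
  refine ⟨hlp, ?_⟩
  by_contra hln
  have hl2 : ¬ (l : ℤ) ∣ 2 := fun h2 => hln ((by exact_mod_cast h2 : l ∣ 2).mul_right n)
  have hln' : ¬ (l : ℤ) ∣ n := fun h2 => hln ((by exact_mod_cast h2 : l ∣ n).mul_left 2)
  have hl' : Prime (l : ℤ) := Nat.prime_iff_prime_int.mp hlp
  have hls' : (l : ℤ) ∣ s := by exact_mod_cast hls
  -- For l prime to 2n the ring modulo l is reduced, so l ∣ x² implies l ∣ x. Then l² divides s,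
  -- against square-freeness.
  have hle : J ≤ Ideal.span {((l : ℤ) : ZSqrtNeg n)} := by
    intro x hx
    have hx2 : x * x ∈ J ^ 2 := by
      rw [pow_two]
      exact Ideal.mul_mem_mul hx hx
    rw [h, Ideal.mem_span_singleton, Zsqrtd.intCast_dvd] at hx2
    have hre := hls'.trans hx2.1
    have him := hls'.trans hx2.2
    rw [Zsqrtd.re_mul] at hre
    rw [Zsqrtd.im_mul] at him
    rw [Ideal.mem_span_singleton, Zsqrtd.intCast_dvd]
    have h2 : (l : ℤ) ∣ 2 * (x.re * x.im) := by
      have e : 2 * (x.re * x.im) = x.re * x.im + x.im * x.re := by ring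
      rwa [e]
    rcases hl'.dvd_or_dvd ((hl'.dvd_or_dvd h2).resolve_left hl2) with hd | hd
    · refine ⟨hd, ?_⟩
      have h3 : (l : ℤ) ∣ n * x.im ^ 2 := by
        have := dvd_sub (hd.mul_right x.re) hre
        have e : (n : ℤ) * x.im ^ 2 = x.re * x.re - (x.re * x.re + -n * x.im * x.im) := by ring
        rwa [e]
      exact hl'.dvd_of_dvd_pow ((hl'.dvd_or_dvd h3).resolve_left hln')
    · refine ⟨?_, hd⟩
      have h3 : (l : ℤ) ∣ x.re ^ 2 := by
        have := dvd_add hre (hd.mul_left (n * x.im))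
        have e : x.re ^ 2 = x.re * x.re + -n * x.im * x.im + n * x.im * x.im := by ring
        rwa [e]
      exact hl'.dvd_of_dvd_pow h3
  obtain ⟨J', rfl⟩ := Ideal.dvd_iff_le.mpr hle
  have hdvd : Ideal.span {(((l * l : ℕ) : ℤ) : ZSqrtNeg n)} ∣
      Ideal.span {((s : ℤ) : ZSqrtNeg n)} := by
    rw [← h, mul_pow, Ideal.span_singleton_pow]
    push_cast
    rw [← pow_two]
    exact dvd_mul_right _ _
  rw [Ideal.dvd_iff_le, Ideal.span_singleton_le_span_singleton, Zsqrtd.intCast_dvd_intCast] at hdvd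
  exact hlp.not_isUnit (hs l (by exact_mod_cast hdvd))

/-- If the class of an ideal with square `(s)` is a square, then `s` is a norm up to squares. -/
theorem exists_norm_of_idealClass_eq_sq (hsq : Squarefree n) (hn4 : n % 4 = 1)
    {M : Ideal (ZSqrtNeg n)} (hM : M ≠ ⊥) {s : ℕ}
    (h : M ^ 2 = Ideal.span {((s : ℤ) : ZSqrtNeg n)}) {c : ClassGroup (ZSqrtNeg n)}
    (hc : idealClass M hM = c ^ 2) :
    ∃ t a b : ℤ, t ≠ 0 ∧ s * t ^ 2 = a ^ 2 + n * b ^ 2 := by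
  obtain ⟨K, hK, rfl⟩ := exists_idealClass_eq c
  rw [pow_two, ← idealClass_mul, idealClass_eq_iff] at hc
  obtain ⟨α, β, hα, hβ, e⟩ := hc
  obtain ⟨m, hm, hKm⟩ := exists_mul_conjIdeal hsq hn4 hK
  -- The equation (α)M = (β)K² is multiplied by its conjugate, with M stable, M² = (s) and K times
  -- its conjugate equal to (m).
  have key : α.norm * s = β.norm * (m * m) := by
    refine eq_of_span_intCast_eq (n := n) (mul_nonneg (zsqrtd_norm_nonneg α) (by omega))
      (mul_nonneg (zsqrtd_norm_nonneg β) (mul_self_nonneg m)) ?_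
    have e' := congrArg conjIdeal e
    simp only [conjIdeal_mul, conjIdeal_span, conjIdeal_eq_of_sq h] at e'
    rw [Int.cast_mul, Int.cast_mul, Int.cast_mul, Zsqrtd.norm_eq_mul_conj, Zsqrtd.norm_eq_mul_conj]
    simp only [← Ideal.span_singleton_mul_span_singleton]
    rw [← h, ← hKm, pow_two, mul_mul_mul_comm, e, e']
    ring
  -- By the preceding equality, N(αβm) = N(α)N(β)m² = s N(α)².
  refine ⟨α.norm, (α * β * m).re, (α * β * m).im, zsqrtd_norm_ne_zero hsq.ne_zero hα, ?_⟩
  rw [← zsqrtd_norm_eq, Zsqrtd.norm_mul, Zsqrtd.norm_mul, Zsqrtd.norm_intCast]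
  linear_combination α.norm * key

/-- If the square-free part of a generator of `M²` is a norm up to squares, then the class of `M`
is a square. -/
theorem idealClass_eq_sq_of_norm (hsq : Squarefree n) (hn4 : n % 4 = 1)
    {M : Ideal (ZSqrtNeg n)} (hM : M ≠ ⊥) {s : ℕ} (hs : s ≠ 0)
    (h : M ^ 2 = Ideal.span {((s : ℤ) : ZSqrtNeg n)}) {α : ZSqrtNeg n} {X : ℤ} (hX : X ≠ 0)
    (hα : α.norm = s * X ^ 2) : ∃ c : ClassGroup (ZSqrtNeg n), idealClass M hM = c ^ 2 := by
  have hs' : (s : ℤ) ≠ 0 := by exact_mod_cast hs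
  have hc : (s : ℤ) * X ≠ 0 := mul_ne_zero hs' hX
  have hα0 : α ≠ 0 := by
    rintro rfl
    exact mul_ne_zero hs' (pow_ne_zero 2 hX) (by rw [← hα]; simp)
  set C : Ideal (ZSqrtNeg n) := Ideal.span {(((s : ℤ) * X : ℤ) : ZSqrtNeg n)} with hC
  set T := Ideal.span {α} * M with hT
  have hT0 : T ≠ ⊥ := mul_ne_zero (span_singleton_ne_bot hα0) hM
  have hTT : T * conjIdeal T = C * C := by
    rw [hT, conjIdeal_mul, conjIdeal_span, conjIdeal_eq_of_sq h, mul_mul_mul_comm, ← pow_two M, h,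
      Ideal.span_singleton_mul_span_singleton, ← Zsqrtd.norm_eq_mul_conj, hα,
      Ideal.span_singleton_mul_span_singleton, hC, Ideal.span_singleton_mul_span_singleton,
      ← Int.cast_mul, ← Int.cast_mul]
    congr 3
    ring
  have hCC : conjIdeal C = C := by rw [hC, conjIdeal_span, zsqrtd_star_intCast]
  have hB0 : C ⊔ T ≠ ⊥ := fun h' => span_intCast_ne_bot hc (eq_bot_iff.mpr (h' ▸ le_sup_left))
  -- Hilbert 90 for ideals: T/C times its conjugate is 1, and the sum C + T writes T/C as C + T over
  -- its conjugate. As an ideal times its conjugate is principal, T and hence M has the class of (C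
  -- + T)².
  have hTB : T * conjIdeal (C ⊔ T) = C * (C ⊔ T) := by
    rw [conjIdeal_sup, Ideal.mul_sup, hTT, hCC, Ideal.mul_sup, mul_comm T C, sup_comm]
  obtain ⟨m, hm, hBm⟩ := exists_mul_conjIdeal hsq hn4 hB0
  refine ⟨idealClass (C ⊔ T) hB0, ?_⟩
  rw [pow_two, ← idealClass_mul, idealClass_eq_iff]
  refine ⟨m * α, ((s : ℤ) * X : ℤ), mul_ne_zero (zsqrtd_intCast_ne_zero hm.ne') hα0,
    zsqrtd_intCast_ne_zero hc, ?_⟩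
  rw [← Ideal.span_singleton_mul_span_singleton, ← hBm, mul_assoc, ← hT, ← hC, mul_assoc,
    mul_comm (conjIdeal _), hTB, mul_left_comm]

end IdealClasses

/-! ### The ramified ideals and their classes -/

/-- Common factors q are divided out repeatedly, which ends because the power of q dividing t ≠ 0 is
bounded. -/
theorem exists_primitive_norm_equation {q s n : ℤ} (hq : q ≠ 0) (hq1 : ¬ IsUnit q) {t a b : ℤ}
    (ht : t ≠ 0) (h : s * t ^ 2 = a ^ 2 + n * b ^ 2) :
    ∃ t a b : ℤ, ¬ (q ∣ t ∧ q ∣ a ∧ q ∣ b) ∧ s * t ^ 2 = a ^ 2 + n * b ^ 2 := by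
  obtain ⟨N, hN⟩ : ∃ N, ¬ q ^ N ∣ t := by
    obtain ⟨N, hN⟩ := (Int.finiteMultiplicity_iff.mpr
      ⟨fun h => hq1 (Int.isUnit_iff_natAbs_eq.mpr h), ht⟩ : FiniteMultiplicity q t)
    exact ⟨N + 1, hN⟩
  induction N generalizing t a b with
  | zero => exact absurd (by simp) hN
  | succ N ih =>
    by_cases hdvd : q ∣ t ∧ q ∣ a ∧ q ∣ b
    · obtain ⟨⟨t, rfl⟩, ⟨a, rfl⟩, ⟨b, rfl⟩⟩ := hdvd
      refine ih (t := t) (a := a) (b := b) (right_ne_zero_of_mul ht) ?_ ?_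
      · exact mul_left_cancel₀ (pow_ne_zero 2 hq) (by linear_combination h)
      · intro h'
        exact hN (by rw [pow_succ']; exact mul_dvd_mul_left q h')
    · exact ⟨t, a, b, hdvd, h⟩

section RamifiedIdeals

variable {k : ℕ} {p : Fin k → ℕ} {n : ℕ}

/-- The generator of the square of `ramifiedIdeal p n q`. -/
def ramifiedNorm (p : Fin k → ℕ) (q : (Fin k → ZMod 2) × ZMod 2) : ℕ :=
  2 ^ q.2.val * prodOfVec p q.1

theorem ramifiedNorm_mul (q q' : (Fin k → ZMod 2) × ZMod 2) : ∃ g : ℕ,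
    ramifiedNorm p q * ramifiedNorm p q' = ramifiedNorm p (q + q') * g ^ 2 := by
  have key : ∀ a b : ZMod 2, a.val + b.val = (a + b).val + (a * b).val * 2 := by decide
  refine ⟨2 ^ (q.2 * q'.2).val * prodOfVec p (q.1 * q'.1), ?_⟩
  have h2 : 2 ^ q.2.val * 2 ^ q'.2.val
      = 2 ^ (q.2 + q'.2).val * (2 ^ (q.2 * q'.2).val) ^ 2 := by
    rw [← pow_add, key, pow_add, pow_mul]
  have h := prodOfVec_mul p q.1 q'.1
  simp only [ramifiedNorm, Prod.fst_add, Prod.snd_add]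
  calc _ = (2 ^ q.2.val * 2 ^ q'.2.val) * (prodOfVec p q.1 * prodOfVec p q'.1) := by ring
    _ = _ := by rw [h2, h]; ring

/-- The product of the ramified primes selected by `q`. -/
def ramifiedIdeal (p : Fin k → ℕ) (n : ℕ) (q : (Fin k → ZMod 2) × ZMod 2) : Ideal (ZSqrtNeg n) :=
  primeOverTwo n ^ q.2.val * primeOver n (prodOfVec p q.1)

theorem isCoprime_prodOfVec (hsq : Squarefree n) (hprod : n = ∏ i, p i) (x : Fin k → ZMod 2) :
    IsCoprime (prodOfVec p x : ℤ) (prodOfVec p (x + 1) : ℤ) := by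
  rw [Nat.isCoprime_iff_coprime]
  rw [hprod, ← prodOfVec_mul_add_one p x] at hsq
  exact Nat.coprime_of_squarefree_mul hsq

theorem ramifiedIdeal_sq (hsq : Squarefree n) (hprod : n = ∏ i, p i) (hn4 : n % 4 = 1)
    (q : (Fin k → ZMod 2) × ZMod 2) :
    ramifiedIdeal p n q ^ 2 = Ideal.span {((ramifiedNorm p q : ℤ) : ZSqrtNeg n)} := by
  rw [ramifiedIdeal, mul_pow, ← pow_mul, mul_comm q.2.val, pow_mul, primeOverTwo_sq hn4,
    primeOver_sq (by rw [prodOfVec_mul_add_one, hprod]) (isCoprime_prodOfVec hsq hprod q.1),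
    Ideal.span_singleton_pow, Ideal.span_singleton_mul_span_singleton, ramifiedNorm]
  push_cast
  rfl

variable [∀ i, Fact (p i).Prime]

theorem ramifiedNorm_ne_zero (q : (Fin k → ZMod 2) × ZMod 2) : ramifiedNorm p q ≠ 0 :=
  mul_ne_zero (pow_ne_zero _ two_ne_zero) (prodOfVec_ne_zero p q.1)

theorem ramifiedIdeal_ne_bot (hsq : Squarefree n) (hprod : n = ∏ i, p i) (hn4 : n % 4 = 1)
    (q : (Fin k → ZMod 2) × ZMod 2) : ramifiedIdeal p n q ≠ ⊥ := by
  intro h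
  have hs := ramifiedIdeal_sq hsq hprod hn4 q
  rw [h, Ideal.bot_pow two_ne_zero] at hs
  exact span_intCast_ne_bot (by exact_mod_cast ramifiedNorm_ne_zero q) hs.symm

/-- A generator of the square of a ramified ideal that is a norm up to squares gives an element of
the kernel of the Rédei matrix. -/
theorem mem_redeiKernel_of_norm (hsq : Squarefree n) (hprod : n = ∏ i, p i)
    (hp : ∀ i, p i ≡ 1 [MOD 4]) (q : (Fin k → ZMod 2) × ZMod 2) {t a b : ℤ} (ht : t ≠ 0)
    (h : ramifiedNorm p q * t ^ 2 = a ^ 2 + n * b ^ 2) : q ∈ redeiKernel (matA p) (vecB p) := by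
  have hinj := injective_of_squarefree_prod (hprod ▸ hsq)
  have hmem : q ∈ redeiKernel (matA p) (vecB p) ↔ (matA p).mulVec q.1 = q.2 • vecB p := Iff.rfl
  rw [hmem]
  ext i
  suffices hs : IsSquare ((2 : ZMod (p i)) ^ q.2.val * coprimePart p q.1 i) by
    rw [← mulVec_add_mul_vecB_eq_zero_iff hp hinj, CharTwo.add_eq_zero] at hs
    simpa using hs
  have hpi : Prime (p i : ℤ) := Nat.prime_iff_prime_int.mp Fact.out
  obtain ⟨t, a, b, hprim, h⟩ := exists_primitive_norm_equation hpi.ne_zero hpi.not_isUnit ht h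
  have hcp := coprimePart_cast_ne_zero hinj q.1 i
  have hcast : ∀ z : ℤ, ((z : ℤ) : ZMod (p i)) = 0 ↔ (p i : ℤ) ∣ z :=
    fun z => ZMod.intCast_zmod_eq_zero_iff_dvd z (p i)
  have hnd : (n : ℤ) = prodOfVec p q.1 * prodOfVec p (q.1 + 1) := by
    rw [hprod, ← prodOfVec_mul_add_one p q.1]
    push_cast
    rfl
  rw [ramifiedNorm] at h
  push_cast at h
  -- If p i ∤ d, the equation modulo p i reads 2ᵉ d t² = a². If p i ∣ d, dividing it by p i first
  -- gives 2ᵉ t² = (n/d) b² modulo p i. In both cases t is a unit by primitivity.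
  rcases zmod_two_cases (q.1 i) with hx | hx
  · rw [coprimePart, if_pos hx] at hcp ⊢
    have hd' : (p i : ℤ) ∣ prodOfVec p (q.1 + 1) := by
      have : p i ∣ prodOfVec p (q.1 + 1) := by
        rw [dvd_prodOfVec_iff hinj, Pi.add_apply, hx, Pi.one_apply, zero_add]
      exact_mod_cast this
    have hd : ¬ (p i : ℤ) ∣ prodOfVec p q.1 := by
      rw [← hcast]
      simpa using hcp
    obtain ⟨e, he⟩ := hd'
    rw [he] at hnd
    -- If p i ∣ t then p i ∣ a, so p i² divides n b². As p i divides n exactly once, also p i ∣ b,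
    -- against primitivity.
    have htp : ¬ (p i : ℤ) ∣ t := by
      rintro ⟨t, rfl⟩
      have ha : (p i : ℤ) ∣ a := by
        refine hpi.dvd_of_dvd_pow (n := 2) ⟨2 ^ q.2.val * prodOfVec p q.1 * (p i * t ^ 2)
          - prodOfVec p q.1 * e * b ^ 2, ?_⟩
        linear_combination -h - b ^ 2 * hnd
      obtain ⟨a, rfl⟩ := ha
      have hb : (p i : ℤ) ∣ prodOfVec p q.1 * e * b ^ 2 := by
        refine ⟨2 ^ q.2.val * prodOfVec p q.1 * t ^ 2 - a ^ 2, ?_⟩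
        apply mul_left_cancel₀ hpi.ne_zero
        linear_combination -h - b ^ 2 * hnd
      have he' : ¬ (p i : ℤ) ∣ prodOfVec p q.1 * e := by
        rintro ⟨f, hf⟩
        have hsq' : Squarefree (n : ℤ) := Int.squarefree_natCast.mpr hsq
        refine hpi.not_isUnit (hsq' _ ⟨f, ?_⟩)
        linear_combination hnd + (p i : ℤ) * hf
      exact hprim ⟨dvd_mul_right _ _, dvd_mul_right _ _,
        hpi.dvd_of_dvd_pow ((hpi.dvd_or_dvd hb).resolve_left he')⟩
    rw [← hcast] at htp
    have hmod := congrArg (Int.cast : ℤ → ZMod (p i)) h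
    rw [hnd] at hmod
    push_cast at hmod
    refine ⟨a / t, ?_⟩
    field_simp
    rw [hmod, ZMod.natCast_self]
    ring
  · have hx0 : q.1 i ≠ 0 := by rw [hx]; decide
    rw [coprimePart, if_neg hx0] at hcp ⊢
    obtain ⟨e, he⟩ : (p i : ℤ) ∣ prodOfVec p q.1 := by
      have : p i ∣ prodOfVec p q.1 := by rw [dvd_prodOfVec_iff hinj, hx]
      exact_mod_cast this
    have hd' : ¬ (p i : ℤ) ∣ prodOfVec p (q.1 + 1) := by
      rw [← hcast]
      simpa using hcp
    have he' : ¬ (p i : ℤ) ∣ e := by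
      rintro ⟨f, rfl⟩
      have hsq' : Squarefree (n : ℤ) := Int.squarefree_natCast.mpr hsq
      refine hpi.not_isUnit (hsq' _ ⟨f * prodOfVec p (q.1 + 1), ?_⟩)
      rw [hnd, he]
      ring
    rw [he] at hnd h
    obtain ⟨a, rfl⟩ : (p i : ℤ) ∣ a := by
      refine hpi.dvd_of_dvd_pow (n := 2) ⟨2 ^ q.2.val * e * t ^ 2
        - e * prodOfVec p (q.1 + 1) * b ^ 2, ?_⟩
      linear_combination -h - b ^ 2 * hnd
    have h' : e * (2 ^ q.2.val * t ^ 2) = p i * a ^ 2 + e * (prodOfVec p (q.1 + 1) * b ^ 2) := by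
      apply mul_left_cancel₀ hpi.ne_zero
      linear_combination h + b ^ 2 * hnd
    have hmod := congrArg (Int.cast : ℤ → ZMod (p i)) h'
    push_cast at hmod
    rw [ZMod.natCast_self, zero_mul, zero_add] at hmod
    have hmod' := mul_left_cancel₀ (by rwa [Ne, hcast]) hmod
    have htp : (t : ZMod (p i)) ≠ 0 := by
      intro ht0
      rw [ht0, zero_pow two_ne_zero, mul_zero, eq_comm, mul_eq_zero] at hmod'
      have hb := pow_eq_zero_iff two_ne_zero |>.mp (hmod'.resolve_left hcp)
      exact hprim ⟨(hcast t).mp ht0, dvd_mul_right _ _, (hcast b).mp hb⟩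
    refine ⟨prodOfVec p (q.1 + 1) * b / t, ?_⟩
    field_simp
    linear_combination hmod'

variable [IsDedekindDomain (ZSqrtNeg n)]

/-- The class of a ramified ideal is a square if and only if `q` lies in the kernel of the Rédei
matrix. -/
theorem idealClass_ramifiedIdeal_isSquare_iff (hsq : Squarefree n) (hprod : n = ∏ i, p i)
    (hn4 : n % 4 = 1) (hp : ∀ i, p i ≡ 1 [MOD 4]) (q : (Fin k → ZMod 2) × ZMod 2) :
    (∃ c : ClassGroup (ZSqrtNeg n),
      idealClass (ramifiedIdeal p n q) (ramifiedIdeal_ne_bot hsq hprod hn4 q) = c ^ 2) ↔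
      q ∈ redeiKernel (matA p) (vecB p) := by
  constructor
  · rintro ⟨c, hc⟩
    obtain ⟨t, a, b, ht, h⟩ :=
      exists_norm_of_idealClass_eq_sq hsq hn4 _ (ramifiedIdeal_sq hsq hprod hn4 q) hc
    exact mem_redeiKernel_of_norm hsq hprod hp q ht h
  · intro hq
    have hinj := injective_of_squarefree_prod (hprod ▸ hsq)
    have hq' : (matA p).mulVec q.1 = q.2 • vecB p := hq
    obtain ⟨X, Y, Z, hX, h⟩ := exists_ternary_solution (hprod ▸ hsq) hp q.1 q.2 (fun i => by
      rw [← mulVec_add_mul_vecB_eq_zero_iff hp hinj, hq', Pi.smul_apply, smul_eq_mul]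
      exact CharTwo.add_self_eq_zero _)
    -- The element dZ + Y√-n has norm d(dZ² + (n/d)Y²) = 2ᵉ d X².
    refine idealClass_eq_sq_of_norm hsq hn4 _ (ramifiedNorm_ne_zero q)
      (ramifiedIdeal_sq hsq hprod hn4 q) hX (α := ⟨prodOfVec p q.1 * Z, Y⟩) ?_
    have hnd : (n : ℤ) = prodOfVec p q.1 * prodOfVec p (q.1 + 1) := by
      rw [hprod, ← prodOfVec_mul_add_one p q.1]
      push_cast
      rfl
    rw [zsqrtd_norm_eq, ramifiedNorm, hnd]
    push_cast
    linear_combination (prodOfVec p q.1 : ℤ) * h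

/-- The homomorphism sending `q` to the class of the ramified ideal attached to `q`. -/
noncomputable def ramifiedClass (hsq : Squarefree n) (hprod : n = ∏ i, p i) (hn4 : n % 4 = 1) :
    (Fin k → ZMod 2) × ZMod 2 →+ Additive (ClassGroup (ZSqrtNeg n)) :=
  AddMonoidHom.mk' (fun q => Additive.ofMul
    (idealClass (ramifiedIdeal p n q) (ramifiedIdeal_ne_bot hsq hprod hn4 q))) (by
    intro q q'
    rw [← ofMul_mul, ← idealClass_mul]
    congr 1
    obtain ⟨g, hg⟩ := ramifiedNorm_mul (p := p) q q'
    have hg0 : (g : ℤ) ≠ 0 := by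
      rintro h0
      have : g = 0 := by exact_mod_cast h0
      rw [this] at hg
      exact mul_ne_zero (ramifiedNorm_ne_zero q) (ramifiedNorm_ne_zero q') (by simpa using hg)
    rw [idealClass_eq_iff]
    refine ⟨(g : ℤ), 1, zsqrtd_intCast_ne_zero hg0, one_ne_zero, ?_⟩
    rw [Ideal.span_singleton_one, Ideal.top_mul]
    apply Ideal.eq_of_sq_eq_sq
    rw [mul_pow, mul_pow]
    simp only [ramifiedIdeal_sq hsq hprod hn4, Ideal.span_singleton_pow,
      Ideal.span_singleton_mul_span_singleton]
    congr 2
    have := congrArg (fun m : ℕ => ((m : ℤ) : ZSqrtNeg n)) hg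
    push_cast at this ⊢
    rw [this]
    ring)

/-- A class of order two contains a conjugation-stable ideal, hence an ideal whose square is (s)
with s square-free dividing 2n. A ramified ideal has the same square, so it is that ideal. -/
theorem ramifiedClass_surjective_on_two_torsion (hsq : Squarefree n) (hprod : n = ∏ i, p i)
    (hn4 : n % 4 = 1) {c : ClassGroup (ZSqrtNeg n)} (hc : c ^ 2 = 1) :
    ∃ q, ramifiedClass hsq hprod hn4 q = Additive.ofMul c := by
  obtain ⟨I, hI, rfl⟩ := exists_idealClass_eq c
  obtain ⟨J, hJ, hJc, hJI⟩ := exists_conjIdeal_eq_self hsq hn4 hI hc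
  obtain ⟨M, hM, s, hs, hMs, hMJ⟩ := exists_sq_eq_span_squarefree hsq hn4 hJ hJc
  have hs2 := dvd_two_mul_of_sq_eq_span hsq.ne_zero hs hMs
  obtain ⟨d, e, hd, hsd⟩ : ∃ (d : ℕ) (e : ZMod 2), d ∣ n ∧ s = 2 ^ e.val * d := by
    by_cases h2 : 2 ∣ s
    · obtain ⟨d, rfl⟩ := h2
      exact ⟨d, 1, (Nat.mul_dvd_mul_iff_left two_pos).mp hs2, by simp [ZMod.val_one]⟩
    · have hcop : Nat.Coprime s 2 := ((Nat.Prime.coprime_iff_not_dvd Nat.prime_two).mpr h2).symm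
      exact ⟨s, 0, hcop.dvd_of_dvd_mul_left hs2, by simp⟩
  obtain ⟨x, hx⟩ := exists_prodOfVec_eq (hprod ▸ hsq) (hprod ▸ hd)
  refine ⟨(x, e), congrArg Additive.ofMul ?_⟩
  rw [← hJI, ← hMJ]
  have : ramifiedIdeal p n (x, e) = M := by
    apply Ideal.eq_of_sq_eq_sq
    rw [ramifiedIdeal_sq hsq hprod hn4, hMs, ramifiedNorm, hx, hsd]
  simp only [this]

end RamifiedIdeals

/-! ### The relation among the ramified classes -/

section RamifiedKernel

variable {k : ℕ} {p : Fin k → ℕ} {n : ℕ}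

/-- The non-trivial relation between the classes of the ramified primes. -/
def ramifiedRelation (k n : ℕ) : (Fin k → ZMod 2) × ZMod 2 := if n = 1 then (0, 1) else (1, 0)

theorem ramifiedRelation_ne_zero (hprod : n = ∏ i, p i) : ramifiedRelation k n ≠ 0 := by
  unfold ramifiedRelation
  split_ifs with h
  · simp
  · intro h'
    apply h
    have h0 : (1 : Fin k → ZMod 2) = 0 := congrArg Prod.fst h'
    rw [hprod, ← prodOfVec_one, h0, prodOfVec_zero]

variable [∀ i, Fact (p i).Prime]

theorem vec_eq_zero_of_prod_eq_one (hprod : 1 = ∏ i, p i) (x : Fin k → ZMod 2) : x = 0 := by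
  ext i
  have : p i = 1 := Nat.dvd_one.mp (hprod ▸ Finset.dvd_prod_of_mem p (Finset.mem_univ i))
  exact absurd this (Fact.out : (p i).Prime).ne_one

theorem ramifiedRelation_mem_redeiKernel (hprod : n = ∏ i, p i) :
    ramifiedRelation k n ∈ redeiKernel (matA p) (vecB p) := by
  have hmem : ∀ q, q ∈ redeiKernel (matA p) (vecB p) ↔ (matA p).mulVec q.1 = q.2 • vecB p :=
    fun _ => Iff.rfl
  rw [hmem]
  unfold ramifiedRelation
  split_ifs with h
  · subst h
    rw [vec_eq_zero_of_prod_eq_one hprod (Matrix.mulVec _ _),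
      vec_eq_zero_of_prod_eq_one hprod (_ • _)]
  · rw [matA_mulVec_one, zero_smul]

/-- The square-free integer attached to `q` is a norm from `ℤ[√-n]` only in the trivial cases. -/
theorem eq_zero_or_eq_relation_of_norm (hsq : Squarefree n) (hprod : n = ∏ i, p i)
    (hp : ∀ i, p i ≡ 1 [MOD 4]) (q : (Fin k → ZMod 2) × ZMod 2) {a b : ℤ}
    (h : (ramifiedNorm p q : ℤ) = a ^ 2 + n * b ^ 2) : q = 0 ∨ q = ramifiedRelation k n := by
  have hinj := injective_of_squarefree_prod (hprod ▸ hsq)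
  obtain ⟨x, e⟩ := q
  have hd := prodOfVec_modEq p hp x
  have hd' := prodOfVec_modEq p hp (x + 1)
  have hdd : n = prodOfVec p x * prodOfVec p (x + 1) := by rw [prodOfVec_mul_add_one, hprod]
  have hpos : 0 < prodOfVec p x := Nat.pos_of_ne_zero (prodOfVec_ne_zero p x)
  have hx0 : prodOfVec p x = 1 → x = 0 := fun hx =>
    prodOfVec_injective hinj (by rw [hx, prodOfVec_zero])
  have hx1 : prodOfVec p (x + 1) = 1 → x = 1 := fun hx =>
    prodOfVec_injective hinj (by
      rw [prodOfVec_one, ← prodOfVec_mul_add_one p x, hx, mul_one])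
  have hbig : prodOfVec p (x + 1) = 1 ∨ 5 ≤ prodOfVec p (x + 1) := by
    unfold Nat.ModEq at hd'
    omega
  unfold ramifiedNorm at h
  -- If b = 0, the square-free number 2ᵉd is a square, hence 1.
  by_cases hb : b = 0
  · left
    have hsd : Squarefree (prodOfVec p x) := hsq.squarefree_of_dvd (hdd ▸ dvd_mul_right _ _)
    have hs : Squarefree ((2 : ℕ) ^ e.val * prodOfVec p x) := by
      rcases zmod_two_cases e with rfl | rfl
      · simpa using hsd
      · rw [ZMod.val_one, pow_one, Nat.squarefree_mul_iff]
        refine ⟨?_, Nat.prime_two.squarefree, hsd⟩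
        rw [Nat.Prime.coprime_iff_not_dvd Nat.prime_two]
        unfold Nat.ModEq at hd
        omega
    have ha : (2 : ℕ) ^ e.val * prodOfVec p x = a.natAbs * a.natAbs := by
      zify
      rw [← sq, sq_abs]
      simp only [hb] at h
      push_cast at h
      linarith
    have hau : a.natAbs = 1 := Nat.isUnit_iff.mp (hs _ ⟨1, by rw [ha, mul_one]⟩)
    rw [hau, mul_one, mul_eq_one] at ha
    refine Prod.ext (hx0 ha.2) ?_
    rcases zmod_two_cases e with rfl | rfl
    · rfl
    · exact absurd ha.1 (by decide)
  · have hb1 : 1 ≤ b ^ 2 := by have := sq_pos_of_ne_zero hb; omega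
    have hle : (n : ℤ) ≤ n * b ^ 2 := le_mul_of_one_le_right (by omega) hb1
    have hle2 : (n : ℤ) ≤ ((2 ^ e.val * prodOfVec p x : ℕ) : ℤ) := by
      rw [h]
      have := sq_nonneg a
      omega
    have hle3 : n ≤ 2 ^ e.val * prodOfVec p x := by exact_mod_cast hle2
    have h2e : 2 ^ e.val ≤ 2 := by
      rcases zmod_two_cases e with rfl | rfl <;> decide
    -- From b ≠ 0 follows n ≤ 2d, so n/d ≤ 2. Being 1 modulo 4, n/d is 1.
    have hone : prodOfVec p (x + 1) = 1 := by
      rcases hbig with h1 | h5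
      · exact h1
      · nlinarith
    have hx := hx1 hone
    rw [hone, mul_one] at hdd
    rw [← hdd] at h
    subst hx
    rcases zmod_two_cases e with rfl | rfl
    · by_cases h1 : n = 1
      · left
        subst h1
        exact Prod.ext (vec_eq_zero_of_prod_eq_one hprod _) rfl
      · right
        rw [ramifiedRelation, if_neg h1]
    · right
      have hna : (n : ℤ) ∣ a := by
        rw [← Int.squarefree_natCast] at hsq
        refine (hsq.dvd_pow_iff_dvd two_ne_zero).mp ⟨2 - b ^ 2, ?_⟩
        rw [ZMod.val_one] at h
        push_cast at h
        linear_combination -h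
      obtain ⟨c, rfl⟩ := hna
      have hn0 : (n : ℤ) ≠ 0 := by exact_mod_cast hsq.ne_zero
      -- Here 2n = a² + n b² with a = n c. As 2 is not a square, c ≠ 0, and b ≠ 0 leaves only n = 1.
      have hc : (n : ℤ) * c ^ 2 + b ^ 2 = 2 := by
        apply mul_left_cancel₀ hn0
        rw [ZMod.val_one] at h
        push_cast at h
        linear_combination -h
      have hn1 : n = 1 := by
        have hc0 : c ≠ 0 := by
          rintro rfl
          have hb2 : b ^ 2 = 2 := by linarith
          have : b.natAbs ≤ 1 := by
            by_contra hb'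
            have hb' : 2 ≤ b ∨ b ≤ -2 := by omega
            rcases hb' with hb' | hb' <;> nlinarith
          have : b = 1 ∨ b = -1 := by omega
          rcases this with rfl | rfl <;> norm_num at hb2
        have hc1 : 1 ≤ c ^ 2 := by have := sq_pos_of_ne_zero hc0; omega
        have hnc : (n : ℤ) ≤ n * c ^ 2 := le_mul_of_one_le_right (by omega) hc1
        omega
      rw [ramifiedRelation, if_pos hn1]
      subst hn1
      exact Prod.ext (vec_eq_zero_of_prod_eq_one hprod _) rfl

variable [IsDedekindDomain (ZSqrtNeg n)]

theorem ramifiedClass_eq_zero_iff_exists (hsq : Squarefree n) (hprod : n = ∏ i, p i)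
    (hn4 : n % 4 = 1) (q : (Fin k → ZMod 2) × ZMod 2) : ramifiedClass hsq hprod hn4 q = 0 ↔
      ∃ x : ZSqrtNeg n, x ≠ 0 ∧ ramifiedIdeal p n q = Ideal.span {x} :=
  idealClass_eq_one_iff (hI := ramifiedIdeal_ne_bot hsq hprod hn4 q)

/-- A generator of a principal ramified ideal has norm 2ᵉd, which is possible in two cases only.
Conversely √-n generates the product of all primes above the p i. For n = 1 it is a unit, and the
relation comes from 1 + √-1, which generates the prime above 2. -/
theorem ramifiedClass_eq_zero_iff (hsq : Squarefree n) (hprod : n = ∏ i, p i)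
    (hn4 : n % 4 = 1) (hp : ∀ i, p i ≡ 1 [MOD 4]) (q : (Fin k → ZMod 2) × ZMod 2) :
    ramifiedClass hsq hprod hn4 q = 0 ↔ q = 0 ∨ q = ramifiedRelation k n := by
  constructor
  · intro h
    obtain ⟨z, hz, hzq⟩ := (ramifiedClass_eq_zero_iff_exists hsq hprod hn4 q).mp h
    have hs := ramifiedIdeal_sq hsq hprod hn4 q
    have hconj := conjIdeal_eq_of_sq hs
    refine eq_zero_or_eq_relation_of_norm hsq hprod hp q (a := z.re) (b := z.im) ?_
    rw [← zsqrtd_norm_eq]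
    refine eq_of_span_intCast_eq (n := n) (by omega) (zsqrtd_norm_nonneg z) ?_
    rw [← hs, Zsqrtd.norm_eq_mul_conj, ← Ideal.span_singleton_mul_span_singleton, ← conjIdeal_span,
      ← hzq, hconj, pow_two]
  · rintro (rfl | rfl)
    · exact map_zero _
    · rw [ramifiedClass_eq_zero_iff_exists]
      have hw := sqrtd_mul_self (n := n)
      have hw0 : (Zsqrtd.sqrtd : ZSqrtNeg n) ≠ 0 := fun h => by
        simpa using congrArg Zsqrtd.im h
      by_cases h1 : n = 1
      · subst h1
        refine ⟨1 + Zsqrtd.sqrtd, fun h => by simpa using congrArg Zsqrtd.im h, ?_⟩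
        apply Ideal.eq_of_sq_eq_sq
        rw [ramifiedIdeal_sq hsq hprod hn4, ramifiedRelation, if_pos rfl, ramifiedNorm,
          prodOfVec_zero, Ideal.span_singleton_pow, Ideal.span_singleton_eq_span_singleton]
        refine ⟨⟨Zsqrtd.sqrtd, -Zsqrtd.sqrtd, ?_, ?_⟩, ?_⟩
        · rw [mul_neg, hw]; simp
        · rw [neg_mul, hw]; simp
        · rw [ZMod.val_one]
          push_cast at hw ⊢
          linear_combination -hw
      · refine ⟨Zsqrtd.sqrtd, hw0, ?_⟩
        apply Ideal.eq_of_sq_eq_sq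
        rw [ramifiedIdeal_sq hsq hprod hn4, ramifiedRelation, if_neg h1, ramifiedNorm,
          prodOfVec_one, ← hprod, Ideal.span_singleton_pow, pow_two, hw,
          Ideal.span_singleton_neg]
        simp

/-- The elements of order two that are squares are half as many as the elements of the kernel of
the Rédei matrix. -/
theorem card_redeiKernel_eq_two_mul (hsq : Squarefree n) (hprod : n = ∏ i, p i)
    (hn4 : n % 4 = 1) (hp : ∀ i, p i ≡ 1 [MOD 4]) :
    Nat.card (redeiKernel (matA p) (vecB p)) =
      2 * Nat.card {c : ClassGroup (ZSqrtNeg n) // c ∈ twoPowMul (ClassGroup (ZSqrtNeg n)) 1 ∧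
        c ^ 2 = 1} := by
  set φ := ramifiedClass hsq hprod hn4 with hφ
  set f := φ.comp (redeiKernel (matA p) (vecB p)).subtype with hf
  have hmem : ∀ q, q ∈ redeiKernel (matA p) (vecB p) ↔
      (φ q).toMul ∈ twoPowMul (ClassGroup (ZSqrtNeg n)) 1 := by
    intro q
    rw [← idealClass_ramifiedIdeal_isSquare_iff hsq hprod hn4 hp q]
    constructor
    · rintro ⟨c, hc⟩
      exact ⟨c, hc.symm⟩
    · rintro ⟨c, hc⟩
      exact ⟨c, hc.symm⟩
  have hker : Nat.card f.ker = 2 := by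
    rw [Nat.card_eq_two_iff]
    have hr0 := ramifiedRelation_mem_redeiKernel hprod
    refine ⟨0, ⟨⟨ramifiedRelation k n, hr0⟩, ?_⟩, ?_, ?_⟩
    · rw [AddMonoidHom.mem_ker]
      exact (ramifiedClass_eq_zero_iff hsq hprod hn4 hp _).mpr (Or.inr rfl)
    · intro h
      exact ramifiedRelation_ne_zero hprod (congrArg (fun z => (z : redeiKernel _ _).1)
        (congrArg Subtype.val h)).symm
    · rw [Set.eq_univ_iff_forall]
      rintro ⟨⟨q, hq⟩, hq'⟩
      rw [AddMonoidHom.mem_ker] at hq'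
      rcases (ramifiedClass_eq_zero_iff hsq hprod hn4 hp q).mp hq' with rfl | rfl
      · exact Or.inl rfl
      · exact Or.inr rfl
  have hrange : Nat.card f.range = Nat.card {c : ClassGroup (ZSqrtNeg n) //
      c ∈ twoPowMul (ClassGroup (ZSqrtNeg n)) 1 ∧ c ^ 2 = 1} := by
    refine Nat.card_congr ((Additive.toMul (α := ClassGroup (ZSqrtNeg n))).subtypeEquiv fun c => ?_)
    constructor
    · rintro ⟨⟨q, hq⟩, rfl⟩
      refine ⟨(hmem q).mp hq, ?_⟩
      have h2 : (2 : ℕ) • q = 0 := by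
        rw [two_nsmul]
        exact Prod.ext (funext fun i => CharTwo.add_self_eq_zero _) (CharTwo.add_self_eq_zero _)
      have := map_nsmul φ 2 q
      rw [h2, map_zero] at this
      exact congrArg Additive.toMul this.symm
    · rintro ⟨hc, hc2⟩
      obtain ⟨q, hq⟩ := ramifiedClass_surjective_on_two_torsion hsq hprod hn4 hc2
      have hq' : φ q = c := hq
      exact ⟨⟨q, (hmem q).mpr (hq' ▸ hc)⟩, hq'⟩
  -- The class map restricted to the Rédei kernel has a kernel of order two and maps onto the square
  -- classes killed by 2.
  rw [← AddSubgroup.card_mul_index f.ker, AddSubgroup.index_ker, hker, hrange]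

end RamifiedKernel

/-! ### The 4-rank of the class group -/

section FourRank

/-- In a finite commutative group, `2A / 4A` has as many elements as the `2`-torsion of `2A`. -/
theorem card_twoPowMul_quotient (A : Type*) [CommGroup A] [Finite A] :
    Nat.card (twoPowMul A 1 ⧸ (twoPowMul A 2).subgroupOf (twoPowMul A 1)) =
      Nat.card {c : A // c ∈ twoPowMul A 1 ∧ c ^ 2 = 1} := by
  -- Doubling on 2A has image 4A and kernel the 2-torsion of 2A. In a finite group the index of the
  -- image equals the order of the kernel.
  let f : twoPowMul A 1 →* twoPowMul A 1 := powMonoidHom 2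
  have hrange : f.range = (twoPowMul A 2).subgroupOf (twoPowMul A 1) := by
    ext ⟨c, hc⟩
    rw [Subgroup.mem_subgroupOf]
    constructor
    · rintro ⟨⟨_, b, rfl⟩, hb⟩
      refine ⟨b, ?_⟩
      have := congrArg Subtype.val hb
      simpa [f, ← pow_mul] using this
    · rintro ⟨b, hb⟩
      refine ⟨⟨b ^ 2, b, by simp⟩, Subtype.ext ?_⟩
      simpa [f, ← pow_mul] using hb
  have hker : Nat.card f.ker = Nat.card {c : A // c ∈ twoPowMul A 1 ∧ c ^ 2 = 1} := by
    refine Nat.card_congr ⟨fun c => ⟨c.1.1, c.1.2, congrArg Subtype.val c.2⟩,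
      fun c => ⟨⟨c.1, c.2.1⟩, Subtype.ext c.2.2⟩, fun _ => rfl, fun _ => rfl⟩
  have h1 := Subgroup.card_mul_index f.ker
  have h2 := Subgroup.card_mul_index f.range
  rw [Subgroup.index_ker] at h1
  have h3 : f.range.index = Nat.card f.ker := by
    have hpos : 0 < Nat.card f.range := Nat.card_pos
    exact Nat.eq_of_mul_eq_mul_left hpos (by rw [h2, ← h1, mul_comm])
  rw [← hker, ← h3, hrange]
  rfl

theorem card_two_torsion_congr {A B : Type*} [CommGroup A] [CommGroup B] (e : A ≃* B) :
    Nat.card {c : A // c ∈ twoPowMul A 1 ∧ c ^ 2 = 1} =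
      Nat.card {c : B // c ∈ twoPowMul B 1 ∧ c ^ 2 = 1} := by
  refine Nat.card_congr (e.toEquiv.subtypeEquiv fun c => and_congr ?_ ?_)
  · constructor
    · rintro ⟨b, rfl⟩
      exact ⟨e b, by simp⟩
    · rintro ⟨b, hb⟩
      refine ⟨e.symm b, e.injective ?_⟩
      simpa using hb
  · simp [← map_pow]

/-- The Rédei kernel has 2 · 2^{h₄} elements, after transport of the class group along the
isomorphism of the ring of integers with ℤ[√-n]. -/
theorem h4_eq_one_iff {k n : ℕ} {p : Fin k → ℕ} [∀ i, Fact (p i).Prime] (hsq : Squarefree n)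
    (hprod : n = ∏ i, p i) (hn4 : n % 4 = 1) (hp : ∀ i, p i ≡ 1 [MOD 4]) :
    h4 n = 1 ↔ Nat.card (redeiKernel (matA p) (vecB p)) = 4 := by
  have : IsDedekindDomain (ZSqrtNeg n) := isDedekindDomain_zsqrtd hsq hn4
  have hcard := card_eq_two_pow_rankF2 _ (twoPowMul_quot_sq (classGroupOf n) 1)
  rw [card_twoPowMul_quotient,
    card_two_torsion_congr (ClassGroup.mulEquiv (ringOfIntegersEquiv hsq hn4))] at hcard
  rw [card_redeiKernel_eq_two_mul hsq hprod hn4 hp, hcard]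
  change h4 n = 1 ↔ 2 * 2 ^ h4 n = 4
  rw [← pow_succ', show (4 : ℕ) = 2 ^ 2 by norm_num, Nat.pow_right_inj one_lt_two]
  omega

end FourRank

theorem mainTheorem6 (n k : ℕ) (p : Fin k → ℕ) [∀ i, Fact (p i).Prime]
    (hsq : Squarefree n) (hprod : n = ∏ i, p i) (hn : n ≡ 1 [MOD 8])
    (hp : ∀ i, p i ≡ 1 [MOD 4]) :
    (s2 n = 2 ↔ h4 n = 1) ∧
    (h4 n = 1 →
      ((matA p).rank + 2 = k →
        (∃ x : Fin k → ZMod 2, (matA p).mulVec x = 0 ∧ x ≠ 0 ∧ x ≠ 1) ∧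
        ∀ x : Fin k → ZMod 2, (matA p).mulVec x = 0 → x ≠ 0 → x ≠ 1 →
          PureSel2GeneratedBy n (sqTriple n n 1)
            (sqTriple (prodOfVec p x) (prodOfVec p x) (prodOfVec p x * prodOfVec p x))) ∧
      ((matA p).rank + 2 ≠ k →
        (∃ x : Fin k → ZMod 2, (matA p).mulVec x = vecB p) ∧
        ∀ x : Fin k → ZMod 2, (matA p).mulVec x = vecB p →
          PureSel2GeneratedBy n (sqTriple n n 1)
            (sqTriple (prodOfVec p x) (n / prodOfVec p x)
              (prodOfVec p x * (n / prodOfVec p x))))) := by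
  exact mainTheorem_of_card_redeiKernel hsq hprod hn hp
    (h4_eq_one_iff hsq hprod (by unfold Nat.ModEq at hn; omega) hp)
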